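/- Let $d\ge1$, $\mathbb M=\mathbb R^d$, $\Omega=(0,1)^d$ with Lebesgue measure, $\mathbb H=L^2(\Omega;\mathbb R^d)$, and let $T>0$, $N\ge2$, $m_*,\lambda_0\in\mathbb R$, $\kappa_0,\lambda_1,\kappa_3>0$. Assume: * $\tilde{\mathcal F},\tilde{\mathcal U}_0:\mathbb H\to\mathbb R$ are Fréchet differentiable with $\kappa_0$-Lipschitz gradients, are rearrangement invariant (they take the same value at $x$ and $y$ whenever $x,y$ have the same law), $\tilde{\mathcal F}\ge0$, $\tilde{\mathcal U}_0\ge m_*$, and $\tilde{\mathcal U}_0$ is convex; * $H,L\in C^{N+1}(\mathbb M\times\mathbb R^d)$, $L\ge0$, $H(q,\cdot)$ and $L(q,\cdot)$ are Legendre transforms of each other for every $q$, $D^2_{vv}L\ge\kappa_3I_d$, $D^2_{pp}H>0$, $DH$ and $DL$ are $\kappa_0$-Lipschitz, and $\lambda_1|v|^2+\lambda_0\le L(q,v)$; * $\tilde{\mathcal L}(x,a)=\int_\Omega L(x(\omega),a(\omega))\,d\omega+\tilde{\mathcal F}(x)$ is jointly strictly convex on $\mathbb H\times\mathbb H$. Put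 $$\tilde{\mathcal U}(t,y)=\inf\Big\{\tilde{\mathcal U}_0(S(0))+\int_0^t\tilde{\mathcal L}(S,\dot S)\,ds\ :\ S\in AC_2(0,t;\mathbb H),\ S(t)=y\Big\}.$$ For each integer $m\ge1$ fix a partition $(\Omega^m_i)_{i=1}^m$ of $\Omega$ into Borel sets of equal volume, and for $q=(q_1,\dots,q_m)\in\mathbb M^m$ put $M^q=\sum_iq_i\chi_{\Omega^m_i}$, $F^{(m)}(q)=\tilde{\mathcal F}(M^q)$, $U_0^{(m)}(q)=\tilde{\mathcal U}_0(M^q)$, $U^{(m)}(t,q)=\tilde{\mathcal U}(t,M^q)$, $H^{(m)}(q,p)=\frac1m\sum_iH(q_i,mp_i)$ and $\mathbb B_r^m=\{q\in\mathbb M^m:\frac1m\sum_j|q_j|^2\le r^2\}$. For $G:\mathbb M^m\to\mathbb R$ and $r,C>0$ consider the estimates * (E1) $G\in C^1$ and $\sum_{i=1}^mm|D_{q_i}G(q)|^2\le C$ for $q\in\mathbb B_r^m$; * (E2) $G\in C^2$ and, for $q\in\mathbb B^m_r$, all entries of $D^2_{q_iq_j}G(q)$ are bounded in absolute value by $Cm^{-1}$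 if $i=j$ and by $Cm^{-2}$ if $i\ne j$; * (E3) $G\in C^3$ and, for $q\in\mathbb B^m_r$, all entries of $D^3_{q_iq_jq_k}G(q)$ are bounded in absolute value by $Cm^{-1}$ if $i=j=k$ and by $Cm^{-2}$ otherwise. Assume finally that $F^{(m)},U_0^{(m)}\in C^3(\mathbb M^m)$ for all $m$ and that, for a positive nondecreasing function $C_0$ on $(0,\infty)$, they satisfy (E2) with constant $C_0(r)$ for all $m\ge1$ and $r>0$. Then, for every $m\ge1$, $U^{(m)}$ is a continuous viscosity solution of $\partial_tU^{(m)}+H^{(m)}(q,D_qU^{(m)})-F^{(m)}(q)=0$ on $(0,T)\times\mathbb M^m$ with $U^{(m)}(0,\cdot)=U^{(m)}_0$. Moreover, for all $r>0$ and $t\in(0,T)$ there is a constant $C(t,r)>0$, independent of $m$, such that for all $m\ge1$: 1. $U^{(m)}(t,\cdot)$ satisfies (E2) on $\mathbb B_r^m$ with constant $C(t,r)$. 2. Suppose in addition that all third order partial derivatives of $H$ are bounded on $\mathbb M\times\mathbb R^d$, and that $U_0^{(m)}$ and $F^{(m)}$ satisfy (E3) for all $m\ge1$ and $r>0$ with constants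 nondecreasing in $r$ and independent of $m$. Then $U^{(m)}(t,\cdot)$ satisfies (E3) on $\mathbb B_r^m$ with constant $C(t,r)$. 3. Suppose in addition (to the assumptions of 1) that $|D_qH(q,p)|\le K(1+|q|+|p|)$ and $|D_qL(q,v)|\le K(1+|q|+|v|)$ for some $K$ and all $q,p,v$. Then $\partial_tU^{(m)}(t,\cdot)$ exists and satisfies (E1) on $\mathbb B_r^m$ with constant $C(t,r)$. -/

import Mathlib

open MeasureTheory Set
open scoped NNReal ENNReal

noncomputable section

namespace ParticleHJ

/-- The Euclidean space `ℝ^d`, written `𝕄` in the mathematical text. -/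
abbrev Pt (d : ℕ) : Type := EuclideanSpace ℝ (Fin d)

/-- The open unit cube `Ω = (0,1)^d`. -/
def cube (d : ℕ) : Set (Pt d) := {x | ∀ a, 0 < x a ∧ x a < 1}

/-- Lebesgue measure restricted to the unit cube. -/
def cubeMeasure (d : ℕ) : Measure (Pt d) := (volume : Measure (Pt d)).restrict (cube d)

/-- The Hilbert space `ℍ = L²(Ω; ℝ^d)`. -/
abbrev Hilb (d : ℕ) : Type := Lp (Pt d) 2 (cubeMeasure d)

/-- Two elements of `ℍ` with the same law have the same image. -/
def RearrangementInvariant {d : ℕ} (G : Hilb d → ℝ) : Prop :=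
  ∀ x y : Hilb d, (cubeMeasure d).map x = (cubeMeasure d).map y → G x = G y

/-- `H(q,·)` and `L(q,·)` are Legendre transforms of each other for every `q`. -/
def LegendreDual {d : ℕ} (H L : Pt d × Pt d → ℝ) : Prop :=
  ∀ q : Pt d,
    (∀ p : Pt d, IsLUB (range fun v : Pt d => inner ℝ p v - L (q, v)) (H (q, p))) ∧
    (∀ v : Pt d, IsLUB (range fun p : Pt d => inner ℝ p v - H (q, p)) (L (q, v)))

/-! ### The control problem on `ℍ` -/

/-- `L̃(x, a) = ∫_Ω L(x(ω), a(ω)) dω + F̃(x)`. -/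
def liftedLagrangian {d : ℕ} (L : Pt d × Pt d → ℝ) (F : Hilb d → ℝ) (x a : Hilb d) : ℝ :=
  (∫ ω, L (x ω, a ω) ∂(cubeMeasure d)) + F x

/-- `S : [0,t] → ℍ` is a 2-absolutely continuous curve with velocity `v = Ṡ`. In a Hilbert space
these are exactly the primitives of square integrable functions. -/
def IsAC2Curve {d : ℕ} (t : ℝ) (S v : ℝ → Hilb d) : Prop :=
  MemLp v 2 ((volume : Measure ℝ).restrict (Ioc 0 t)) ∧
    ∀ s ∈ Icc 0 t, S s = S 0 + ∫ τ in (0 : ℝ)..s, v τ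

/-- The action `∫_0^t L̃(S, Ṡ) ds` of a curve `S` with velocity `v`. -/
def action {d : ℕ} (L : Pt d × Pt d → ℝ) (F : Hilb d → ℝ) (t : ℝ) (S v : ℝ → Hilb d) : ℝ :=
  ∫ s in (0 : ℝ)..t, liftedLagrangian L F (S s) (v s)

/-- The value function `Ũ(t, y)`: the infimum of `∫_0^t L̃(S, Ṡ) ds + Ũ₀(S(0))` over all
2-absolutely continuous curves `S` in `ℍ` (with free initial point) such that `S(t) = y`. -/
def valueFunction {d : ℕ} (L : Pt d × Pt d → ℝ) (F U₀ : Hilb d → ℝ) (t : ℝ) (y : Hilb d) : ℝ :=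
  sInf {c : ℝ | ∃ S v : ℝ → Hilb d,
    IsAC2Curve t S v ∧ S t = y ∧ c = action L F t S v + U₀ (S 0)}

/-! ### Discretization -/

/-- A partition of the unit cube into `m` Borel sets of the same volume. -/
structure Equipartition (d m : ℕ) where
  cell : Fin m → Set (Pt d)
  measurableSet_cell : ∀ i, MeasurableSet (cell i)
  disjoint_cell : ∀ i j, i ≠ j → Disjoint (cell i) (cell j)
  iUnion_cell : (⋃ i, cell i) = cube d
  volume_cell : ∀ i, (volume : Measure (Pt d)) (cell i) = (m : ℝ≥0∞)⁻¹

theorem Equipartition.cubeMeasure_cell_ne_top {d m : ℕ} (P : Equipartition d m) (i : Fin m) :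
    cubeMeasure d (P.cell i) ≠ ∞ := by
  have hm : (m : ℝ≥0∞) ≠ 0 := by
    have := i.pos
    exact_mod_cast this.ne'
  have h : (volume : Measure (Pt d)) (P.cell i) ≠ ∞ := by
    rw [P.volume_cell i]
    exact ENNReal.inv_ne_top.2 hm
  exact ne_top_of_le_ne_top h (Measure.restrict_apply_le _ _)

/-- `M^q = ∑ i, q_i χ_{Ω_i} ∈ ℍ`. -/
def stepMap {d m : ℕ} (P : Equipartition d m) (q : Fin m → Pt d) : Hilb d :=
  ∑ i, indicatorConstLp 2 (P.measurableSet_cell i) (P.cubeMeasure_cell_ne_top i) (q i)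

/-- The restriction `G^{(m)}(q) = G(M^q)` of a function `G` on `ℍ` to `m` particles. -/
def discretize {d m : ℕ} (P : Equipartition d m) (G : Hilb d → ℝ) (q : Fin m → Pt d) : ℝ :=
  G (stepMap P q)

/-- `U^{(m)}(t, q) = Ũ(t, M^q)`. -/
def particleValue {d m : ℕ} (P : Equipartition d m) (L : Pt d × Pt d → ℝ) (F U₀ : Hilb d → ℝ)
    (t : ℝ) (q : Fin m → Pt d) : ℝ :=
  discretize P (valueFunction L F U₀ t) q

/-- `H^{(m)}(q, p) = (1/m) ∑ i, H(q_i, m p_i)`. -/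
def particleHamiltonian {d m : ℕ} (H : Pt d × Pt d → ℝ) (q p : Fin m → Pt d) : ℝ :=
  (m : ℝ)⁻¹ * ∑ i, H (q i, (m : ℝ) • p i)

/-! ### Derivatives on `𝕄^m` and the Hamilton-Jacobi equation -/

/-- The partial gradient `D_{q_i} G(q) ∈ ℝ^d`. -/
def partialGrad {d m : ℕ} (G : (Fin m → Pt d) → ℝ) (q : Fin m → Pt d) (i : Fin m) : Pt d :=
  (InnerProductSpace.toDual ℝ (Pt d)).symm
    ((fderiv ℝ G q).comp (ContinuousLinearMap.single ℝ (fun _ : Fin m => Pt d) i))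

/-- The vector of `𝕄^m` whose `i`-th particle is the `a`-th basis vector of `ℝ^d`, all other
particles being `0`. -/
def basisVec {d m : ℕ} (i : Fin m) (a : Fin d) : Fin m → Pt d :=
  Pi.single i (EuclideanSpace.single a (1 : ℝ))

/-- `U` is a continuous viscosity solution of
`∂_t U + H^{(m)}(q, D_q U) - F^{(m)}(q) = 0` on `(0,T) × 𝕄^m`, `U(0,·) = U_0^{(m)}`. -/
def IsViscositySolution {d m : ℕ} (T : ℝ) (H : Pt d × Pt d → ℝ) (Fm U₀m : (Fin m → Pt d) → ℝ)
    (U : ℝ → (Fin m → Pt d) → ℝ) : Prop :=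
  ContinuousOn (fun z : ℝ × (Fin m → Pt d) => U z.1 z.2) (Ico 0 T ×ˢ univ) ∧
  (∀ q, U 0 q = U₀m q) ∧
  ∀ φ : ℝ × (Fin m → Pt d) → ℝ, ContDiff ℝ 1 φ → ∀ t ∈ Ioo 0 T, ∀ q : Fin m → Pt d,
    (IsLocalMax (fun z : ℝ × (Fin m → Pt d) => U z.1 z.2 - φ z) (t, q) →
      deriv (fun s => φ (s, q)) t
        + particleHamiltonian H q (partialGrad (fun y => φ (t, y)) q) - Fm q ≤ 0) ∧
    (IsLocalMin (fun z : ℝ × (Fin m → Pt d) => U z.1 z.2 - φ z) (t, q) →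
      0 ≤ deriv (fun s => φ (s, q)) t
        + particleHamiltonian H q (partialGrad (fun y => φ (t, y)) q) - Fm q)

/-! ### The estimates -/

/-- `𝔹_r^m = {q ∈ 𝕄^m : (1/m) ∑ j, |q_j|² ≤ r²}`. -/
def particleBall (d m : ℕ) (r : ℝ) : Set (Fin m → Pt d) :=
  {q | (m : ℝ)⁻¹ * ∑ j, ‖q j‖ ^ 2 ≤ r ^ 2}

/-- `G` is `C¹` and `∑ i, m |D_{q_i} G|² ≤ C` on `𝔹_r^m`. (On the finite dimensional space `𝕄^m`,
being `C¹` contains being locally Lipschitz; similarly for the higher orders below.) -/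
def GradientEstimate {d m : ℕ} (G : (Fin m → Pt d) → ℝ) (r C : ℝ) : Prop :=
  ContDiff ℝ 1 G ∧
    ∀ q ∈ particleBall d m r, ∑ i, (m : ℝ) * ‖partialGrad G q i‖ ^ 2 ≤ C

/-- `G` is `C²` and on `𝔹_r^m` all entries of the `d × d` matrix `D²_{q_i q_j} G` are bounded by
`C / m` if `i = j` and by `C / m²` if `i ≠ j`. -/
def HessianEstimate {d m : ℕ} (G : (Fin m → Pt d) → ℝ) (r C : ℝ) : Prop :=
  ContDiff ℝ 2 G ∧
    ∀ q ∈ particleBall d m r, ∀ (i j : Fin m) (a b : Fin d),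
      |iteratedFDeriv ℝ 2 G q ![basisVec i a, basisVec j b]|
        ≤ if i = j then C / (m : ℝ) else C / (m : ℝ) ^ 2

/-- `G` is `C³` and on `𝔹_r^m` all entries of the `d × d × d` tensor `D³_{q_i q_j q_k} G` are
bounded by `C / m` if `i = j = k` and by `C / m²` otherwise. -/
def ThirdDerivativeEstimate {d m : ℕ} (G : (Fin m → Pt d) → ℝ) (r C : ℝ) : Prop :=
  ContDiff ℝ 3 G ∧
    ∀ q ∈ particleBall d m r, ∀ (i j k : Fin m) (a b c : Fin d),
      |iteratedFDeriv ℝ 3 G q ![basisVec i a, basisVec j b, basisVec k c]|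
        ≤ if i = j ∧ j = k then C / (m : ℝ) else C / (m : ℝ) ^ 2

/-- The third derivative estimates hold for a whole family `G^{(m)}`, `m ≥ 1`, for every `r > 0`,
with a constant that is nondecreasing in `r` and independent of `m`. -/
def UniformThirdDerivativeEstimate {d : ℕ} (G : ∀ m : ℕ+, (Fin m → Pt d) → ℝ) : Prop :=
  ∃ C : ℝ → ℝ, MonotoneOn C (Ioi 0) ∧
    ∀ m : ℕ+, ∀ r : ℝ, 0 < r → ThirdDerivativeEstimate (G m) r (C r)

/-- All third order derivatives of `H` are bounded on `𝕄 × ℝ^d`. -/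
def BoundedThirdDerivatives {d : ℕ} (H : Pt d × Pt d → ℝ) : Prop :=
  ∃ K : ℝ, ∀ z, ‖iteratedFDeriv ℝ 3 H z‖ ≤ K

/-- `|D_q G(q, p)| ≤ K (1 + |q| + |p|)`. -/
def LinearGrowthDq {d : ℕ} (G : Pt d × Pt d → ℝ) : Prop :=
  ∃ K : ℝ, ∀ q p : Pt d, ‖fderiv ℝ (fun y => G (y, p)) q‖ ≤ K * (1 + ‖q‖ + ‖p‖)

end ParticleHJ

end

open ParticleHJ

/-!
The proof is by the method of characteristics, carried out with constants that do not depend on the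
number `m` of particles.

*Extremals.* An extremal is a solution of the Hamiltonian system of `m` particles whose initial
momentum is the gradient of `U₀^{(m)}`, scaled by `m`. By Legendre duality it is a critical point
of the action, and by joint convexity of the lifted Lagrangian and convexity of `Ũ₀` it is a
minimizer (`IsExtremal.isLeast`), with the final momentum as a subgradient of the value function
(`IsExtremal.subgradient`). The competitors are arbitrary curves in `ℍ`, not only curves of step
maps: the gradient of a rearrangement invariant function at a step map is again a step map
(`fderiv_stepMap_apply`), so the tangent inequalities at an extremal only see cell averages.

*Stability and the field of extremals.* A convex function with Lipschitz gradient has a cocoercive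
gradient. Together with the energy identity for the duality pairing of positions and momenta this
bounds the difference of two extremals on `[0, t]` by the distance of their endpoints at time `t`
(`exists_stability_const`, `exists_arc_stability_const`). Hence the map from initial to
final positions is antilipschitz, therefore a diffeomorphism
(`exists_contDiff_inverse_of_antilipschitz`), and the extremals form a field that covers
`[0, T] × 𝕄^m` (`IsRegular.exists_extremal_field`). The value function is then differentiable, its
spatial gradient is the momentum of the field, and it solves the equation classically at interior
times (`ExtremalField.hasFDerivAt_particleValue`).

*Second derivatives.* The stability estimate holds for any set of particles separately, up to the
influence of the others on their force. By the Hessian estimates of the data this influence is of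
order `m⁻¹`, so moving the endpoint of one particle moves every other particle only by a multiple
of `m⁻¹` (`IsRegular.exists_localization_const`). The Hessian of the value function is the
derivative of the momentum, which gives its estimate.

*Third derivatives.* For variations along two extremals, integrating the derivative of the
symplectic form expresses the increment of the Hessian of the value function through increments of
the second derivatives of `U₀^{(m)}`, `F^{(m)}` and `H` (`abs_fderiv_fderiv_particleValue_sub_le`).
Neither third order expansions of the flow nor further stability estimates are needed. The decay of
the variations and the decay of the third derivatives of the data combine by the summation bound
`sum_tripleWeight_mul_decay_le`.

*Time derivative.* Since `∂_t U = F - H(q, D_q U)`, the gradient of the time derivative is bounded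
in mean square by the stability estimate (`IsRegular.exists_gradientEstimate`).
-/

universe u

namespace ParticleHJ

/-! ### Superposition operators on spaces of continuous functions -/

section Superposition

variable {K : Type*} [TopologicalSpace K] [CompactSpace K]
  {E F : Type*} [NormedAddCommGroup E] [NormedSpace ℝ E] [NormedAddCommGroup F] [NormedSpace ℝ F]

/-- Pointwise application of a continuous field of operators to a continuous function. -/
noncomputable def pointwiseApply (K E F : Type*) [TopologicalSpace K] [CompactSpace K]
    [NormedAddCommGroup E] [NormedSpace ℝ E] [NormedAddCommGroup F] [NormedSpace ℝ F] :
    C(K, E →L[ℝ] F) →L[ℝ] C(K, E) →L[ℝ] C(K, F) :=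
  LinearMap.mkContinuous₂
    (LinearMap.mk₂ ℝ (fun (A : C(K, E →L[ℝ] F)) (u : C(K, E)) =>
        (⟨fun k => A k (u k), A.continuous.clm_apply u.continuous⟩ : C(K, F)))
      (fun _ _ _ => by ext; simp) (fun _ _ _ => by ext; simp)
      (fun _ _ _ => by ext; simp) (fun _ _ _ => by ext; simp)) 1
    (fun A u => by
      rw [one_mul]
      refine (ContinuousMap.norm_le _ (by positivity)).2 fun k => ?_
      exact ((A k).le_opNorm _).trans
        (mul_le_mul (A.norm_coe_le_norm k) (u.norm_coe_le_norm k) (norm_nonneg _) (by positivity)))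

@[simp] theorem pointwiseApply_apply (A : C(K, E →L[ℝ] F)) (u : C(K, E)) (k : K) :
    pointwiseApply K E F A u k = A k (u k) := rfl

theorem hasFDerivAt_postcomp {f : E → F} {f' : C(E, E →L[ℝ] F)}
    (hf : ∀ x, HasFDerivAt f (f' x) x) (fc : C(E, F)) (hfc : ⇑fc = f) (u : C(K, E)) :
    HasFDerivAt (fun v : C(K, E) => fc.comp v) (pointwiseApply K E F (f'.comp u)) u := by
  rw [hasFDerivAt_iff_isLittleO_nhds_zero, Asymptotics.isLittleO_iff]
  intro ε hε
  have hK : IsCompact (range u) := isCompact_range u.continuous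
  have h1 := hK.uniformContinuousAt_of_continuousAt f'
    (fun x _ => f'.continuous.continuousAt) (Metric.dist_mem_uniformity hε)
  obtain ⟨δ, hδ, h2⟩ := Metric.mem_uniformity_dist.1 h1
  filter_upwards [Metric.ball_mem_nhds (0 : C(K, E)) hδ] with h hh
  rw [mem_ball_zero_iff] at hh
  refine (ContinuousMap.norm_le _ (by positivity)).2 fun k => ?_
  have hk : ‖h k‖ < δ := (h.norm_coe_le_norm k).trans_lt hh
  have h3 := (convex_ball (u k) δ).norm_image_sub_le_of_norm_hasFDerivWithin_le' (f := f)
    (f' := f') (φ := f' (u k)) (C := ε) (x := u k) (y := u k + h k)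
    (fun x _ => (hf x).hasFDerivWithinAt)
    (fun x hx => by
      rw [← dist_eq_norm, dist_comm]
      refine le_of_lt (h2 (a := u k) (b := x) ?_ ⟨k, rfl⟩)
      rwa [dist_comm])
    (Metric.mem_ball_self hδ) (by simpa [dist_eq_norm] using hk)
  simp only [add_sub_cancel_left] at h3
  calc _ ≤ ε * ‖h k‖ := by simpa [hfc] using h3
    _ ≤ ε * ‖h‖ := by gcongr; exact h.norm_coe_le_norm k

end Superposition

/-- The superposition operator `u ↦ f ∘ u` on `C(K, E)` is as smooth as `f`. -/
theorem contDiff_postcomp {K : Type*} [TopologicalSpace K] [CompactSpace K] {n : ℕ} {E F : Type u}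
    [NormedAddCommGroup E] [NormedSpace ℝ E] [NormedAddCommGroup F] [NormedSpace ℝ F] {f : C(E, F)}
    (hf : ContDiff ℝ n f) : ContDiff ℝ n (fun v : C(K, E) => f.comp v) := by
  induction n generalizing F with
  | zero => exact contDiff_zero.2 f.continuous_postcomp
  | succ n ih =>
    have hf1 : Differentiable ℝ f := hf.differentiable (by simp)
    have hf' : ContDiff ℝ n (fderiv ℝ f) := hf.fderiv_right (by simp)
    have hd : ∀ u : C(K, E), HasFDerivAt (fun v : C(K, E) => f.comp v)
        (pointwiseApply K E F ((⟨fderiv ℝ f, hf'.continuous⟩ : C(E, E →L[ℝ] F)).comp u)) u :=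
      fun u => hasFDerivAt_postcomp (fun x => (hf1 x).hasFDerivAt) f rfl u
    rw [Nat.cast_add, Nat.cast_one]
    rw [contDiff_succ_iff_hasFDerivAt]
    refine ⟨fun u => pointwiseApply K E F
      ((⟨fderiv ℝ f, hf'.continuous⟩ : C(E, E →L[ℝ] F)).comp u), ?_, hd⟩
    exact (pointwiseApply K E F).contDiff.comp (ih (f := ⟨fderiv ℝ f, hf'.continuous⟩) hf')

/-! ### The flow of a Lipschitz vector field -/

section Flow

theorem continuous_extend {X : Type*} [TopologicalSpace X] {T : ℝ} (hT : 0 ≤ T)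
    (u : C(Icc 0 T, X)) :
    Continuous fun τ => u (projIcc 0 T hT τ) :=
  u.continuous.comp continuous_projIcc

variable {E : Type u} [NormedAddCommGroup E] [NormedSpace ℝ E]

/-- The primitive `s ↦ ∫ τ in 0..s, u τ` on `[0, T]`, the function `u` being extended to the real
line by its values at the end points. -/
noncomputable def primitive (T : ℝ) (hT : 0 ≤ T) (u : C(Icc 0 T, E)) (s : ℝ) : E :=
  ∫ τ in (0 : ℝ)..s, u (projIcc 0 T hT τ)

theorem hasDerivAt_primitive [CompleteSpace E] {T : ℝ} (hT : 0 ≤ T) (u : C(Icc 0 T, E)) (s : ℝ) :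
    HasDerivAt (primitive T hT u) (u (projIcc 0 T hT s)) s :=
  intervalIntegral.integral_hasDerivAt_right ((continuous_extend hT u).intervalIntegrable _ _)
    ((continuous_extend hT u).stronglyMeasurableAtFilter _ _)
    (continuous_extend hT u).continuousAt

/-- Multiplication of continuous functions on `[0, T]` by a continuous real function. -/
noncomputable def mulOp {K : Type*} [TopologicalSpace K] [CompactSpace K] (a : C(K, ℝ)) :
    C(K, E) →L[ℝ] C(K, E) :=
  pointwiseApply K E E ⟨fun k => a k • ContinuousLinearMap.id ℝ E, by fun_prop⟩

/-- The inclusion of the constants in `C(K, E)`. -/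
noncomputable def constOp (K : Type*) [TopologicalSpace K] [CompactSpace K] : E →L[ℝ] C(K, E) :=
  LinearMap.mkContinuous
    { toFun := fun z => ContinuousMap.const K z
      map_add' := fun _ _ => rfl
      map_smul' := fun _ _ => rfl } 1
    (fun z => by
      rw [one_mul]
      exact (ContinuousMap.norm_le _ (by positivity)).2 fun s => le_rfl)

@[simp] theorem constOp_apply {K : Type*} [TopologicalSpace K] [CompactSpace K] (z : E) (k : K) :
    constOp K z k = z := rfl

/-- The primitive as a bounded operator on `C([0, T], E)`. -/
noncomputable def primitiveOp [CompleteSpace E] (T : ℝ) (hT : 0 ≤ T) :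
    C(Icc 0 T, E) →L[ℝ] C(Icc 0 T, E) :=
  LinearMap.mkContinuous
    { toFun := fun u => ⟨fun s => primitive T hT u s,
        (continuous_iff_continuousAt.2 fun s =>
          (hasDerivAt_primitive hT u s).continuousAt).comp continuous_subtype_val⟩
      map_add' := fun u v => by
        ext s
        exact intervalIntegral.integral_add ((continuous_extend hT u).intervalIntegrable _ _)
          ((continuous_extend hT v).intervalIntegrable _ _)
      map_smul' := fun c u => by
        ext s
        exact intervalIntegral.integral_smul c _ } T
    (fun u => by
      refine (ContinuousMap.norm_le _ (by positivity)).2 fun s => ?_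
      have h := intervalIntegral.norm_integral_le_of_norm_le_const (a := 0) (b := s)
        (f := fun τ => u (projIcc 0 T hT τ)) (C := ‖u‖) (fun τ _ => u.norm_coe_le_norm _)
      rw [sub_zero, abs_of_nonneg s.2.1] at h
      refine h.trans ?_
      rw [mul_comm]
      exact mul_le_mul_of_nonneg_right s.2.2 (by positivity))

@[simp] theorem primitiveOp_apply [CompleteSpace E] {T : ℝ} (hT : 0 ≤ T) (u : C(Icc 0 T, E))
    (s : Icc 0 T) : primitiveOp T hT u s = primitive T hT u s := rfl

@[simp] theorem mulOp_apply {K : Type*} [TopologicalSpace K] [CompactSpace K] (a : C(K, ℝ))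
    (u : C(K, E)) (k : K) : mulOp a u k = a k • u k := rfl

/-- The integrated flow of a Lipschitz vector field exists on every compact interval and is as
smooth a function of the initial point as the field. In the norm weighted by `exp (-λ s)` the
integral operator of the differential equation is a perturbation of the identity of Lipschitz
constant at most `1/2`, hence the homeomorphism and the inverse function theorem apply globally. -/
theorem exists_contDiff_flow [CompleteSpace E] {n : ℕ} (hn : 1 ≤ n) {V : C(E, E)}
    (hV : ContDiff ℝ n V) {k : ℝ≥0} (hk : LipschitzWith k V) (T : ℝ) (hT : 0 ≤ T) :
    ∃ Φ : E → C(Icc 0 T, E), ContDiff ℝ n Φ ∧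
      ∀ z, Φ z = constOp _ z + primitiveOp T hT (V.comp (Φ z)) := by
  set l : ℝ := 2 * k + 1 with hl
  have hl0 : 0 < l := by positivity
  set ep : C(Icc 0 T, ℝ) := ⟨fun s => Real.exp (l * s), by fun_prop⟩ with hep
  set em : C(Icc 0 T, ℝ) := ⟨fun s => Real.exp (-(l * s)), by fun_prop⟩ with hem
  set Q : C(Icc 0 T, E) → C(Icc 0 T, E) :=
    fun y => mulOp em (primitiveOp T hT (V.comp (mulOp ep y))) with hQ
  have hQs : ContDiff ℝ n Q :=
    (mulOp em).contDiff.comp ((primitiveOp T hT).contDiff.comp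
      ((contDiff_postcomp hV).comp (mulOp ep).contDiff))
  have hQlip : LipschitzWith (1 / 2) Q := by
    refine LipschitzWith.of_dist_le_mul fun y y' => ?_
    rw [ContinuousMap.dist_le (by positivity)]
    intro s
    have hs := s.2.1
    have e1 : dist (Q y s) (Q y' s) = Real.exp (-(l * s)) * ‖∫ τ in (0 : ℝ)..s,
        (V (ep (projIcc 0 T hT τ) • y (projIcc 0 T hT τ)) -
          V (ep (projIcc 0 T hT τ) • y' (projIcc 0 T hT τ)))‖ := by
      have h0 := intervalIntegral.integral_sub (μ := volume)
        ((continuous_extend hT (V.comp (mulOp ep y))).intervalIntegrable 0 s)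
        ((continuous_extend hT (V.comp (mulOp ep y'))).intervalIntegrable 0 s)
      simp only [ContinuousMap.comp_apply, mulOp_apply] at h0
      rw [h0, dist_eq_norm, ← abs_of_pos (Real.exp_pos (-(l * (s : ℝ)))), ← Real.norm_eq_abs,
          ← norm_smul,
        smul_sub]
      rfl
    have e2 : ‖∫ τ in (0 : ℝ)..s, (V (ep (projIcc 0 T hT τ) • y (projIcc 0 T hT τ)) -
          V (ep (projIcc 0 T hT τ) • y' (projIcc 0 T hT τ)))‖
        ≤ ∫ τ in (0 : ℝ)..s, k * dist y y' * Real.exp (l * τ) := by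
      refine intervalIntegral.norm_integral_le_of_norm_le hs ?_
        (Continuous.intervalIntegrable (by fun_prop) _ _)
      refine Filter.Eventually.of_forall fun τ hτ => ?_
      have hτ' : τ ∈ Icc 0 T := ⟨hτ.1.le, hτ.2.trans s.2.2⟩
      rw [projIcc_of_mem hT hτ', ← dist_eq_norm]
      refine (hk.dist_le_mul _ _).trans ?_
      rw [dist_smul₀, mul_assoc]
      have := ContinuousMap.dist_apply_le_dist (f := y) (g := y') ⟨τ, hτ'⟩
      have h3 : ‖ep ⟨τ, hτ'⟩‖ = Real.exp (l * τ) := by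
        rw [Real.norm_eq_abs]; exact abs_of_pos (Real.exp_pos _)
      rw [h3, mul_comm (Real.exp _)]
      gcongr
    have e3 : ∫ τ in (0 : ℝ)..s, k * dist y y' * Real.exp (l * τ)
        = k * dist y y' * ((Real.exp (l * s) - 1) / l) := by
      rw [intervalIntegral.integral_const_mul]
      congr 1
      rw [intervalIntegral.integral_comp_mul_left (fun x => Real.exp x) hl0.ne', integral_exp]
      simp [div_eq_inv_mul]
    rw [e1]
    calc _ ≤ Real.exp (-(l * s)) * (k * dist y y' * ((Real.exp (l * s) - 1) / l)) := by
          rw [← e3]; gcongr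
      _ = k * dist y y' * ((1 - Real.exp (-(l * s))) / l) := by
          have : Real.exp (-(l * s)) * Real.exp (l * s) = 1 := by rw [← Real.exp_add]; simp
          field_simp
          linear_combination (k * dist y y') * this
      _ ≤ k * dist y y' * (1 / l) := by
          gcongr
          linarith [Real.exp_pos (-(l * s))]
      _ = (k / l) * dist y y' := by ring
      _ ≤ _ := by
          gcongr
          push_cast
          rw [div_le_div_iff₀ hl0 (by norm_num)]
          linarith
  set Ψ : C(Icc 0 T, E) → C(Icc 0 T, E) := fun y => y - Q y with hΨ
  have hΨs : ContDiff ℝ n Ψ := contDiff_id.sub hQs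
  have happ : ApproximatesLinearOn Ψ
      ((ContinuousLinearEquiv.refl ℝ C(Icc 0 T, E) : _ →L[ℝ] C(Icc 0 T, E))) univ (1 / 2) := by
    intro y _ y' _
    have := hQlip.norm_sub_le y y'
    have h2 : Ψ y - Ψ y' - (ContinuousLinearEquiv.refl ℝ C(Icc 0 T, E) : _ →L[ℝ] _) (y - y')
        = -(Q y - Q y') := by simp [hΨ]; abel
    rw [h2, norm_neg]
    exact this
  have hc : Subsingleton C(Icc 0 T, E) ∨ (1 / 2 : ℝ≥0) <
      ‖((ContinuousLinearEquiv.refl ℝ C(Icc 0 T, E)).symm :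
        C(Icc 0 T, E) →L[ℝ] C(Icc 0 T, E))‖₊⁻¹ := by
    rcases subsingleton_or_nontrivial C(Icc 0 T, E) with h | h
    · exact Or.inl h
    · right
      rw [ContinuousLinearEquiv.refl_symm, ContinuousLinearEquiv.coe_refl,
        ContinuousLinearMap.nnnorm_id, inv_one]
      exact NNReal.half_lt_self one_ne_zero
  set h : C(Icc 0 T, E) ≃ₜ C(Icc 0 T, E) := happ.toHomeomorph Ψ hc with hh
  have hhc : ⇑h = Ψ := rfl
  have hQd : ∀ a, HasFDerivAt Q (fderiv ℝ Q a) a :=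
    fun a => ((hQs.differentiable (by exact_mod_cast (by lia : n ≠ 0))) a).hasFDerivAt
  have hQn : ∀ a, ‖fderiv ℝ Q a‖ < 1 := fun a =>
    ((hQd a).le_of_lipschitz hQlip).trans_lt (by
      rw [← NNReal.coe_one]; exact NNReal.coe_lt_coe.2 (NNReal.half_lt_self one_ne_zero))
  have hder : ∀ a, HasFDerivAt h
      ((ContinuousLinearEquiv.unitsEquiv ℝ _ (Units.oneSub (fderiv ℝ Q a) (hQn a)) :
        C(Icc 0 T, E) ≃L[ℝ] C(Icc 0 T, E)) : C(Icc 0 T, E) →L[ℝ] C(Icc 0 T, E)) a := by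
    intro a
    rw [hhc]
    exact (hasFDerivAt_id a).sub (hQd a)
  have hsymm : ContDiff ℝ n h.symm := h.contDiff_symm hder (by rw [hhc]; exact hΨs)
  refine ⟨fun z => mulOp ep (h.symm (mulOp em (constOp _ z))), ?_, fun z => ?_⟩
  · exact (mulOp ep).contDiff.comp (hsymm.comp ((mulOp em).contDiff.comp (constOp _).contDiff))
  · set y := h.symm (mulOp em (constOp _ z)) with hy
    have h1 : Ψ y = mulOp em (constOp _ z) := by rw [← hhc, hy]; exact h.apply_symm_apply _
    have h2 : y = mulOp em (constOp _ z + primitiveOp T hT (V.comp (mulOp ep y))) := by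
      rw [map_add, ← h1]; simp [hΨ, hQ]
    have h3 : ∀ v : C(Icc 0 T, E), mulOp ep (mulOp em v) = v := by
      intro v; ext s
      simp only [mulOp_apply, smul_smul, hep, hem, ContinuousMap.coe_mk, ← Real.exp_add]
      simp
    change mulOp ep y = constOp _ z + primitiveOp T hT (V.comp (mulOp ep y))
    conv_lhs => rw [h2, h3]

end Flow

/-! ### Convex functions with Lipschitz gradient -/

theorem le_of_forall_le_add_mul {a b c : ℝ} (h : ∀ θ : ℝ, 0 < θ → θ ≤ 1 → b ≤ a + θ * c) :
    b ≤ a := by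
  by_contra! hab
  rcases le_or_gt c 0 with hc | hc
  · linarith [h 1 one_pos le_rfl]
  · have h1 := h (min 1 ((b - a) / (2 * c))) (by
      refine lt_min one_pos (div_pos (by linarith) (by linarith))) (min_le_left _ _)
    have h2 : min 1 ((b - a) / (2 * c)) * c ≤ (b - a) / (2 * c) * c := by
      gcongr; exact min_le_right _ _
    have h3 : (b - a) / (2 * c) * c = (b - a) / 2 := by field_simp
    linarith

section Convex

variable {Y : Type*} [NormedAddCommGroup Y] [NormedSpace ℝ Y]

theorem abs_sub_sub_le_of_lipschitz_fderiv {f : Y → ℝ} {f' : Y → Y →L[ℝ] ℝ} {κ : ℝ}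
    (hf : ∀ y, HasFDerivAt f (f' y) y) (hf' : ∀ y y', ‖f' y - f' y'‖ ≤ κ * ‖y - y'‖) (hκ : 0 ≤ κ)
    (y h : Y) : |f (y + h) - f y - f' y h| ≤ κ * ‖h‖ ^ 2 := by
  have h3 := (convex_segment (𝕜 := ℝ) y (y + h)).norm_image_sub_le_of_norm_hasFDerivWithin_le'
    (f := f) (f' := f') (φ := f' y) (C := κ * ‖h‖) (x := y) (y := y + h)
    (fun x _ => (hf x).hasFDerivWithinAt)
    (fun x hx => by
      refine (hf' x y).trans ?_
      gcongr
      obtain ⟨a, b, ha, hb, hab, rfl⟩ := hx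
      have : a • y + b • (y + h) - y = b • h := by
        have : a = 1 - b := by linarith
        rw [this]; module
      rw [this, norm_smul, Real.norm_of_nonneg hb]
      exact mul_le_of_le_one_left (norm_nonneg _) (by linarith))
    (left_mem_segment _ _ _) (right_mem_segment _ _ _)
  simp only [add_sub_cancel_left, Real.norm_eq_abs] at h3
  calc _ ≤ κ * ‖h‖ * ‖h‖ := h3
    _ = _ := by ring

theorem convexOn_add_fderiv_le {f : Y → ℝ} {f' : Y → Y →L[ℝ] ℝ} {κ : ℝ}
    (hf : ∀ y, HasFDerivAt f (f' y) y) (hf' : ∀ y y', ‖f' y - f' y'‖ ≤ κ * ‖y - y'‖) (hκ : 0 ≤ κ)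
    (hconv : ConvexOn ℝ univ f) (y h : Y) : f y + f' y h ≤ f (y + h) := by
  refine le_of_forall_le_add_mul (c := κ * ‖h‖ ^ 2) fun θ hθ hθ1 => ?_
  have h1 := (abs_le.1 (abs_sub_sub_le_of_lipschitz_fderiv hf hf' hκ y (θ • h))).1
  have h2 := hconv.2 (mem_univ y) (mem_univ (y + h)) (sub_nonneg.2 hθ1) hθ.le (by ring)
  rw [show (1 - θ) • y + θ • (y + h) = y + θ • h by module] at h2
  rw [map_smul, norm_smul, Real.norm_of_nonneg hθ.le] at h1
  simp only [smul_eq_mul] at h1 h2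
  have h3 : θ * (f y + f' y h) ≤ θ * (f (y + h) + θ * (κ * ‖h‖ ^ 2)) := by nlinarith
  exact le_of_mul_le_mul_left h3 hθ

end Convex

section Cocoercive

variable {Y : Type*} [NormedAddCommGroup Y] [InnerProductSpace ℝ Y]

/-- The gradient of a convex function is cocoercive as soon as it is Lipschitz: after subtraction
of its tangent at `y'` the function is minimal at `y'`, and one gradient step from `y` cannot go
below that minimum. -/
theorem cocoercive_gradient {f : Y → ℝ} {g : Y → Y} {κ : ℝ} (hκ : 0 < κ)
    (hf : ∀ y, HasFDerivAt f (innerSL ℝ (g y)) y) (hg : ∀ y y', ‖g y - g y'‖ ≤ κ * ‖y - y'‖)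
    (hconv : ConvexOn ℝ univ f) (y y' : Y) :
    (2 * κ)⁻¹ * ‖g y - g y'‖ ^ 2 ≤ inner ℝ (g y - g y') (y - y') := by
  have hg' : ∀ y y', ‖innerSL ℝ (g y) - innerSL ℝ (g y')‖ ≤ κ * ‖y - y'‖ := fun y y' => by
    rw [← map_sub, innerSL_apply_norm]; exact hg y y'
  have key : ∀ y y' : Y, f y' + inner ℝ (g y') (y - y') + (4 * κ)⁻¹ * ‖g y - g y'‖ ^ 2 ≤ f y := by
    intro y y'
    set D := g y - g y' with hD
    have h1 := convexOn_add_fderiv_le hf hg' hκ.le hconv y' (y - (2 * κ)⁻¹ • D - y')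
    have h2 := (abs_le.1 (abs_sub_sub_le_of_lipschitz_fderiv hf hg' hκ.le y
      (-((2 * κ)⁻¹ • D)))).2
    rw [show y' + (y - (2 * κ)⁻¹ • D - y') = y + -((2 * κ)⁻¹ • D) by abel] at h1
    simp only [innerSL_apply_apply, inner_sub_right, inner_neg_right, inner_smul_right, norm_neg,
      norm_smul, norm_inv, Real.norm_of_nonneg (by positivity : 0 ≤ 2 * κ)] at h1 h2 ⊢
    have h3 : inner ℝ (g y) D - inner ℝ (g y') D = ‖D‖ ^ 2 := by
      rw [← inner_sub_left, ← hD, real_inner_self_eq_norm_sq]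
    have h4 : κ * ((2 * κ)⁻¹ * ‖D‖) ^ 2 = (4 * κ)⁻¹ * ‖D‖ ^ 2 := by field_simp; ring
    have h5 : (2 * κ)⁻¹ * inner ℝ (g y) D - (2 * κ)⁻¹ * inner ℝ (g y') D
        = 2 * ((4 * κ)⁻¹ * ‖D‖ ^ 2) := by
      rw [← mul_sub, h3]; field_simp; ring
    linarith
  have h1 := key y y'
  have h2 := key y' y
  rw [norm_sub_rev] at h2
  have h3 : (2 * κ)⁻¹ * ‖g y - g y'‖ ^ 2 = 2 * ((4 * κ)⁻¹ * ‖g y - g y'‖ ^ 2) := by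
    field_simp; ring
  rw [h3, inner_sub_left]
  have h4 : inner ℝ (g y) (y' - y) = - inner ℝ (g y) (y - y') := by
    rw [← inner_neg_right, neg_sub]
  linarith

end Cocoercive

/-! ### Stability of two point boundary value problems with convex Lagrangian -/

set_option maxHeartbeats 1000000 in
/-- Stability of the boundary value problem with prescribed end point `η t` and an initial
condition relating `ζ 0` to `η 0`, with source terms `f` and `g`. The cocoercivity of the
gradient of the Lagrangian controls `∫ ‖ζ‖² + ‖ζ' - f‖²` by boundary terms, because
`⟪ζ, η⟫` is a primitive of the left hand side of the cocoercivity inequality; the equation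
for `η` is then integrated backwards and the one for `ζ` forwards. -/
theorem exists_stability_const {c K T : ℝ} (hc : 0 < c) (hK : 0 ≤ K) (hT : 0 ≤ T) :
    ∃ C : ℝ, 0 < C ∧ ∀ (G : Type) [NormedAddCommGroup G] [InnerProductSpace ℝ G]
      (t φ : ℝ) (η η' ζ ζ' f : ℝ → G) (g : G), t ∈ Icc 0 T →
      (∀ s, HasDerivAt η (η' s) s) → (∀ s, HasDerivAt ζ (ζ' s) s) →
      Continuous η' → Continuous ζ' → Continuous f →
      (∀ s ∈ Icc 0 t, c * (‖ζ s‖ ^ 2 + ‖ζ' s - f s‖ ^ 2) ≤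
        inner ℝ (ζ' s - f s) (η s) + inner ℝ (ζ s) (η' s)) →
      c * ‖ζ 0 - g‖ ^ 2 ≤ inner ℝ (ζ 0 - g) (η 0) →
      (∀ s ∈ Icc 0 t, ‖η' s‖ ≤ K * (‖η s‖ + ‖ζ s‖)) →
      (∀ s ∈ Icc 0 t, ‖f s‖ ≤ φ) → ‖g‖ ≤ φ →
      ∀ s ∈ Icc 0 t, ‖η s‖ ≤ C * (‖η t‖ + φ) ∧ ‖ζ s‖ ≤ C * (‖η t‖ + φ) := by
  set A : ℝ := Real.exp (3 * K * T) * (1 + K) + 4 + T with hA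
  set B : ℝ := (T + 1) / c with hB
  have hA0 : 0 < A := by positivity
  have hB0 : 0 < B := by positivity
  refine ⟨A * B + A + 1, by positivity, ?_⟩
  intro G _ _ t φ η η' ζ ζ' f g ht hη hζ hη' hζ' hfc hmon h0 hKη hf hg
  have hηc : Continuous η := continuous_iff_continuousAt.2 fun s => (hη s).continuousAt
  have hζc : Continuous ζ := continuous_iff_continuousAt.2 fun s => (hζ s).continuousAt
  have hφ : 0 ≤ φ := (norm_nonneg _).trans hg
  set D := ‖η t‖ + φ with hD
  have hD0 : 0 ≤ D := by positivity
  obtain ⟨s₀, hs₀, hmax⟩ := (isCompact_Icc (a := (0 : ℝ)) (b := t)).exists_isMaxOn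
    ⟨0, left_mem_Icc.2 ht.1⟩ (f := fun s => ‖η s‖ ^ 2 + ‖ζ s‖ ^ 2) (by fun_prop)
  set M := Real.sqrt (‖η s₀‖ ^ 2 + ‖ζ s₀‖ ^ 2) with hM
  have hM0 : 0 ≤ M := Real.sqrt_nonneg _
  have hM2 : M ^ 2 = ‖η s₀‖ ^ 2 + ‖ζ s₀‖ ^ 2 := Real.sq_sqrt (by positivity)
  have hηM : ∀ s ∈ Icc 0 t, ‖η s‖ ≤ M := fun s hs =>
    Real.le_sqrt_of_sq_le
      ((le_add_of_nonneg_right (sq_nonneg ‖ζ s‖)).trans (isMaxOn_iff.1 hmax s hs))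
  have hζM : ∀ s ∈ Icc 0 t, ‖ζ s‖ ≤ M := fun s hs =>
    Real.le_sqrt_of_sq_le
      ((le_add_of_nonneg_left (sq_nonneg ‖η s‖)).trans (isMaxOn_iff.1 hmax s hs))
  set J : ℝ := ∫ s in (0 : ℝ)..t, (‖ζ s‖ ^ 2 + ‖ζ' s - f s‖ ^ 2) with hJ
  set I : ℝ := J + ‖ζ 0 - g‖ ^ 2 with hI
  have hJs : ∀ a b, 0 ≤ a → a ≤ b → b ≤ t →
      ∫ s in a..b, (‖ζ s‖ ^ 2 + ‖ζ' s - f s‖ ^ 2) ≤ J := by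
    intro a b ha hab hb
    exact intervalIntegral.integral_mono_interval ha hab hb
      (Filter.Eventually.of_forall fun s => by positivity)
      (Continuous.intervalIntegrable (by fun_prop) _ _)
  have hJ0 : 0 ≤ J := by
    have := hJs 0 0 le_rfl le_rfl ht.1
    simpa using this
  -- the energy identity
  have hIB : I ≤ B * D * M := by
    have e1 : ∫ s in (0 : ℝ)..t, (inner ℝ (ζ s) (η' s) + inner ℝ (ζ' s) (η s))
        = inner ℝ (ζ t) (η t) - inner ℝ (ζ 0) (η 0) :=
      intervalIntegral.integral_eq_sub_of_hasDerivAt (f := fun s => inner ℝ (ζ s) (η s))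
        (fun s _ => (hζ s).inner ℝ (hη s)) (Continuous.intervalIntegrable (by fun_prop) _ _)
    have e2 : c * J ≤ ∫ s in (0 : ℝ)..t,
        (inner ℝ (ζ s) (η' s) + inner ℝ (ζ' s) (η s) + φ * M) := by
      rw [hJ, ← intervalIntegral.integral_const_mul]
      refine intervalIntegral.integral_mono_on ht.1
        (Continuous.intervalIntegrable (by fun_prop) _ _)
        (Continuous.intervalIntegrable (by fun_prop) _ _) fun s hs => ?_
      have h1 := hmon s hs
      rw [inner_sub_left] at h1
      have h2 : -(inner ℝ (f s) (η s)) ≤ φ * M := by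
        refine (neg_le_abs _).trans ((abs_real_inner_le_norm _ _).trans ?_)
        exact mul_le_mul (hf s hs) (hηM s hs) (norm_nonneg _) hφ
      linarith
    rw [intervalIntegral.integral_add (Continuous.intervalIntegrable (by fun_prop) _ _)
      (Continuous.intervalIntegrable (by fun_prop) _ _), e1] at e2
    simp only [intervalIntegral.integral_const, sub_zero, smul_eq_mul] at e2
    have e3 : c * ‖ζ 0 - g‖ ^ 2 ≤ inner ℝ (ζ 0) (η 0) + φ * M := by
      rw [inner_sub_left] at h0
      have h2 : -(inner ℝ g (η 0)) ≤ φ * M := by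
        refine (neg_le_abs _).trans ((abs_real_inner_le_norm _ _).trans ?_)
        exact mul_le_mul hg (hηM 0 ⟨le_rfl, ht.1⟩) (norm_nonneg _) hφ
      linarith
    have e4 : inner ℝ (ζ t) (η t) ≤ M * ‖η t‖ :=
      (real_inner_le_norm _ _).trans
        (mul_le_mul_of_nonneg_right (hζM t ⟨ht.1, le_rfl⟩) (norm_nonneg _))
    have e5 : t * (φ * M) ≤ T * (φ * M) := mul_le_mul_of_nonneg_right ht.2 (by positivity)
    have e6 : c * I ≤ (T + 1) * D * M := by
      rw [hI, hD, mul_add]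
      nlinarith [mul_nonneg (mul_nonneg hT (norm_nonneg (η t))) hM0]
    rw [hB, div_mul_eq_mul_div, div_mul_eq_mul_div, le_div_iff₀ hc]
    linarith
  have hI0 : 0 ≤ I := by positivity
  -- backward estimate of `η`
  have hη2 : ∀ s ∈ Icc 0 t, ‖η s‖ ^ 2 ≤ Real.exp (3 * K * T) * (D ^ 2 + K * I) := by
    intro s hs
    have e1 : ∫ τ in s..t, (3 * K * Real.exp (3 * K * τ) * ‖η τ‖ ^ 2
          + Real.exp (3 * K * τ) * (2 * inner ℝ (η τ) (η' τ)))
        = Real.exp (3 * K * t) * ‖η t‖ ^ 2 - Real.exp (3 * K * s) * ‖η s‖ ^ 2 := by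
      refine intervalIntegral.integral_eq_sub_of_hasDerivAt
        (f := fun τ => Real.exp (3 * K * τ) * ‖η τ‖ ^ 2) (fun τ _ => ?_)
        (Continuous.intervalIntegrable (by fun_prop) _ _)
      have h1 : HasDerivAt (fun τ : ℝ => Real.exp (3 * K * τ)) (3 * K * Real.exp (3 * K * τ)) τ := by
        have := ((hasDerivAt_id τ).const_mul (3 * K)).exp
        simpa [mul_comm] using this
      exact h1.mul (hη τ).norm_sq
    have e2 : -(K * Real.exp (3 * K * T) * J) ≤ ∫ τ in s..t,
        (3 * K * Real.exp (3 * K * τ) * ‖η τ‖ ^ 2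
          + Real.exp (3 * K * τ) * (2 * inner ℝ (η τ) (η' τ))) := by
      calc -(K * Real.exp (3 * K * T) * J)
          ≤ -(K * Real.exp (3 * K * T)) * ∫ τ in s..t, (‖ζ τ‖ ^ 2 + ‖ζ' τ - f τ‖ ^ 2) := by
            rw [neg_mul]
            exact neg_le_neg (mul_le_mul_of_nonneg_left (hJs s t hs.1 hs.2 le_rfl) (by positivity))
        _ ≤ _ := by
            rw [← intervalIntegral.integral_const_mul]
            refine intervalIntegral.integral_mono_on hs.2
              (Continuous.intervalIntegrable (by fun_prop) _ _)
              (Continuous.intervalIntegrable (by fun_prop) _ _) fun τ hτ => ?_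
            have hτ' : τ ∈ Icc 0 t := ⟨hs.1.trans hτ.1, hτ.2⟩
            have h1 : -(inner ℝ (η τ) (η' τ)) ≤ ‖η τ‖ * (K * (‖η τ‖ + ‖ζ τ‖)) :=
              (neg_le_abs _).trans ((abs_real_inner_le_norm _ _).trans
                (mul_le_mul_of_nonneg_left (hKη τ hτ') (norm_nonneg _)))
            have h2 : Real.exp (3 * K * τ) ≤ Real.exp (3 * K * T) := by
              gcongr; exact hτ.2.trans ht.2
            have h3 : -(K * ‖ζ τ‖ ^ 2) ≤ 3 * K * ‖η τ‖ ^ 2 + 2 * inner ℝ (η τ) (η' τ) := by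
              nlinarith [mul_nonneg hK (sq_nonneg (‖η τ‖ - ‖ζ τ‖))]
            calc -(K * Real.exp (3 * K * T)) * (‖ζ τ‖ ^ 2 + ‖ζ' τ - f τ‖ ^ 2)
                ≤ -(K * Real.exp (3 * K * τ)) * ‖ζ τ‖ ^ 2 := by
                  rw [neg_mul, neg_mul]
                  refine neg_le_neg ?_
                  gcongr
                  nlinarith [sq_nonneg ‖ζ' τ - f τ‖]
              _ = Real.exp (3 * K * τ) * -(K * ‖ζ τ‖ ^ 2) := by ring
              _ ≤ Real.exp (3 * K * τ) * (3 * K * ‖η τ‖ ^ 2 + 2 * inner ℝ (η τ) (η' τ)) := by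
                  gcongr
              _ = _ := by ring
    have e3 : Real.exp (3 * K * t) ≤ Real.exp (3 * K * T) := by
      gcongr; exact ht.2
    have e4 : 1 * ‖η s‖ ^ 2 ≤ Real.exp (3 * K * s) * ‖η s‖ ^ 2 := by
      gcongr
      exact Real.one_le_exp (by have := hs.1; positivity)
    have e5 : Real.exp (3 * K * t) * ‖η t‖ ^ 2 ≤ Real.exp (3 * K * T) * D ^ 2 := by
      gcongr
      rw [hD]; linarith
    have e6 : K * Real.exp (3 * K * T) * J ≤ K * Real.exp (3 * K * T) * I := by
      gcongr
      rw [hI]; nlinarith [sq_nonneg ‖ζ 0 - g‖]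
    linarith
  -- forward estimate of `ζ`
  have hζ2 : ∀ s ∈ Icc 0 t, ‖ζ s‖ ^ 2 ≤ 2 * I + (T + 2) * D ^ 2 := by
    intro s hs
    have e1 : ∫ τ in (0 : ℝ)..s, (2 * inner ℝ (ζ τ) (ζ' τ)) = ‖ζ s‖ ^ 2 - ‖ζ 0‖ ^ 2 :=
      intervalIntegral.integral_eq_sub_of_hasDerivAt (f := fun τ => ‖ζ τ‖ ^ 2)
        (fun τ _ => (hζ τ).norm_sq) (Continuous.intervalIntegrable (by fun_prop) _ _)
    have e2 : ∫ τ in (0 : ℝ)..s, (2 * inner ℝ (ζ τ) (ζ' τ))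
        ≤ ∫ τ in (0 : ℝ)..s, (2 * (‖ζ τ‖ ^ 2 + ‖ζ' τ - f τ‖ ^ 2) + φ ^ 2) := by
      refine intervalIntegral.integral_mono_on hs.1
        (Continuous.intervalIntegrable (by fun_prop) _ _)
        (Continuous.intervalIntegrable (by fun_prop) _ _) fun τ hτ => ?_
      have hτ' : τ ∈ Icc 0 t := ⟨hτ.1, hτ.2.trans hs.2⟩
      have h1 : inner ℝ (ζ τ) (ζ' τ) = inner ℝ (ζ τ) (ζ' τ - f τ) + inner ℝ (ζ τ) (f τ) := by
        rw [← inner_add_right, sub_add_cancel]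
      have h2 := real_inner_le_norm (ζ τ) (ζ' τ - f τ)
      have h3 : inner ℝ (ζ τ) (f τ) ≤ ‖ζ τ‖ * φ := (real_inner_le_norm _ _).trans
        (mul_le_mul_of_nonneg_left (hf τ hτ') (norm_nonneg _))
      have h4 := two_mul_le_add_sq ‖ζ τ‖ ‖ζ' τ - f τ‖
      have h5 := two_mul_le_add_sq ‖ζ τ‖ φ
      have h6 := sq_nonneg ‖ζ' τ - f τ‖
      linarith
    rw [e1, intervalIntegral.integral_add (Continuous.intervalIntegrable (by fun_prop) _ _)
      (Continuous.intervalIntegrable (by fun_prop) _ _),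
      intervalIntegral.integral_const_mul] at e2
    simp only [intervalIntegral.integral_const, sub_zero, smul_eq_mul] at e2
    have e3 := hJs 0 s le_rfl hs.1 hs.2
    have e4 : s * φ ^ 2 ≤ T * φ ^ 2 := by gcongr; exact hs.2.trans ht.2
    have e5 : ‖ζ 0‖ ^ 2 ≤ 2 * ‖ζ 0 - g‖ ^ 2 + 2 * φ ^ 2 := by
      have h1 : ‖ζ 0‖ ≤ ‖ζ 0 - g‖ + φ := by
        calc ‖ζ 0‖ = ‖(ζ 0 - g) + g‖ := by rw [sub_add_cancel]
          _ ≤ _ := (norm_add_le _ _).trans (by gcongr)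
      nlinarith [sq_nonneg (‖ζ 0 - g‖ - φ), norm_nonneg (ζ 0), norm_nonneg (ζ 0 - g)]
    have e6 : φ ^ 2 ≤ D ^ 2 := by gcongr; rw [hD]; linarith [norm_nonneg (η t)]
    have e7 : (T + 2) * φ ^ 2 ≤ (T + 2) * D ^ 2 := by gcongr
    rw [hI]
    linarith
  have hMA : M ^ 2 ≤ A * (I + D ^ 2) := by
    rw [hM2, hA]
    have h1 := hη2 s₀ hs₀
    have h2 := hζ2 s₀ hs₀
    have hE := Real.exp_pos (3 * K * T)
    nlinarith [mul_nonneg hE.le hI0, mul_nonneg (mul_nonneg hE.le hK) (sq_nonneg D),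
      mul_nonneg hT hI0, sq_nonneg D]
  have hMC : M ≤ (A * B + A + 1) * D := by
    by_contra! hlt
    have hD1 : D ≤ (A * B + A + 1) * D := le_mul_of_one_le_left hD0 (by nlinarith [mul_pos hA0 hB0])
    have hMD : D ≤ M := hD1.trans hlt.le
    have hMpos : 0 < M := lt_of_le_of_lt (by positivity) hlt
    have h1 : (A * B + A + 1) * D * M < M * M := mul_lt_mul_of_pos_right hlt hMpos
    have h2 : A * I ≤ A * (B * D * M) := by gcongr
    have h3 : A * D ^ 2 ≤ A * (D * M) := by rw [sq]; gcongr
    nlinarith [mul_nonneg hD0 hM0]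
  exact fun s hs => ⟨(hηM s hs).trans hMC, (hζM s hs).trans hMC⟩

/-! ### Legendre duality -/

section Legendre

variable {d : ℕ}

/-- The gradient in the first variable of a function on `ℝ^d × ℝ^d`. -/
noncomputable def gradFst (H : Pt d × Pt d → ℝ) (z : Pt d × Pt d) : Pt d :=
  (InnerProductSpace.toDual ℝ (Pt d)).symm
    ((fderiv ℝ H z).comp (ContinuousLinearMap.inl ℝ (Pt d) (Pt d)))

/-- The gradient in the second variable of a function on `ℝ^d × ℝ^d`. -/
noncomputable def gradSnd (H : Pt d × Pt d → ℝ) (z : Pt d × Pt d) : Pt d :=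
  (InnerProductSpace.toDual ℝ (Pt d)).symm
    ((fderiv ℝ H z).comp (ContinuousLinearMap.inr ℝ (Pt d) (Pt d)))

theorem inner_gradFst (H : Pt d × Pt d → ℝ) (z : Pt d × Pt d) (w : Pt d) :
    inner ℝ (gradFst H z) w = fderiv ℝ H z (w, 0) := by
  rw [gradFst, InnerProductSpace.toDual_symm_apply]; rfl

theorem inner_gradSnd (H : Pt d × Pt d → ℝ) (z : Pt d × Pt d) (w : Pt d) :
    inner ℝ (gradSnd H z) w = fderiv ℝ H z (0, w) := by
  rw [gradSnd, InnerProductSpace.toDual_symm_apply]; rfl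

theorem fderiv_eq_inner_grad (H : Pt d × Pt d → ℝ) (z : Pt d × Pt d) (h k : Pt d) :
    fderiv ℝ H z (h, k) = inner ℝ (gradFst H z) h + inner ℝ (gradSnd H z) k := by
  rw [inner_gradFst, inner_gradSnd, ← map_add]; simp

theorem norm_gradFst_sub_le {H : Pt d × Pt d → ℝ} {κ : ℝ≥0} (hH : LipschitzWith κ (fderiv ℝ H))
    (z z' : Pt d × Pt d) : ‖gradFst H z - gradFst H z'‖ ≤ κ * ‖z - z'‖ := by
  rw [gradFst, gradFst, ← map_sub, LinearIsometryEquiv.norm_map, ← ContinuousLinearMap.sub_comp]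
  refine (ContinuousLinearMap.opNorm_comp_le _ _).trans ?_
  refine (mul_le_of_le_one_right (norm_nonneg _)
      (ContinuousLinearMap.norm_inl_le_one _ _ _)).trans ?_
  exact hH.norm_sub_le z z'

theorem norm_gradSnd_sub_le {H : Pt d × Pt d → ℝ} {κ : ℝ≥0} (hH : LipschitzWith κ (fderiv ℝ H))
    (z z' : Pt d × Pt d) : ‖gradSnd H z - gradSnd H z'‖ ≤ κ * ‖z - z'‖ := by
  rw [gradSnd, gradSnd, ← map_sub, LinearIsometryEquiv.norm_map, ← ContinuousLinearMap.sub_comp]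
  refine (ContinuousLinearMap.opNorm_comp_le _ _).trans ?_
  refine (mul_le_of_le_one_right (norm_nonneg _)
      (ContinuousLinearMap.norm_inr_le_one _ _ _)).trans ?_
  exact hH.norm_sub_le z z'

theorem contDiff_gradFst {H : Pt d × Pt d → ℝ} {n : ℕ} (hH : ContDiff ℝ (n + 1) H) :
    ContDiff ℝ n (gradFst H) :=
  (InnerProductSpace.toDual ℝ (Pt d)).symm.contDiff.comp
    ((hH.fderiv_right le_rfl).clm_comp contDiff_const)

theorem contDiff_gradSnd {H : Pt d × Pt d → ℝ} {n : ℕ} (hH : ContDiff ℝ (n + 1) H) :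
    ContDiff ℝ n (gradSnd H) :=
  (InnerProductSpace.toDual ℝ (Pt d)).symm.contDiff.comp
    ((hH.fderiv_right le_rfl).clm_comp contDiff_const)

theorem LegendreDual.symm {H L : Pt d × Pt d → ℝ} (h : LegendreDual H L) : LegendreDual L H := by
  intro q
  constructor
  · intro p
    simpa only [real_inner_comm] using (h q).2 p
  · intro p
    simpa only [real_inner_comm] using (h q).1 p

/-- Equality in the Fenchel inequality at `v = D_p H(q, p)`. -/
theorem LegendreDual.fenchel_eq {H L : Pt d × Pt d → ℝ} (h : LegendreDual H L)
    (hH : Differentiable ℝ H) {κ : ℝ≥0} (hlip : LipschitzWith κ (fderiv ℝ H)) (q p : Pt d) :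
    L (q, gradSnd H (q, p)) + H (q, p) = inner ℝ p (gradSnd H (q, p)) := by
  set v := gradSnd H (q, p) with hv
  have hconv : ConvexOn ℝ univ fun p : Pt d => H (q, p) := by
    refine ⟨convex_univ, fun p _ p' _ a b ha hb hab => ?_⟩
    refine ((h q).1 (a • p + b • p')).2 ?_
    rintro _ ⟨w, rfl⟩
    have h1 := ((h q).1 p).1 ⟨w, rfl⟩
    have h2 := ((h q).1 p').1 ⟨w, rfl⟩
    simp only [inner_add_left, inner_smul_left, smul_eq_mul, RCLike.conj_to_real] at *
    have h3 := mul_le_mul_of_nonneg_left h1 ha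
    have h4 := mul_le_mul_of_nonneg_left h2 hb
    have h5 : L (q, w) = a * L (q, w) + b * L (q, w) := by rw [← add_mul, hab, one_mul]
    linarith
  have hd : ∀ p, HasFDerivAt (fun p : Pt d => H (q, p)) (innerSL ℝ (gradSnd H (q, p))) p := by
    intro p
    have h1 : HasFDerivAt (fun p : Pt d => (q, p)) (ContinuousLinearMap.inr ℝ (Pt d) (Pt d)) p :=
      hasFDerivAt_prodMk_right q p
    have h2 : innerSL ℝ (gradSnd H (q, p))
        = (fderiv ℝ H (q, p)).comp (ContinuousLinearMap.inr ℝ (Pt d) (Pt d)) := by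
      refine ContinuousLinearMap.ext fun w => ?_
      rw [innerSL_apply_apply, inner_gradSnd]; rfl
    rw [h2]
    exact (hH (q, p)).hasFDerivAt.comp p h1
  have hd' : ∀ y y', ‖innerSL ℝ (gradSnd H (q, y)) - innerSL ℝ (gradSnd H (q, y'))‖
      ≤ κ * ‖y - y'‖ := fun y y' => by
    rw [← map_sub, innerSL_apply_norm]
    refine (norm_gradSnd_sub_le hlip _ _).trans_eq ?_
    simp [Prod.norm_def]
  refine le_antisymm ?_ ?_
  · rw [← le_sub_iff_add_le]
    refine ((h q).2 v).2 ?_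
    rintro _ ⟨p', rfl⟩
    have h1 := convexOn_add_fderiv_le hd hd' κ.2 hconv p (p' - p)
    simp only [innerSL_apply_apply, add_sub_cancel, ← hv, inner_sub_right] at h1
    rw [real_inner_comm p', real_inner_comm p] at h1
    linarith
  · rw [← sub_le_iff_le_add]
    exact ((h q).2 v).1 ⟨p, rfl⟩

/-- Legendre duality between the gradients: if `v = D_p H(q, p)`, then `p = D_v L(q, v)` and
`D_q L(q, v) = - D_q H(q, p)`. Both follow from the Fenchel inequality, which becomes an equality
at `(q, v)`. -/
theorem LegendreDual.grad_eq {H L : Pt d × Pt d → ℝ} (h : LegendreDual H L)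
    (hH : Differentiable ℝ H) (hL : Differentiable ℝ L) {κ : ℝ≥0}
    (hlip : LipschitzWith κ (fderiv ℝ H)) (q p : Pt d) :
    gradSnd L (q, gradSnd H (q, p)) = p ∧
      gradFst L (q, gradSnd H (q, p)) = -gradFst H (q, p) := by
  set v := gradSnd H (q, p) with hv
  have hmin : IsLocalMin (fun z : Pt d × Pt d => L z + H (z.1, p) - inner ℝ p z.2) (q, v) := by
    refine Filter.Eventually.of_forall fun z => ?_
    change L (q, v) + H (q, p) - inner ℝ p v ≤ L z + H (z.1, p) - inner ℝ p z.2
    rw [h.fenchel_eq hH hlip q p, sub_self]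
    have h1 := ((h z.1).1 p).1 ⟨z.2, rfl⟩
    simp only [Prod.mk.eta] at h1
    linarith
  have h1 : HasFDerivAt (fun z : Pt d × Pt d => H (z.1, p))
      ((fderiv ℝ H (q, p)).comp ((ContinuousLinearMap.inl ℝ (Pt d) (Pt d)).comp
        (ContinuousLinearMap.fst ℝ (Pt d) (Pt d)))) (q, v) := by
    have h2 : HasFDerivAt (fun z : Pt d × Pt d => (z.1, p))
      ((ContinuousLinearMap.inl ℝ (Pt d) (Pt d)).comp
        (ContinuousLinearMap.fst ℝ (Pt d) (Pt d))) (q, v) :=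
      HasFDerivAt.comp (q, v) (g := fun y : Pt d => (y, p)) (hasFDerivAt_prodMk_left q p)
        hasFDerivAt_fst
    exact (hH (q, p)).hasFDerivAt.comp (q, v) h2
  have h3 : HasFDerivAt (fun z : Pt d × Pt d => inner ℝ p z.2)
      ((innerSL ℝ p).comp (ContinuousLinearMap.snd ℝ (Pt d) (Pt d))) (q, v) :=
    (innerSL ℝ p).hasFDerivAt.comp (q, v) hasFDerivAt_snd
  have h4 := hmin.hasFDerivAt_eq_zero (((hL (q, v)).hasFDerivAt.add h1).sub h3)
  have h5 : ∀ a b : Pt d, inner ℝ (gradFst L (q, v)) a + inner ℝ (gradSnd L (q, v)) b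
      + inner ℝ (gradFst H (q, p)) a - inner ℝ p b = 0 := by
    intro a b
    have := DFunLike.congr_fun h4 (a, b)
    simp only [sub_apply, add_apply,
      fderiv_eq_inner_grad] at this
    simpa [inner_gradFst] using this
  constructor
  · refine ext_inner_right ℝ fun b => ?_
    have := h5 0 b
    simp only [inner_zero_right] at this
    linarith
  · refine ext_inner_right ℝ fun a => ?_
    have := h5 a 0
    simp only [inner_zero_right] at this
    rw [inner_neg_left]
    linarith

end Legendre

/-! ### Step maps -/

section StepMap

variable {d m : ℕ} (P : Equipartition d m)

theorem Equipartition.cell_subset (i : Fin m) : P.cell i ⊆ cube d := by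
  rw [← P.iUnion_cell]; exact subset_iUnion _ _

theorem Equipartition.cubeMeasure_cell (i : Fin m) :
    cubeMeasure d (P.cell i) = (m : ℝ≥0∞)⁻¹ := by
  rw [cubeMeasure, Measure.restrict_apply (P.measurableSet_cell i),
    inter_eq_self_of_subset_left (P.cell_subset i), P.volume_cell]

theorem Equipartition.real_cubeMeasure_cell (i : Fin m) :
    (cubeMeasure d).real (P.cell i) = (m : ℝ)⁻¹ := by
  simp [Measure.real, P.cubeMeasure_cell]

theorem Equipartition.isProbabilityMeasure {d m : ℕ} (P : Equipartition d m)
    (hm : m ≠ 0) : IsProbabilityMeasure (cubeMeasure d) := by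
  constructor
  rw [cubeMeasure, Measure.restrict_apply_univ, ← P.iUnion_cell,
    measure_iUnion (fun i j hij => P.disjoint_cell i j hij) P.measurableSet_cell]
  simp only [P.volume_cell, tsum_fintype, Finset.sum_const, Finset.card_univ, Fintype.card_fin,
    nsmul_eq_mul]
  exact ENNReal.mul_inv_cancel (by exact_mod_cast hm) (by finiteness)

theorem Equipartition.ae_mem_iUnion_cell : ∀ᵐ ω ∂(cubeMeasure d), ω ∈ ⋃ i, P.cell i := by
  have hmeas : MeasurableSet (cube d) := by
    rw [← P.iUnion_cell]; exact MeasurableSet.iUnion P.measurableSet_cell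
  rw [P.iUnion_cell]
  exact ae_restrict_mem hmeas

theorem stepMap_ae_eq (q : Fin m → Pt d) :
    stepMap P q =ᵐ[cubeMeasure d] fun ω => ∑ i, (P.cell i).indicator (fun _ => q i) ω := by
  have h : ∀ s : Finset (Fin m), ((∑ i ∈ s, indicatorConstLp 2 (P.measurableSet_cell i)
      (P.cubeMeasure_cell_ne_top i) (q i) : Hilb d) : Pt d → Pt d) =ᵐ[cubeMeasure d]
      fun ω => ∑ i ∈ s, (P.cell i).indicator (fun _ => q i) ω := by
    intro s
    induction s using Finset.induction_on with
    | empty =>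
      simp only [Finset.sum_empty]
      exact Lp.coeFn_zero _ _ _
    | insert a s ha ih =>
      rw [Finset.sum_insert ha]
      filter_upwards [Lp.coeFn_add (indicatorConstLp 2 (P.measurableSet_cell a)
        (P.cubeMeasure_cell_ne_top a) (q a)) (∑ i ∈ s, indicatorConstLp 2 (P.measurableSet_cell i)
        (P.cubeMeasure_cell_ne_top i) (q i) : Hilb d), ih,
        indicatorConstLp_coeFn (p := 2) (hs := P.measurableSet_cell a)
          (hμs := P.cubeMeasure_cell_ne_top a) (c := q a)] with ω h1 h2 h3
      rw [h1, Pi.add_apply, h2, h3, Finset.sum_insert ha]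
  exact h Finset.univ

theorem stepMap_ae : ∀ q : Fin m → Pt d,
    ∀ᵐ ω ∂(cubeMeasure d), ∀ i, ω ∈ P.cell i → stepMap P q ω = q i := by
  intro q
  filter_upwards [stepMap_ae_eq P q] with ω hω i hi
  rw [hω, Finset.sum_eq_single i, indicator_of_mem hi]
  · intro j _ hj
    exact indicator_of_notMem (fun h => disjoint_left.1 (P.disjoint_cell j i hj) h hi) _
  · simp

/-- The step map as a bounded linear operator. -/
noncomputable def stepCLM : (Fin m → Pt d) →L[ℝ] Hilb d :=
  LinearMap.toContinuousLinearMap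
    { toFun := stepMap P
      map_add' := fun x y => by
        simp only [stepMap, ← Finset.sum_add_distrib, Pi.add_apply, indicatorConstLp_add]
      map_smul' := fun c x => by
        refine Lp.ext ?_
        filter_upwards [stepMap_ae P (c • x), stepMap_ae P x, P.ae_mem_iUnion_cell,
          Lp.coeFn_smul c (stepMap P x)] with ω h1 h2 h3 h4
        obtain ⟨i, hi⟩ := mem_iUnion.1 h3
        rw [RingHom.id_apply, h4, h1 i hi, Pi.smul_apply, Pi.smul_apply, h2 i hi] }

@[simp] theorem stepCLM_apply (q : Fin m → Pt d) : stepCLM P q = stepMap P q := rfl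

theorem stepMap_add (x y : Fin m → Pt d) : stepMap P (x + y) = stepMap P x + stepMap P y :=
  map_add (stepCLM P) x y

theorem stepMap_sub (x y : Fin m → Pt d) : stepMap P (x - y) = stepMap P x - stepMap P y :=
  map_sub (stepCLM P) x y

theorem inner_stepMap (p : Fin m → Pt d) (y : Hilb d) :
    inner ℝ (stepMap P p) y = ∑ i, inner ℝ (p i) (∫ ω in P.cell i, y ω ∂(cubeMeasure d)) := by
  rw [stepMap, sum_inner]
  refine Finset.sum_congr rfl fun i _ => ?_
  rw [L2.inner_indicatorConstLp_eq_inner_setIntegral]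

theorem setIntegral_stepMap (q : Fin m → Pt d) (i : Fin m) :
    ∫ ω in P.cell i, stepMap P q ω ∂(cubeMeasure d) = (m : ℝ)⁻¹ • q i := by
  have : ∀ᵐ ω ∂(cubeMeasure d), ω ∈ P.cell i → stepMap P q ω = q i := by
    filter_upwards [stepMap_ae P q] with ω hω using hω i
  rw [setIntegral_congr_ae (P.measurableSet_cell i) this, setIntegral_const,
    P.real_cubeMeasure_cell]

theorem inner_stepMap_stepMap (p q : Fin m → Pt d) :
    inner ℝ (stepMap P p) (stepMap P q) = (m : ℝ)⁻¹ * ∑ i, inner ℝ (p i) (q i) := by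
  rw [inner_stepMap, Finset.mul_sum]
  refine Finset.sum_congr rfl fun i _ => ?_
  rw [setIntegral_stepMap, inner_smul_right]

theorem norm_stepMap_sq (q : Fin m → Pt d) :
    ‖stepMap P q‖ ^ 2 = (m : ℝ)⁻¹ * ∑ i, ‖q i‖ ^ 2 := by
  rw [← real_inner_self_eq_norm_sq, inner_stepMap_stepMap]
  simp only [real_inner_self_eq_norm_sq]

/-- Integration over the cube of a function of two step maps. -/
theorem integral_comp_stepMap (g : Pt d × Pt d → ℝ) (x v : Fin m → Pt d) :
    ∫ ω, g (stepMap P x ω, stepMap P v ω) ∂(cubeMeasure d) = (m : ℝ)⁻¹ * ∑ i, g (x i, v i) := by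
  have h : (fun ω => g (stepMap P x ω, stepMap P v ω)) =ᵐ[cubeMeasure d]
      fun ω => ∑ i, (P.cell i).indicator (fun _ => g (x i, v i)) ω := by
    filter_upwards [stepMap_ae P x, stepMap_ae P v, P.ae_mem_iUnion_cell] with ω h1 h2 h3
    obtain ⟨i, hi⟩ := mem_iUnion.1 h3
    rw [h1 i hi, h2 i hi, Finset.sum_eq_single i, indicator_of_mem hi]
    · intro j _ hj
      exact indicator_of_notMem (fun h => disjoint_left.1 (P.disjoint_cell j i hj) h hi) _
    · simp
  rw [integral_congr_ae h, integral_finsetSum, Finset.mul_sum]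
  · refine Finset.sum_congr rfl fun i _ => ?_
    rw [integral_indicator_const _ (P.measurableSet_cell i), P.real_cubeMeasure_cell, smul_eq_mul]
  · intro i _
    exact (integrable_indicator_iff (P.measurableSet_cell i)).2
      (integrableOn_const (P.cubeMeasure_cell_ne_top i))

theorem liftedLagrangian_stepMap (L : Pt d × Pt d → ℝ) (F : Hilb d → ℝ) (x v : Fin m → Pt d) :
    liftedLagrangian L F (stepMap P x) (stepMap P v)
      = (m : ℝ)⁻¹ * ∑ i, L (x i, v i) + discretize P F x := by
  rw [liftedLagrangian, integral_comp_stepMap P L]; rfl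

end StepMap

/-! ### Gradients of rearrangement invariant functions at step maps -/

/-- Subsets of prescribed measure exist because the radial distribution of a set has no atoms. -/
theorem exists_subset_cubeMeasure_eq {d : ℕ} (hd : 1 ≤ d) [IsFiniteMeasure (cubeMeasure d)]
    {A : Set (Pt d)} (hA : MeasurableSet A) {a : ℝ} (ha0 : 0 ≤ a)
    (ha : a ≤ (cubeMeasure d).real A) :
    ∃ B ⊆ A, MeasurableSet B ∧ (cubeMeasure d).real B = a := by
  rcases ha.eq_or_lt with rfl | ha
  · exact ⟨A, subset_rfl, hA, rfl⟩
  have : Nonempty (Fin d) := ⟨⟨0, hd⟩⟩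
  have : Nontrivial (Pt d) := inferInstance
  have hsph : ∀ r : ℝ, (cubeMeasure d).restrict A ((fun ω : Pt d => ‖ω‖) ⁻¹' {r}) = 0 := by
    intro r
    refine le_antisymm ((Measure.restrict_apply_le _ _).trans
      ((Measure.restrict_apply_le _ _).trans ?_)) bot_le
    have h1 : (fun ω : Pt d => ‖ω‖) ⁻¹' {r} = Metric.sphere 0 r := by ext; simp
    rw [h1, Measure.addHaar_sphere]
  set ν : Measure ℝ := ((cubeMeasure d).restrict A).map (fun ω : Pt d => ‖ω‖) with hν
  have hmeas : Measurable fun ω : Pt d => ‖ω‖ := measurable_norm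
  have : NullSingletonClass ν := ⟨fun r => by rw [hν, Measure.map_apply hmeas
      (measurableSet_singleton r), hsph]⟩
  have : IsFiniteMeasure ν := by rw [hν]; infer_instance
  have hval : ∀ r : ℝ, 0 ≤ r → ∫ _ in (0 : ℝ)..r, (1 : ℝ) ∂ν
      = (cubeMeasure d).real (A ∩ (fun ω : Pt d => ‖ω‖) ⁻¹' (Ioc 0 r)) := by
    intro r hr
    rw [intervalIntegral.integral_of_le hr]
    simp only [integral_const, smul_eq_mul, mul_one, measureReal_restrict_apply_univ]
    rw [Measure.real, hν, Measure.map_apply hmeas measurableSet_Ioc,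
      Measure.restrict_apply (hmeas measurableSet_Ioc), inter_comm]
    rfl
  have hcont : Continuous fun r : ℝ => ∫ _ in (0 : ℝ)..r, (1 : ℝ) ∂ν :=
    intervalIntegral.continuous_primitive (fun a b => by
      simp) 0
  have hlim : Filter.Tendsto (fun r : ℝ => ∫ _ in (0 : ℝ)..r, (1 : ℝ) ∂ν) Filter.atTop
      (nhds (∫ _ in Ioi (0 : ℝ), (1 : ℝ) ∂ν)) :=
    intervalIntegral_tendsto_integral_Ioi 0 (integrable_const _) Filter.tendsto_id
  have htot : ∫ _ in Ioi (0 : ℝ), (1 : ℝ) ∂ν = (cubeMeasure d).real A := by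
    simp only [integral_const, smul_eq_mul, mul_one, measureReal_restrict_apply_univ]
    have h1 : (fun ω : Pt d => ‖ω‖) ⁻¹' (Ioi 0) = ((fun ω : Pt d => ‖ω‖) ⁻¹' {0})ᶜ := by
      ext ω; simp
    rw [Measure.real, hν, Measure.map_apply hmeas measurableSet_Ioi, h1,
      measure_compl (hmeas (measurableSet_singleton 0)) (by finiteness), hsph, tsub_zero,
      Measure.restrict_apply_univ]
    rfl
  rw [htot] at hlim
  obtain ⟨R, hR, hR0⟩ := ((hlim.eventually (lt_mem_nhds ha)).and
    (Filter.eventually_ge_atTop 0)).exists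
  obtain ⟨r, hr, hra⟩ := intermediate_value_Icc hR0 hcont.continuousOn
    (show a ∈ Icc _ _ from ⟨by simpa using ha0, hR.le⟩)
  refine ⟨A ∩ (fun ω : Pt d => ‖ω‖) ⁻¹' (Ioc 0 r), inter_subset_left,
    hA.inter (hmeas measurableSet_Ioc), ?_⟩
  rw [← hval r hr.1]
  exact hra

/-- If the integral of `f` over a subset of `C` only depends on the measure of the subset, then `f`
is constant on `C`. Otherwise the sets where `f` exceeds its mean and where it falls below it both
have positive measure, and contain subsets of the same positive measure. -/
theorem ae_eq_const_of_setIntegral_eq {d : ℕ} (hd : 1 ≤ d) [IsFiniteMeasure (cubeMeasure d)]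
    {C : Set (Pt d)} (hC : MeasurableSet C) {f : Pt d → ℝ} (hf : Integrable f (cubeMeasure d))
    (hfm : Measurable f)
    (h : ∀ A B, MeasurableSet A → MeasurableSet B → A ⊆ C → B ⊆ C →
      (cubeMeasure d).real A = (cubeMeasure d).real B →
      ∫ ω in A, f ω ∂(cubeMeasure d) = ∫ ω in B, f ω ∂(cubeMeasure d)) (c : ℝ)
    (hc : ∫ ω in C, f ω ∂(cubeMeasure d) = (cubeMeasure d).real C * c) :
    ∀ᵐ ω ∂(cubeMeasure d), ω ∈ C → f ω = c := by
  set μ := cubeMeasure d with hμ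
  set A := C ∩ {ω | c < f ω} with hA
  set B := C ∩ {ω | f ω < c} with hB
  have hAm : MeasurableSet A := hC.inter (measurableSet_lt measurable_const hfm)
  have hBm : MeasurableSet B := hC.inter (measurableSet_lt hfm measurable_const)
  have hi : ∀ s, IntegrableOn (fun ω => f ω - c) s μ := fun s =>
    (hf.sub (integrable_const c)).integrableOn
  have hpos : ∀ D ⊆ A, MeasurableSet D → 0 < μ.real D → 0 < ∫ ω in D, (f ω - c) ∂μ := by
    intro D hD hDm hD0
    rw [setIntegral_pos_iff_support_of_nonneg_ae
      ((ae_restrict_mem hDm).mono fun ω hω => sub_nonneg.2 (hD hω).2.le) (hi D)]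
    refine lt_of_lt_of_le ((measureReal_ne_zero_iff).1 hD0.ne').bot_lt (measure_mono ?_)
    exact fun ω hω => ⟨(sub_pos.2 (hD hω).2).ne', hω⟩
  have hneg : ∀ D ⊆ B, MeasurableSet D → 0 < μ.real D → 0 < ∫ ω in D, (c - f ω) ∂μ := by
    intro D hD hDm hD0
    rw [setIntegral_pos_iff_support_of_nonneg_ae
      ((ae_restrict_mem hDm).mono fun ω hω => sub_nonneg.2 (hD hω).2.le)
      (((integrable_const c).sub hf).integrableOn)]
    refine lt_of_lt_of_le ((measureReal_ne_zero_iff).1 hD0.ne').bot_lt (measure_mono ?_)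
    exact fun ω hω => ⟨(sub_pos.2 (hD hω).2).ne', hω⟩
  have hsub : ∀ D, ∫ ω in D, (f ω - c) ∂μ = ∫ ω in D, f ω ∂μ - μ.real D * c := by
    intro D
    rw [integral_sub hf.integrableOn (integrable_const c), setIntegral_const, smul_eq_mul]
  have hsub' : ∀ D, ∫ ω in D, (c - f ω) ∂μ = μ.real D * c - ∫ ω in D, f ω ∂μ := by
    intro D
    rw [integral_sub (integrable_const c) hf.integrableOn, setIntegral_const, smul_eq_mul]
  -- subsets of equal measure of `A` and `B` are null
  have hnull : ∀ D E, D ⊆ A → E ⊆ B → MeasurableSet D → MeasurableSet E → μ.real D = μ.real E →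
      μ.real D = 0 := by
    intro D E hD hE hDm hEm heq
    by_contra h0
    have h1 := hpos D hD hDm (lt_of_le_of_ne measureReal_nonneg (Ne.symm h0))
    have h2 := hneg E hE hEm (by rw [← heq]; exact lt_of_le_of_ne measureReal_nonneg (Ne.symm h0))
    rw [hsub] at h1
    rw [hsub', ← heq, ← h D E hDm hEm (hD.trans inter_subset_left) (hE.trans inter_subset_left)
      heq] at h2
    linarith
  have hdec : ∫ ω in C, (f ω - c) ∂μ = ∫ ω in A, (f ω - c) ∂μ + ∫ ω in B, (f ω - c) ∂μ := by
    have h1 : Disjoint A B := by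
      rw [disjoint_left]; rintro ω ⟨_, h1⟩ ⟨_, h2⟩
      exact lt_asymm (show c < f ω from h1) h2
    rw [← setIntegral_union h1 hBm (hi _) (hi _)]
    refine setIntegral_eq_of_subset_of_forall_sdiff_eq_zero (f := fun ω => f ω - c) hC
      (union_subset (hA ▸ inter_subset_left) (hB ▸ inter_subset_left)) ?_
    intro ω hω
    have h3 : ¬ c < f ω := fun h => hω.2 (Or.inl ⟨hω.1, h⟩)
    have h4 : ¬ f ω < c := fun h => hω.2 (Or.inr ⟨hω.1, h⟩)
    linarith [le_antisymm (not_lt.1 h3) (not_lt.1 h4)]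
  have hC0 : ∫ ω in C, (f ω - c) ∂μ = 0 := by rw [hsub, hc, sub_self]
  have hAB : μ.real A = 0 ∧ μ.real B = 0 := by
    have key : μ.real A = 0 ∨ μ.real B = 0 := by
      rcases le_total (μ.real A) (μ.real B) with hle | hle
      · obtain ⟨E, hE, hEm, hEq⟩ := exists_subset_cubeMeasure_eq hd hBm measureReal_nonneg hle
        exact Or.inl (hnull A E subset_rfl hE hAm hEm hEq.symm)
      · obtain ⟨E, hE, hEm, hEq⟩ := exists_subset_cubeMeasure_eq hd hAm measureReal_nonneg hle
        exact Or.inr (hEq ▸ hnull E B hE subset_rfl hEm hBm hEq)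
    rcases key with h0 | h0
    · refine ⟨h0, ?_⟩
      by_contra hB0
      have h1 := hneg B subset_rfl hBm (lt_of_le_of_ne measureReal_nonneg (Ne.symm hB0))
      have h2 : ∫ ω in A, (f ω - c) ∂μ = 0 :=
        setIntegral_measure_zero _ ((measureReal_eq_zero_iff).1 h0)
      rw [hsub'] at h1
      rw [hdec, h2, hsub] at hC0
      linarith
    · refine ⟨?_, h0⟩
      by_contra hA0
      have h1 := hpos A subset_rfl hAm (lt_of_le_of_ne measureReal_nonneg (Ne.symm hA0))
      have h2 : ∫ ω in B, (f ω - c) ∂μ = 0 :=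
        setIntegral_measure_zero _ ((measureReal_eq_zero_iff).1 h0)
      rw [hdec, h2] at hC0
      linarith
  have hA0 : ∀ᵐ ω ∂μ, ω ∉ A := measure_eq_zero_iff_ae_notMem.1 ((measureReal_eq_zero_iff).1 hAB.1)
  have hB0 : ∀ᵐ ω ∂μ, ω ∉ B := measure_eq_zero_iff_ae_notMem.1 ((measureReal_eq_zero_iff).1 hAB.2)
  filter_upwards [hA0, hB0] with ω h1 h2 hω
  exact le_antisymm (not_lt.1 fun h => h1 ⟨hω, h⟩) (not_lt.1 fun h => h2 ⟨hω, h⟩)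

section Rearrangement

variable {d m : ℕ} (P : Equipartition d m)

/-- The components `m D_{q_k} G` of the gradient for the normalized inner product
`m⁻¹ ∑ k, ⟪p k, q k⟫`. -/
noncomputable def scaledGrad (G : (Fin m → Pt d) → ℝ) (x : Fin m → Pt d) : Fin m → Pt d :=
  fun k => (m : ℝ) • partialGrad G x k

theorem inner_partialGrad (G : (Fin m → Pt d) → ℝ) (x : Fin m → Pt d) (k : Fin m) (w : Pt d) :
    inner ℝ (partialGrad G x k) w = fderiv ℝ G x (Pi.single k w) := by
  rw [partialGrad, InnerProductSpace.toDual_symm_apply]; rfl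

theorem smul_indicatorConstLp {A : Set (Pt d)} (hA : MeasurableSet A) (hμA : cubeMeasure d A ≠ ∞)
    (ε : ℝ) (c : Pt d) :
    ε • (indicatorConstLp 2 hA hμA c : Hilb d) = indicatorConstLp 2 hA hμA (ε • c) := by
  refine Lp.ext ?_
  filter_upwards [Lp.coeFn_smul ε (indicatorConstLp 2 hA hμA c : Hilb d),
    indicatorConstLp_coeFn (p := 2) (hs := hA) (hμs := hμA) (c := c),
    indicatorConstLp_coeFn (p := 2) (hs := hA) (hμs := hμA) (c := ε • c)] with ω h1 h2 h3
  rw [h1, h3, Pi.smul_apply, h2]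
  by_cases hω : ω ∈ A <;> simp [hω]

/-- The law of a perturbation of a step map by a constant on a subset of a cell only depends on
the measure of the subset. -/
theorem map_stepMap_add_indicator [IsFiniteMeasure (cubeMeasure d)] (x : Fin m → Pt d) (k : Fin m)
    (c : Pt d) {A B : Set (Pt d)} (hA : MeasurableSet A) (hB : MeasurableSet B)
    (hAk : A ⊆ P.cell k) (hBk : B ⊆ P.cell k)
    (hAB : (cubeMeasure d).real A = (cubeMeasure d).real B) :
    (cubeMeasure d).map (stepMap P x + indicatorConstLp 2 hA (measure_ne_top _ A) c : Hilb d)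
      = (cubeMeasure d).map (stepMap P x + indicatorConstLp 2 hB (measure_ne_top _ B) c : Hilb d) := by
  set g : Set (Pt d) → Pt d → Pt d := fun D ω =>
    ∑ i, (P.cell i).indicator (fun _ => x i) ω + D.indicator (fun _ => c) ω with hg
  have hgm : ∀ D, MeasurableSet D → Measurable (g D) := fun D hD =>
    (Finset.measurable_sum _ fun i _ => measurable_const.indicator (P.measurableSet_cell i)).add
      (measurable_const.indicator hD)
  have hae : ∀ D (hD : MeasurableSet D),
      (stepMap P x + indicatorConstLp 2 hD (measure_ne_top _ D) c : Hilb d)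
        =ᵐ[cubeMeasure d] g D := by
    intro D hD
    filter_upwards [Lp.coeFn_add (stepMap P x) (indicatorConstLp 2 hD (measure_ne_top _ D) c),
      stepMap_ae_eq P x, indicatorConstLp_coeFn (p := 2) (hs := hD)
        (hμs := measure_ne_top (cubeMeasure d) D) (c := c)] with ω h1 h2 h3
    rw [h1, Pi.add_apply, h2, h3]
  have hcell : ∀ ω ∈ P.cell k, ∑ i, (P.cell i).indicator (fun _ => x i) ω = x k := by
    intro ω hω
    rw [Finset.sum_eq_single k, indicator_of_mem hω]
    · intro j _ hj
      exact indicator_of_notMem (fun h => disjoint_left.1 (P.disjoint_cell j k hj) h hω) _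
    · simp
  rw [Measure.map_congr (hae A hA), Measure.map_congr (hae B hB)]
  ext S hS
  rw [Measure.map_apply (hgm A hA) hS, Measure.map_apply (hgm B hB) hS]
  have hAB' : cubeMeasure d A = cubeMeasure d B := by
    rwa [measureReal_def, measureReal_def, ENNReal.toReal_eq_toReal_iff' (measure_ne_top _ _)
      (measure_ne_top _ _)] at hAB
  classical
  have hsplit : ∀ D, MeasurableSet D → D ⊆ P.cell k → cubeMeasure d (g D ⁻¹' S) =
      (if x k + c ∈ S then cubeMeasure d D else 0) +
      (if x k ∈ S then cubeMeasure d (P.cell k) - cubeMeasure d D else 0) +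
      cubeMeasure d (g ∅ ⁻¹' S \ P.cell k) := by
    intro D hD hDk
    rw [← measure_inter_add_sdiff (g D ⁻¹' S) (P.measurableSet_cell k),
      ← measure_inter_add_sdiff (g D ⁻¹' S ∩ P.cell k) hD]
    congr 1
    · congr 1
      · have : g D ⁻¹' S ∩ P.cell k ∩ D = if x k + c ∈ S then D else ∅ := by
          ext ω
          by_cases hω : ω ∈ D
          · have : g D ω = x k + c := by
              simp only [hg]; rw [hcell ω (hDk hω), indicator_of_mem hω]
            simp only [mem_inter_iff, mem_preimage, this, hω, hDk hω, and_true]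
            split_ifs with h <;> simp [h, hω]
          · split_ifs <;> simp [hω]
        rw [this]; split_ifs <;> simp
      · have : (g D ⁻¹' S ∩ P.cell k) \ D = if x k ∈ S then P.cell k \ D else ∅ := by
          ext ω
          by_cases hω : ω ∈ P.cell k \ D
          · have : g D ω = x k := by
              simp only [hg]; rw [hcell ω hω.1, indicator_of_notMem hω.2, add_zero]
            simp only [mem_sdiff, mem_inter_iff, mem_preimage, this, hω.1, hω.2, and_true,
              not_false_eq_true]
            split_ifs with h <;> simp [h, hω.1, hω.2]
          · have h2 : ω ∉ (g D ⁻¹' S ∩ P.cell k) \ D := fun h => hω ⟨h.1.2, h.2⟩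
            split_ifs <;> simp only [h2, hω, mem_empty_iff_false]
        rw [this]
        split_ifs
        · exact measure_sdiff hDk hD.nullMeasurableSet (measure_ne_top _ _)
        · simp
    · congr 1
      ext ω
      simp only [mem_sdiff, mem_preimage]
      refine and_congr_left fun hω => ?_
      have : g D ω = g ∅ ω := by
        simp only [hg]; rw [indicator_of_notMem fun h => hω (hDk h)]; simp
      rw [this]
  rw [hsplit A hA hAk, hsplit B hB hBk, hAB']

/-- The gradient of a rearrangement invariant function at a step map is a step map. -/
theorem fderiv_stepMap_apply (hd : 1 ≤ d) (hm : m ≠ 0) {G : Hilb d → ℝ} (hG : Differentiable ℝ G)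
    (hinv : RearrangementInvariant G) (x : Fin m → Pt d) (h : Hilb d) :
    fderiv ℝ G (stepMap P x) h = inner ℝ (stepMap P (scaledGrad (discretize P G) x)) h := by
  have := P.isProbabilityMeasure hm
  have hm' : (m : ℝ) ≠ 0 := by exact_mod_cast hm
  set g : Hilb d := (InnerProductSpace.toDual ℝ (Hilb d)).symm (fderiv ℝ G (stepMap P x)) with hg
  have hgi : ∀ h, fderiv ℝ G (stepMap P x) h = inner ℝ g h := fun h => by
    rw [hg, InnerProductSpace.toDual_symm_apply]
  have hAB : ∀ (k : Fin m) (c : Pt d) (A B : Set (Pt d)) (hA : MeasurableSet A)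
      (hB : MeasurableSet B), A ⊆ P.cell k → B ⊆ P.cell k →
      (cubeMeasure d).real A = (cubeMeasure d).real B →
      ∫ ω in A, inner ℝ c (g ω) ∂(cubeMeasure d) = ∫ ω in B, inner ℝ c (g ω) ∂(cubeMeasure d) := by
    intro k c A B hA hB hAk hBk hAB
    rw [← L2.inner_indicatorConstLp_eq_setIntegral_inner ℝ g hA c (measure_ne_top _ _),
      ← L2.inner_indicatorConstLp_eq_setIntegral_inner ℝ g hB c (measure_ne_top _ _),
      real_inner_comm, ← hgi, real_inner_comm, ← hgi]
    have hder : ∀ w : Hilb d, HasDerivAt (fun ε : ℝ => G (stepMap P x + ε • w))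
        (fderiv ℝ G (stepMap P x) w) 0 := by
      intro w
      have h1 : HasDerivAt (fun ε : ℝ => stepMap P x + ε • w) w 0 := by
        simpa using ((hasDerivAt_id (0 : ℝ)).smul_const w).const_add (stepMap P x)
      have h2 : HasFDerivAt G (fderiv ℝ G (stepMap P x)) (stepMap P x + (0 : ℝ) • w) := by
        simpa using (hG (stepMap P x)).hasFDerivAt
      exact h2.comp_hasDerivAt 0 h1
    refine (hder _).unique ?_
    have : (fun ε : ℝ => G (stepMap P x + ε • indicatorConstLp 2 hA (measure_ne_top _ A) c))
        = fun ε : ℝ => G (stepMap P x + ε • indicatorConstLp 2 hB (measure_ne_top _ B) c) := by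
      funext ε
      rw [smul_indicatorConstLp, smul_indicatorConstLp]
      exact hinv _ _ (map_stepMap_add_indicator P x k (ε • c) hA hB hAk hBk hAB)
    rw [this]
    exact hder _
  set ξ : Fin m → Pt d := fun k => (m : ℝ) • ∫ ω in P.cell k, g ω ∂(cubeMeasure d) with hξ
  have hgint : Integrable g (cubeMeasure d) := (Lp.memLp g).integrable (by norm_num)
  have hconst : ∀ (k : Fin m) (c : Pt d), ∀ᵐ ω ∂(cubeMeasure d), ω ∈ P.cell k →
      inner ℝ c (g ω) = inner ℝ c (ξ k) := by
    intro k c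
    refine ae_eq_const_of_setIntegral_eq hd (P.measurableSet_cell k) (hgint.const_inner c)
      ((Lp.stronglyMeasurable g).measurable.const_inner) (fun A B hA hB h1 h2 h3 =>
        hAB k c A B hA hB h1 h2 h3) _ ?_
    rw [integral_inner hgint.integrableOn, P.real_cubeMeasure_cell, hξ, inner_smul_right]
    field_simp
  have hstep : g = stepMap P ξ := by
    refine Lp.ext ?_
    have h1 : ∀ᵐ ω ∂(cubeMeasure d), ∀ (k : Fin m) (a : Fin d), ω ∈ P.cell k →
        inner ℝ (EuclideanSpace.single a (1 : ℝ)) (g ω)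
          = inner ℝ (EuclideanSpace.single a (1 : ℝ)) (ξ k) :=
      ae_all_iff.2 fun k => ae_all_iff.2 fun a => hconst k _
    filter_upwards [h1, stepMap_ae P ξ, P.ae_mem_iUnion_cell] with ω h1 h2 h3
    obtain ⟨k, hk⟩ := mem_iUnion.1 h3
    rw [h2 k hk]
    ext a
    have h4 := h1 k a hk
    rw [EuclideanSpace.inner_single_left, EuclideanSpace.inner_single_left] at h4
    simpa using h4
  have hξ' : ξ = scaledGrad (discretize P G) x := by
    funext k
    refine ext_inner_right ℝ fun w => ?_
    have h1 : HasFDerivAt (discretize P G) ((fderiv ℝ G (stepMap P x)).comp (stepCLM P)) x :=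
      (hG (stepMap P x)).hasFDerivAt.comp x (stepCLM P).hasFDerivAt
    rw [scaledGrad, inner_smul_left (partialGrad _ _ _), inner_partialGrad, h1.fderiv]
    simp only [ContinuousLinearMap.comp_apply, stepCLM_apply, hgi, hstep, inner_stepMap_stepMap]
    rw [Finset.sum_eq_single k]
    · simp [hm']
    · intro j _ hj; simp [hj]
    · simp
  rw [hgi, hstep, hξ']

end Rearrangement

/-! ### The lifted Lagrangian -/

section Lifted

variable {d : ℕ}

theorem abs_le_of_lipschitz_fderiv {Y : Type*} [NormedAddCommGroup Y] [NormedSpace ℝ Y] {f : Y → ℝ}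
    (hf : Differentiable ℝ f) {κ : ℝ≥0} (hlip : LipschitzWith κ (fderiv ℝ f)) (y : Y) :
    |f y| ≤ |f 0| + ‖fderiv ℝ f 0‖ + (‖fderiv ℝ f 0‖ + κ) * ‖y‖ ^ 2 := by
  have h1 := abs_sub_sub_le_of_lipschitz_fderiv (fun y => (hf y).hasFDerivAt)
    (fun y y' => hlip.norm_sub_le y y') κ.2 0 y
  have h2 : |fderiv ℝ f 0 y| ≤ ‖fderiv ℝ f 0‖ * ‖y‖ := (fderiv ℝ f 0).le_opNorm y
  have h3 : ‖y‖ ≤ 1 + ‖y‖ ^ 2 := by nlinarith [sq_nonneg (‖y‖ - 1), norm_nonneg y]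
  have h4 : ‖fderiv ℝ f 0‖ * ‖y‖ ≤ ‖fderiv ℝ f 0‖ * (1 + ‖y‖ ^ 2) := by gcongr
  rw [zero_add] at h1
  have h5 : |f y| ≤ |f y - f 0 - fderiv ℝ f 0 y| + |fderiv ℝ f 0 y| + |f 0| := by
    have : f y = (f y - f 0 - fderiv ℝ f 0 y) + fderiv ℝ f 0 y + f 0 := by ring
    conv_lhs => rw [this]
    exact (abs_add_le _ _).trans (by gcongr; exact abs_add_le _ _)
  nlinarith

theorem norm_prod_sq_le {X Y : Type*} [SeminormedAddCommGroup X] [SeminormedAddCommGroup Y]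
    (z : X × Y) : ‖z‖ ^ 2 ≤ ‖z.1‖ ^ 2 + ‖z.2‖ ^ 2 := by
  rw [Prod.norm_def]
  rcases max_cases ‖z.1‖ ‖z.2‖ with h | h <;> rw [h.1] <;> nlinarith [sq_nonneg ‖z.1‖,
      sq_nonneg ‖z.2‖]

theorem integrable_norm_sq (x : Hilb d) : Integrable (fun ω => ‖x ω‖ ^ 2) (cubeMeasure d) := by
  simpa only [real_inner_self_eq_norm_sq] using L2.integrable_inner (𝕜 := ℝ) x x

theorem integral_norm_sq (x : Hilb d) : ∫ ω, ‖x ω‖ ^ 2 ∂(cubeMeasure d) = ‖x‖ ^ 2 := by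
  rw [← real_inner_self_eq_norm_sq, L2.inner_def]
  simp only [real_inner_self_eq_norm_sq]

variable [IsProbabilityMeasure (cubeMeasure d)]

theorem integrable_comp_of_lipschitz_fderiv {L : Pt d × Pt d → ℝ} (hL : Differentiable ℝ L)
    {κ : ℝ≥0} (hlip : LipschitzWith κ (fderiv ℝ L)) (x a : Hilb d) :
    Integrable (fun ω => L (x ω, a ω)) (cubeMeasure d) ∧
    |∫ ω, L (x ω, a ω) ∂(cubeMeasure d)| ≤
      |L 0| + ‖fderiv ℝ L 0‖ + (‖fderiv ℝ L 0‖ + κ) * (‖x‖ ^ 2 + ‖a‖ ^ 2) := by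
  have hb : ∀ ω, ‖L (x ω, a ω)‖ ≤ |L 0| + ‖fderiv ℝ L 0‖
      + (‖fderiv ℝ L 0‖ + κ) * (‖x ω‖ ^ 2 + ‖a ω‖ ^ 2) := fun ω =>
    (abs_le_of_lipschitz_fderiv hL hlip _).trans (by
      gcongr; exact norm_prod_sq_le (x ω, a ω))
  have hint : Integrable (fun ω => |L 0| + ‖fderiv ℝ L 0‖
      + (‖fderiv ℝ L 0‖ + κ) * (‖x ω‖ ^ 2 + ‖a ω‖ ^ 2)) (cubeMeasure d) :=
    (integrable_const _).add (((integrable_norm_sq x).add (integrable_norm_sq a)).const_mul _)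
  refine ⟨hint.mono' (hL.continuous.comp_aestronglyMeasurable
    ((Lp.aestronglyMeasurable x).prodMk (Lp.aestronglyMeasurable a)))
    (Filter.Eventually.of_forall hb), ?_⟩
  refine (norm_integral_le_of_norm_le hint (Filter.Eventually.of_forall hb)).trans_eq ?_
  have hi : Integrable (fun ω => (‖fderiv ℝ L 0‖ + κ) * (‖x ω‖ ^ 2 + ‖a ω‖ ^ 2))
      (cubeMeasure d) := ((integrable_norm_sq x).add (integrable_norm_sq a)).const_mul _
  rw [integral_add (integrable_const _) hi, integral_const_mul,
    integral_add (integrable_norm_sq x) (integrable_norm_sq a), integral_norm_sq, integral_norm_sq]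
  simp

theorem exists_abs_liftedLagrangian_le {L : Pt d × Pt d → ℝ} (hL : Differentiable ℝ L)
    {κ : ℝ≥0} (hlip : LipschitzWith κ (fderiv ℝ L)) {F : Hilb d → ℝ} (hF : Differentiable ℝ F)
    (hFlip : LipschitzWith κ (fderiv ℝ F)) :
    ∃ C : ℝ, 0 ≤ C ∧ ∀ x a, |liftedLagrangian L F x a| ≤ C * (1 + ‖x‖ ^ 2 + ‖a‖ ^ 2) := by
  refine ⟨|L 0| + ‖fderiv ℝ L 0‖ + (‖fderiv ℝ L 0‖ + κ) + (|F 0| + ‖fderiv ℝ F 0‖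
    + (‖fderiv ℝ F 0‖ + κ)), by positivity, fun x a => ?_⟩
  have h1 := (integrable_comp_of_lipschitz_fderiv hL hlip x a).2
  have h2 := abs_le_of_lipschitz_fderiv hF hFlip x
  refine (abs_add_le _ _).trans ((add_le_add h1 h2).trans ?_)
  have := κ.2
  have e1 : 0 ≤ (|L 0| + ‖fderiv ℝ L 0‖) * (‖x‖ ^ 2 + ‖a‖ ^ 2) := by positivity
  have e2 : 0 ≤ ‖fderiv ℝ L 0‖ + κ := by positivity
  have e3 : 0 ≤ (|F 0| + ‖fderiv ℝ F 0‖) * (‖x‖ ^ 2 + ‖a‖ ^ 2) := by positivity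
  have e4 : 0 ≤ (‖fderiv ℝ F 0‖ + κ) * (1 + ‖a‖ ^ 2) := by positivity
  linarith

theorem continuous_liftedLagrangian {L : Pt d × Pt d → ℝ} (hL : Differentiable ℝ L)
    {κ : ℝ≥0} (hlip : LipschitzWith κ (fderiv ℝ L)) {F : Hilb d → ℝ} (hF : Differentiable ℝ F)
    (hFlip : LipschitzWith κ (fderiv ℝ F))
    (hconv : ConvexOn ℝ univ fun z : Hilb d × Hilb d => liftedLagrangian L F z.1 z.2) :
    Continuous fun z : Hilb d × Hilb d => liftedLagrangian L F z.1 z.2 := by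
  obtain ⟨C, hC, hb⟩ := exists_abs_liftedLagrangian_le hL hlip hF hFlip
  rw [← continuousOn_univ]
  have h := (hconv.continuousOn_tfae isOpen_univ ⟨0, mem_univ _⟩).out 1 3
  refine h.2 ⟨0, mem_univ _, ?_⟩
  refine Filter.isBoundedUnder_of_eventually_le (a := C * (1 + 1 ^ 2 + 1 ^ 2)) ?_
  filter_upwards [Metric.ball_mem_nhds (0 : Hilb d × Hilb d) one_pos] with z hz
  rw [mem_ball_zero_iff, Prod.norm_def, max_lt_iff] at hz
  refine (le_abs_self _).trans ((hb _ _).trans ?_)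
  gcongr
  · exact hz.1.le
  · exact hz.2.le

/-- A convex lifted Lagrangian lies above its tangent plane at a pair of step maps. -/
theorem liftedLagrangian_ge_tangent (hd : 1 ≤ d) {m : ℕ} (hm : m ≠ 0) (P : Equipartition d m)
    {L : Pt d × Pt d → ℝ} (hL : Differentiable ℝ L)
    {κ : ℝ≥0} (hlip : LipschitzWith κ (fderiv ℝ L)) {F : Hilb d → ℝ} (hF : Differentiable ℝ F)
    (hFlip : LipschitzWith κ (fderiv ℝ F)) (hFinv : RearrangementInvariant F)
    (hconv : ConvexOn ℝ univ fun z : Hilb d × Hilb d => liftedLagrangian L F z.1 z.2)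
    (x v : Fin m → Pt d) (y a : Hilb d) :
    liftedLagrangian L F (stepMap P x) (stepMap P v)
      + (inner ℝ (stepMap P fun k => gradFst L (x k, v k) + scaledGrad (discretize P F) x k)
          (y - stepMap P x)
        + inner ℝ (stepMap P fun k => gradSnd L (x k, v k)) (a - stepMap P v))
      ≤ liftedLagrangian L F y a := by
  set h := y - stepMap P x with hh
  set k := a - stepMap P v with hk
  refine le_of_forall_le_add_mul (c := κ * (‖h‖ ^ 2 + ‖k‖ ^ 2) + κ * ‖h‖ ^ 2) fun θ hθ hθ1 => ?_
  have h2 := hconv.2 (mem_univ (stepMap P x, stepMap P v)) (mem_univ (y, a))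
    (sub_nonneg.2 hθ1) hθ.le (by ring)
  rw [show (1 - θ) • (stepMap P x, stepMap P v) + θ • (y, a)
      = (stepMap P x + θ • h, stepMap P v + θ • k) by
    rw [hh, hk, Prod.smul_mk, Prod.smul_mk, Prod.mk_add_mk]; congr 1 <;> module] at h2
  simp only [smul_eq_mul] at h2
  -- lower bound of the part coming from `F`
  have hFb := (abs_le.1 (abs_sub_sub_le_of_lipschitz_fderiv (fun y => (hF y).hasFDerivAt)
    (fun y y' => hFlip.norm_sub_le y y') κ.2 (stepMap P x) (θ • h))).1
  rw [map_smul, fderiv_stepMap_apply P hd hm hF hFinv, norm_smul, Real.norm_of_nonneg hθ.le,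
    smul_eq_mul] at hFb
  -- lower bound of the part coming from `L`
  have hLb : ∫ ω, L (stepMap P x ω, stepMap P v ω) ∂(cubeMeasure d)
      + θ * (inner ℝ (stepMap P fun k => gradFst L (x k, v k)) h
        + inner ℝ (stepMap P fun k => gradSnd L (x k, v k)) k)
      - κ * θ ^ 2 * (‖h‖ ^ 2 + ‖k‖ ^ 2)
      ≤ ∫ ω, L ((stepMap P x + θ • h : Hilb d) ω, (stepMap P v + θ • k : Hilb d) ω)
        ∂(cubeMeasure d) := by
    have i1 := (integrable_comp_of_lipschitz_fderiv hL hlip (stepMap P x) (stepMap P v)).1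
    have i2 : Integrable (fun ω => θ *
        (inner ℝ ((stepMap P fun k => gradFst L (x k, v k)) ω) (h ω)
          + inner ℝ ((stepMap P fun k => gradSnd L (x k, v k)) ω) (k ω))) (cubeMeasure d) :=
      ((L2.integrable_inner _ _).add (L2.integrable_inner _ _)).const_mul _
    have i3 : Integrable (fun ω => κ * θ ^ 2 * (‖h ω‖ ^ 2 + ‖k ω‖ ^ 2)) (cubeMeasure d) :=
      ((integrable_norm_sq h).add (integrable_norm_sq k)).const_mul _
    rw [L2.inner_def, L2.inner_def, ← integral_norm_sq h, ← integral_norm_sq k,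
      ← integral_add (L2.integrable_inner _ _) (L2.integrable_inner _ _),
      ← integral_add (integrable_norm_sq h) (integrable_norm_sq k), ← integral_const_mul,
      ← integral_const_mul, ← integral_add i1 i2, ← integral_sub (i1.fun_add i2) i3]
    refine integral_mono_ae ((i1.add i2).sub i3)
      (integrable_comp_of_lipschitz_fderiv hL hlip _ _).1 ?_
    filter_upwards [stepMap_ae P x, stepMap_ae P v, stepMap_ae P fun k => gradFst L (x k, v k),
      stepMap_ae P fun k => gradSnd L (x k, v k), P.ae_mem_iUnion_cell,
      Lp.coeFn_add (stepMap P x) (θ • h), Lp.coeFn_add (stepMap P v) (θ • k),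
      Lp.coeFn_smul θ h, Lp.coeFn_smul θ k] with ω e1 e2 e3 e4 e5 e6 e7 e8 e9
    obtain ⟨i, hi⟩ := mem_iUnion.1 e5
    rw [e6, e7, Pi.add_apply, Pi.add_apply, e8, e9, Pi.smul_apply, Pi.smul_apply, e1 i hi, e2 i hi,
      e3 i hi, e4 i hi]
    have h3 := (abs_le.1 (abs_sub_sub_le_of_lipschitz_fderiv (fun y => (hL y).hasFDerivAt)
      (fun y y' => hlip.norm_sub_le y y') κ.2 (x i, v i) (θ • (h ω, k ω)))).1
    rw [map_smul, fderiv_eq_inner_grad, norm_smul, Real.norm_of_nonneg hθ.le, smul_eq_mul,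
      Prod.smul_mk, Prod.mk_add_mk] at h3
    have h4 : κ * (θ * ‖(h ω, k ω)‖) ^ 2 ≤ κ * θ ^ 2 * (‖h ω‖ ^ 2 + ‖k ω‖ ^ 2) := by
      rw [mul_pow, ← mul_assoc]
      gcongr
      exact norm_prod_sq_le (h ω, k ω)
    change L (x i, v i) + θ * (inner ℝ (gradFst L (x i, v i)) (h ω)
      + inner ℝ (gradSnd L (x i, v i)) (k ω)) - κ * θ ^ 2 * (‖h ω‖ ^ 2 + ‖k ω‖ ^ 2) ≤ _
    linarith
  have hsplit : inner ℝ (stepMap P fun k => gradFst L (x k, v k)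
      + scaledGrad (discretize P F) x k) h
      = inner ℝ (stepMap P fun k => gradFst L (x k, v k)) h
        + inner ℝ (stepMap P (scaledGrad (discretize P F) x)) h := by
    rw [← inner_add_left, ← stepMap_add]; rfl
  rw [hsplit]
  refine le_of_mul_le_mul_left (a := θ) ?_ hθ
  simp only [liftedLagrangian] at h2 ⊢
  nlinarith

end Lifted

/-! ### Optimality of the Hamiltonian trajectories -/

/-- Integration by parts for a `C¹` function and the primitive of an integrable function. -/
theorem integral_deriv_mul_primitive {P P' δ : ℝ → ℝ} {t : ℝ}
    (hP : ∀ s, HasDerivAt P (P' s) s) (hP' : Continuous P')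
    (hδ : IntervalIntegrable δ volume 0 t) (c : ℝ) :
    ∫ s in (0 : ℝ)..t, (P' s * (c + ∫ τ in (0 : ℝ)..s, δ τ) + P s * δ s)
      = P t * (c + ∫ τ in (0 : ℝ)..t, δ τ) - P 0 * c := by
  have hPac : AbsolutelyContinuousOnInterval P 0 t := by
    have : ContDiff ℝ 1 P := by
      rw [contDiff_one_iff_deriv]
      refine ⟨fun s => (hP s).differentiableAt, ?_⟩
      rwa [show deriv P = P' from funext fun s => (hP s).deriv]
    exact this.contDiffOn.absolutelyContinuousOnInterval
  have hDac : AbsolutelyContinuousOnInterval (fun s => c + ∫ τ in (0 : ℝ)..s, δ τ) 0 t := by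
    have h1 := hδ.absolutelyContinuousOnInterval_intervalIntegral left_mem_uIcc
    have h2 : AbsolutelyContinuousOnInterval (fun _ : ℝ => c) 0 t :=
      (contDiff_const (n := 1)).contDiffOn.absolutelyContinuousOnInterval
    exact h2.add h1
  have h3 := hPac.integral_deriv_mul_eq_sub hDac
  simp only [intervalIntegral.integral_same, add_zero] at h3
  rw [← h3]
  refine intervalIntegral.integral_congr_ae ?_
  have h4 := hδ.ae_hasDerivAt_integral
  filter_upwards [h4] with s hs hs'
  rw [(hP s).deriv, ((hs (uIoc_subset_uIcc hs') 0 left_mem_uIcc).const_add c).deriv]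

section Extremal

variable {d m : ℕ}

/-- Positions `x`, velocities `v = x'`, momenta `p` and forces `r = p'` of `m` particles, where the
velocities and the momenta are related by Legendre duality on `[0, t]`. The curves are defined on
the whole real line for convenience. -/
structure IsArc (H L : Pt d × Pt d → ℝ) (t : ℝ) (x v p r : ℝ → Fin m → Pt d) : Prop where
  hasDerivAt_position : ∀ s, HasDerivAt x (v s) s
  hasDerivAt_momentum : ∀ s, HasDerivAt p (r s) s
  continuous_velocity : Continuous v
  continuous_force : Continuous r
  velocity_eq : ∀ s ∈ Icc 0 t, ∀ k, v s k = gradSnd H (x s k, p s k)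
  momentum_eq : ∀ s ∈ Icc 0 t, ∀ k, p s k = gradSnd L (x s k, v s k)

/-- A solution of the Hamiltonian system on `[0, t]` whose initial momentum is the gradient of the
initial cost. -/
structure IsExtremal (P : Equipartition d m) (H L : Pt d × Pt d → ℝ) (F U₀ : Hilb d → ℝ) (t : ℝ)
    (x v p r : ℝ → Fin m → Pt d) : Prop extends IsArc H L t x v p r where
  force_eq : ∀ s ∈ Icc 0 t, ∀ k,
    r s k = gradFst L (x s k, v s k) + scaledGrad (discretize P F) (x s) k
  initial_momentum : p 0 = scaledGrad (discretize P U₀) (x 0)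

variable {P : Equipartition d m} {H L : Pt d × Pt d → ℝ} {F U₀ : Hilb d → ℝ} {t : ℝ}
  {x v p r : ℝ → Fin m → Pt d}

theorem IsArc.continuous_position (h : IsArc H L t x v p r) : Continuous x :=
  continuous_iff_continuousAt.2 fun s => (h.hasDerivAt_position s).continuousAt

theorem IsArc.continuous_momentum (h : IsArc H L t x v p r) : Continuous p :=
  continuous_iff_continuousAt.2 fun s => (h.hasDerivAt_momentum s).continuousAt

theorem IsExtremal.mono (h : IsExtremal P H L F U₀ t x v p r) {t' : ℝ} (ht' : t' ≤ t) :
    IsExtremal P H L F U₀ t' x v p r :=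
  ⟨⟨h.hasDerivAt_position, h.hasDerivAt_momentum, h.continuous_velocity, h.continuous_force,
    fun s hs => h.velocity_eq s ⟨hs.1, hs.2.trans ht'⟩,
    fun s hs => h.momentum_eq s ⟨hs.1, hs.2.trans ht'⟩⟩,
    fun s hs => h.force_eq s ⟨hs.1, hs.2.trans ht'⟩, h.initial_momentum⟩

theorem eq_sum_basisVec (q : Fin m → Pt d) : q = ∑ k, ∑ a, q k a • basisVec k a := by
  funext k
  ext a
  simp only [basisVec, Finset.sum_apply, Pi.smul_apply, WithLp.ofLp_sum, WithLp.ofLp_smul,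
    smul_eq_mul]
  rw [Finset.sum_eq_single k, Finset.sum_eq_single a]
  · simp
  · intro b _ hb; simp [hb.symm]
  · simp
  · intro j _ hj; simp [hj.symm]
  · simp

theorem stepMap_eq_sum_basisVec (P : Equipartition d m) (q : Fin m → Pt d) :
    stepMap P q = ∑ k, ∑ a, q k a • stepMap P (basisVec k a) := by
  conv_lhs => rw [eq_sum_basisVec q, ← stepCLM_apply, map_sum]
  simp only [map_sum, map_smul, stepCLM_apply]

theorem HasDerivAt.coord {x v : ℝ → Fin m → Pt d} {s : ℝ} (h : HasDerivAt x (v s) s) (k : Fin m)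
    (a : Fin d) : HasDerivAt (fun s => x s k a) (v s k a) s :=
  ((EuclideanSpace.proj (𝕜 := ℝ) a).hasFDerivAt).comp_hasDerivAt s
    ((hasDerivAt_pi.1 h) k)

theorem IsAC2Curve.intervalIntegrable {S w : ℝ → Hilb d} (ht : 0 ≤ t) (h : IsAC2Curve t S w) :
    IntervalIntegrable w volume 0 t := by
  rw [intervalIntegrable_iff_integrableOn_Ioc_of_le ht]
  exact h.1.integrable (by norm_num)

theorem IsAC2Curve.continuousOn {S w : ℝ → Hilb d} (ht : 0 ≤ t) (h : IsAC2Curve t S w) :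
    ContinuousOn S (Icc 0 t) := by
  have h1 : ContinuousOn (fun s => S 0 + ∫ τ in (0 : ℝ)..s, w τ) (uIcc 0 t) :=
    continuousOn_const.add (intervalIntegral.continuousOn_primitive_interval'
      (h.intervalIntegrable ht) left_mem_uIcc)
  rw [uIcc_of_le ht] at h1
  exact h1.congr h.2

theorem isAC2Curve_stepMap (hx : ∀ s, HasDerivAt x (v s) s) (hv : Continuous v) :
    IsAC2Curve t (fun s => stepMap P (x s)) (fun s => stepMap P (v s)) := by
  have hc : Continuous fun s => stepMap P (v s) := (stepCLM P).continuous.comp hv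
  constructor
  · obtain ⟨C, hC⟩ := (isCompact_Icc (a := (0 : ℝ)) (b := t)).exists_bound_of_continuousOn
      hc.continuousOn
    refine MemLp.of_bound hc.aestronglyMeasurable C ?_
    refine (ae_restrict_mem measurableSet_Ioc).mono fun s hs => hC s (Ioc_subset_Icc_self hs)
  · intro s _
    have h1 : ∫ τ in (0 : ℝ)..s, stepMap P (v τ) = stepMap P (x s) - stepMap P (x 0) :=
      intervalIntegral.integral_eq_sub_of_hasDerivAt (f := fun s => stepMap P (x s))
        (fun τ _ => (stepCLM P).hasFDerivAt.comp_hasDerivAt τ (hx τ))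
        (hc.intervalIntegrable _ _)
    simp only [h1, add_sub_cancel]

theorem intervalIntegrable_fun_sum {ι : Type*} (s : Finset ι) {f : ι → ℝ → ℝ} {a b : ℝ}
    (h : ∀ i ∈ s, IntervalIntegrable (f i) volume a b) :
    IntervalIntegrable (fun τ => ∑ i ∈ s, f i τ) volume a b := by
  convert! IntervalIntegrable.sum s h using 1
  ext τ
  simp

variable [IsProbabilityMeasure (cubeMeasure d)]

theorem intervalIntegrable_liftedLagrangian (hL : Differentiable ℝ L)
    {κ : ℝ≥0} (hlip : LipschitzWith κ (fderiv ℝ L)) (hF : Differentiable ℝ F)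
    (hFlip : LipschitzWith κ (fderiv ℝ F))
    (hconv : ConvexOn ℝ univ fun z : Hilb d × Hilb d => liftedLagrangian L F z.1 z.2)
    (ht : 0 ≤ t) {S w : ℝ → Hilb d} (h : IsAC2Curve t S w) :
    IntervalIntegrable (fun s => liftedLagrangian L F (S s) (w s)) volume 0 t := by
  rw [intervalIntegrable_iff_integrableOn_Ioc_of_le ht]
  obtain ⟨C, hC, hb⟩ := exists_abs_liftedLagrangian_le hL hlip hF hFlip
  obtain ⟨B, hB⟩ := isCompact_Icc.exists_bound_of_continuousOn (h.continuousOn ht)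
  have hw2 : Integrable (fun s => ‖w s‖ ^ 2) (volume.restrict (Ioc 0 t)) :=
    (memLp_two_iff_integrable_sq_norm h.1.1).1 h.1
  have hint : Integrable (fun s => C * (1 + B ^ 2 + ‖w s‖ ^ 2)) (volume.restrict (Ioc 0 t)) :=
    ((integrable_const _).add hw2).const_mul _
  have hSm : AEStronglyMeasurable S (volume.restrict (Ioc 0 t)) :=
    ((h.continuousOn ht).mono Ioc_subset_Icc_self).aestronglyMeasurable measurableSet_Ioc
  refine hint.mono' ((continuous_liftedLagrangian hL hlip hF hFlip hconv).comp_aestronglyMeasurable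
    (hSm.prodMk h.1.1)) ?_
  refine (ae_restrict_mem measurableSet_Ioc).mono fun s hs => (hb _ _).trans ?_
  gcongr
  exact hB s (Ioc_subset_Icc_self hs)

/-- An extremal minimizes the action among all curves in `ℍ` with the same end point, and its
final momentum is a subgradient. Integrate the tangent plane inequality along the extremal and
integrate by parts. -/
theorem IsExtremal.action_le (hd : 1 ≤ d) (hm : m ≠ 0) (h : IsExtremal P H L F U₀ t x v p r)
    (hL : Differentiable ℝ L) {κ : ℝ≥0} (hlip : LipschitzWith κ (fderiv ℝ L))
    (hF : Differentiable ℝ F) (hFlip : LipschitzWith κ (fderiv ℝ F))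
    (hFinv : RearrangementInvariant F) (hU : Differentiable ℝ U₀)
    (hUlip : LipschitzWith κ (fderiv ℝ U₀)) (hUinv : RearrangementInvariant U₀)
    (hconv : ConvexOn ℝ univ fun z : Hilb d × Hilb d => liftedLagrangian L F z.1 z.2)
    (hUconv : ConvexOn ℝ univ U₀) (ht : 0 ≤ t) {S w : ℝ → Hilb d} (hS : IsAC2Curve t S w) :
    action L F t (fun s => stepMap P (x s)) (fun s => stepMap P (v s)) + U₀ (stepMap P (x 0))
      + inner ℝ (stepMap P (p t)) (S t - stepMap P (x t)) ≤ action L F t S w + U₀ (S 0) := by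
  have hX := isAC2Curve_stepMap (P := P) (t := t) h.hasDerivAt_position h.continuous_velocity
  set δ : ℝ → Hilb d := fun s => w s - stepMap P (v s) with hδ
  have hδi : IntervalIntegrable δ volume 0 t :=
    (hS.intervalIntegrable ht).sub (hX.intervalIntegrable ht)
  set D0 : Hilb d := S 0 - stepMap P (x 0) with hD0
  set b : Fin m → Fin d → Hilb d := fun k a => stepMap P (basisVec k a) with hb
  have hD : ∀ s ∈ Icc 0 t, ∀ k a, inner ℝ (b k a) (S s - stepMap P (x s))
      = inner ℝ (b k a) D0 + ∫ τ in (0 : ℝ)..s, inner ℝ (b k a) (δ τ) := by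
    intro s hs k a
    have hsub : uIcc 0 s ⊆ uIcc 0 t := by
      rw [uIcc_of_le hs.1, uIcc_of_le ht]; exact Icc_subset_Icc_right hs.2
    have h1 := (innerSL ℝ (b k a)).intervalIntegral_comp_comm (hδi.mono_set hsub)
    simp only [innerSL_apply_apply] at h1
    rw [h1, ← inner_add_right, hδ, intervalIntegral.integral_sub
      ((hS.intervalIntegrable ht).mono_set hsub) ((hX.intervalIntegrable ht).mono_set hsub),
      hS.2 s hs, show stepMap P (x s) = _ from hX.2 s hs, hD0]
    congr 1
    abel
  have hδb : ∀ k a, IntervalIntegrable (fun s => inner ℝ (b k a) (δ s)) volume 0 t := by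
    intro k a
    rw [intervalIntegrable_iff_integrableOn_Ioc_of_le ht] at hδi ⊢
    exact hδi.const_inner (b k a)
  set g : ℝ → ℝ := fun s => ∑ k, ∑ a, (r s k a * (inner ℝ (b k a) D0
    + ∫ τ in (0 : ℝ)..s, inner ℝ (b k a) (δ τ)) + p s k a * inner ℝ (b k a) (δ s)) with hg
  have hpc : ∀ k a, Continuous fun s => p s k a := fun k a =>
    continuous_iff_continuousAt.2 fun s =>
      (HasDerivAt.coord (h.hasDerivAt_momentum s) k a).continuousAt
  have hrc : ∀ k a, Continuous fun s => r s k a := fun k a =>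
    (EuclideanSpace.proj (𝕜 := ℝ) a).continuous.comp
      ((continuous_apply k).comp h.continuous_force)
  have hgi : ∀ k a, IntervalIntegrable (fun s => r s k a * (inner ℝ (b k a) D0
      + ∫ τ in (0 : ℝ)..s, inner ℝ (b k a) (δ τ)) + p s k a * inner ℝ (b k a) (δ s))
      volume 0 t := by
    intro k a
    refine IntervalIntegrable.add (ContinuousOn.intervalIntegrable ?_)
      ((hδb k a).continuousOn_mul (hpc k a).continuousOn)
    refine (hrc k a).continuousOn.mul (continuousOn_const.add ?_)
    exact intervalIntegral.continuousOn_primitive_interval' (hδb k a) left_mem_uIcc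
  have hgint : ∫ s in (0 : ℝ)..t, g s = inner ℝ (stepMap P (p t)) (S t - stepMap P (x t))
      - inner ℝ (stepMap P (p 0)) D0 := by
    have e1 : ∀ q y, inner ℝ (stepMap P q) y = ∑ k, ∑ a, q k a * inner ℝ (b k a) y := by
      intro q y
      rw [stepMap_eq_sum_basisVec, sum_inner]
      refine Finset.sum_congr rfl fun k _ => ?_
      rw [sum_inner]
      refine Finset.sum_congr rfl fun a _ => ?_
      rw [inner_smul_left]; rfl
    rw [hg, intervalIntegral.integral_finsetSum, e1, e1, ← Finset.sum_sub_distrib]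
    · refine Finset.sum_congr rfl fun k _ => ?_
      rw [intervalIntegral.integral_finsetSum, ← Finset.sum_sub_distrib]
      · refine Finset.sum_congr rfl fun a _ => ?_
        rw [integral_deriv_mul_primitive
          (fun s => HasDerivAt.coord (h.hasDerivAt_momentum s) k a) (hrc k a) (hδb k a),
          hD t ⟨ht, le_rfl⟩]
      · intro a _; exact hgi k a
    · intro k _
      exact intervalIntegrable_fun_sum _ fun a _ => hgi k a
  have hgI : IntervalIntegrable g volume 0 t :=
    intervalIntegrable_fun_sum _ fun k _ => intervalIntegrable_fun_sum _ fun a _ => hgi k a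
  have hpt : ∀ s ∈ Icc 0 t, liftedLagrangian L F (stepMap P (x s)) (stepMap P (v s)) + g s
      ≤ liftedLagrangian L F (S s) (w s) := by
    intro s hs
    have h1 := liftedLagrangian_ge_tangent hd hm P hL hlip hF hFlip hFinv hconv (x s) (v s)
      (S s) (w s)
    have h2 : (fun k => gradFst L (x s k, v s k) + scaledGrad (discretize P F) (x s) k) = r s :=
      funext fun k => (h.force_eq s hs k).symm
    have h3 : (fun k => gradSnd L (x s k, v s k)) = p s :=
      funext fun k => (h.momentum_eq s hs k).symm
    rw [h2, h3, stepMap_eq_sum_basisVec P (r s), stepMap_eq_sum_basisVec P (p s)] at h1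
    simp only [sum_inner, inner_smul_left, RCLike.conj_to_real] at h1
    refine le_trans (le_of_eq ?_) h1
    congr 1
    rw [hg]
    simp only [Finset.sum_add_distrib]
    congr 1
    refine Finset.sum_congr rfl fun k _ => Finset.sum_congr rfl fun a _ => ?_
    rw [← hD s hs]
  have hact : action L F t (fun s => stepMap P (x s)) (fun s => stepMap P (v s))
      + ∫ s in (0 : ℝ)..t, g s ≤ action L F t S w := by
    have i1 := intervalIntegrable_liftedLagrangian hL hlip hF hFlip hconv ht hX
    rw [action, action, ← intervalIntegral.integral_add i1 hgI]
    exact intervalIntegral.integral_mono_on ht (i1.add hgI)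
      (intervalIntegrable_liftedLagrangian hL hlip hF hFlip hconv ht hS) hpt
  have hU0 := convexOn_add_fderiv_le (fun y => (hU y).hasFDerivAt)
    (fun y y' => hUlip.norm_sub_le y y') κ.2 hUconv (stepMap P (x 0)) D0
  rw [fderiv_stepMap_apply P hd hm hU hUinv, ← h.initial_momentum, hD0, add_sub_cancel] at hU0
  rw [hgint] at hact
  linarith

/-- An extremal realizes the infimum that defines the value function at its endpoint, among all
admissible curves in `ℍ` and not only among those of step maps. -/
theorem IsExtremal.isLeast (hd : 1 ≤ d) (hm : m ≠ 0) (h : IsExtremal P H L F U₀ t x v p r)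
    (hL : Differentiable ℝ L) {κ : ℝ≥0} (hlip : LipschitzWith κ (fderiv ℝ L))
    (hF : Differentiable ℝ F) (hFlip : LipschitzWith κ (fderiv ℝ F))
    (hFinv : RearrangementInvariant F) (hU : Differentiable ℝ U₀)
    (hUlip : LipschitzWith κ (fderiv ℝ U₀)) (hUinv : RearrangementInvariant U₀)
    (hconv : ConvexOn ℝ univ fun z : Hilb d × Hilb d => liftedLagrangian L F z.1 z.2)
    (hUconv : ConvexOn ℝ univ U₀) (ht : 0 ≤ t) :
    valueFunction L F U₀ t (stepMap P (x t)) =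
      action L F t (fun s => stepMap P (x s)) (fun s => stepMap P (v s)) + U₀ (stepMap P (x 0)) := by
  refine IsLeast.csInf_eq ⟨⟨_, _, isAC2Curve_stepMap h.hasDerivAt_position h.continuous_velocity,
    rfl, rfl⟩, ?_⟩
  rintro _ ⟨S, w, hS, hSt, rfl⟩
  have := h.action_le hd hm hL hlip hF hFlip hFinv hU hUlip hUinv hconv hUconv ht hS
  rwa [hSt, sub_self, inner_zero_right, add_zero] at this

/-- The final momentum of an extremal is a subgradient of the value function on `𝕄^m`. -/
theorem IsExtremal.subgradient (hd : 1 ≤ d) (hm : m ≠ 0) (h : IsExtremal P H L F U₀ t x v p r)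
    (hL : Differentiable ℝ L) {κ : ℝ≥0} (hlip : LipschitzWith κ (fderiv ℝ L))
    (hF : Differentiable ℝ F) (hFlip : LipschitzWith κ (fderiv ℝ F))
    (hFinv : RearrangementInvariant F) (hU : Differentiable ℝ U₀)
    (hUlip : LipschitzWith κ (fderiv ℝ U₀)) (hUinv : RearrangementInvariant U₀)
    (hconv : ConvexOn ℝ univ fun z : Hilb d × Hilb d => liftedLagrangian L F z.1 z.2)
    (hUconv : ConvexOn ℝ univ U₀) (ht : 0 ≤ t) (q : Fin m → Pt d) :
    particleValue P L F U₀ t (x t) + (m : ℝ)⁻¹ * ∑ k, inner ℝ (p t k) (q k - x t k)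
      ≤ particleValue P L F U₀ t q := by
  refine le_csInf ?_ ?_
  · exact ⟨_, fun _ => stepMap P q, fun _ => 0, ⟨by simp, fun s _ => by simp⟩, rfl, rfl⟩
  · rintro _ ⟨S, w, hS, hSt, rfl⟩
    have h1 := h.action_le hd hm hL hlip hF hFlip hFinv hU hUlip hUinv hconv hUconv ht hS
    have h2 : inner ℝ (stepMap P (p t)) (S t - stepMap P (x t))
        = (m : ℝ)⁻¹ * ∑ k, inner ℝ (p t k) (q k - x t k) := by
      rw [hSt, ← stepMap_sub, inner_stepMap_stepMap]; rfl
    rw [h2] at h1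
    rw [particleValue, discretize,
      h.isLeast hd hm hL hlip hF hFlip hFinv hU hUlip hUinv hconv hUconv ht]
    exact h1

end Extremal

/-! ### Cocoercivity for finitely many particles -/

/-- Cocoercivity in coordinates, for the Euclidean inner product on a finite product. -/
theorem cocoercive_sum {ι V : Type*} [Fintype ι] [NormedAddCommGroup V] [InnerProductSpace ℝ V]
    {f : (ι → V) → ℝ} {f' : (ι → V) → (ι → V) →L[ℝ] ℝ} {g : (ι → V) → ι → V} {κ : ℝ} (hκ : 0 < κ)
    (hf : ∀ y, HasFDerivAt f (f' y) y) (hg : ∀ y h, f' y h = ∑ i, inner ℝ (g y i) (h i))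
    (hlip : ∀ y y', ∑ i, ‖g y i - g y' i‖ ^ 2 ≤ κ ^ 2 * ∑ i, ‖y i - y' i‖ ^ 2)
    (hconv : ConvexOn ℝ univ f) (y y' : ι → V) :
    (2 * κ)⁻¹ * ∑ i, ‖g y i - g y' i‖ ^ 2 ≤ ∑ i, inner ℝ (g y i - g y' i) (y i - y' i) := by
  set A := PiLp.continuousLinearEquiv 2 ℝ fun _ : ι => V with hA
  have h := cocoercive_gradient (Y := PiLp 2 fun _ : ι => V) (f := fun y => f (A y))
    (g := fun y => WithLp.toLp 2 (g (A y))) hκ ?_ ?_ ?_ (WithLp.toLp 2 y) (WithLp.toLp 2 y')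
  · rw [← WithLp.toLp_sub, ← WithLp.toLp_sub, PiLp.norm_sq_eq_of_L2, PiLp.inner_apply] at h
    exact h
  · intro y
    have h1 : innerSL ℝ (WithLp.toLp 2 (g (A y)))
        = (f' (A y)).comp (A : (PiLp 2 fun _ : ι => V) →L[ℝ] (ι → V)) := by
      refine ContinuousLinearMap.ext fun h => ?_
      rw [innerSL_apply_apply, ContinuousLinearMap.comp_apply, hg, PiLp.inner_apply]
      rfl
    rw [h1]
    exact (hf (A y)).comp y (A : (PiLp 2 fun _ : ι => V) →L[ℝ] (ι → V)).hasFDerivAt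
  · intro y y'
    refine (pow_le_pow_iff_left₀ (norm_nonneg _) (by positivity) two_ne_zero).1 ?_
    rw [mul_pow, ← WithLp.toLp_sub, PiLp.norm_sq_eq_of_L2, PiLp.norm_sq_eq_of_L2]
    exact hlip (A y) (A y')
  · exact hconv.comp_linearMap (A : (PiLp 2 fun _ : ι => V) →L[ℝ] (ι → V)).toLinearMap

section Particles

variable {d m : ℕ} (P : Equipartition d m)

theorem hasFDerivAt_discretize {G : Hilb d → ℝ} (hG : Differentiable ℝ G) (x : Fin m → Pt d) :
    HasFDerivAt (discretize P G) ((fderiv ℝ G (stepMap P x)).comp (stepCLM P)) x :=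
  (hG (stepMap P x)).hasFDerivAt.comp x (stepCLM P).hasFDerivAt

theorem fderiv_discretize_apply (hd : 1 ≤ d) (hm : m ≠ 0) {G : Hilb d → ℝ}
    (hG : Differentiable ℝ G) (hinv : RearrangementInvariant G) (x h : Fin m → Pt d) :
    fderiv ℝ (discretize P G) x h
      = (m : ℝ)⁻¹ * ∑ k, inner ℝ (scaledGrad (discretize P G) x k) (h k) := by
  rw [(hasFDerivAt_discretize P hG x).fderiv, ContinuousLinearMap.comp_apply, stepCLM_apply,
    fderiv_stepMap_apply P hd hm hG hinv, inner_stepMap_stepMap]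

/-- The scaled gradient is Lipschitz for the Euclidean norm, uniformly in the number of
particles. -/
theorem sum_norm_scaledGrad_sub_sq_le (hd : 1 ≤ d) (hm : m ≠ 0) {G : Hilb d → ℝ}
    (hG : Differentiable ℝ G) (hinv : RearrangementInvariant G) {κ : ℝ≥0}
    (hlip : LipschitzWith κ (fderiv ℝ G)) (x x' : Fin m → Pt d) :
    ∑ k, ‖scaledGrad (discretize P G) x k - scaledGrad (discretize P G) x' k‖ ^ 2
      ≤ κ ^ 2 * ∑ k, ‖x k - x' k‖ ^ 2 := by
  have hm' : (0 : ℝ) < (m : ℝ)⁻¹ := by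
    rw [inv_pos]; exact_mod_cast Nat.pos_of_ne_zero hm
  have h1 : ∀ x, fderiv ℝ G (stepMap P x)
      = innerSL ℝ (stepMap P (scaledGrad (discretize P G) x)) := fun x => by
    refine ContinuousLinearMap.ext fun h => ?_
    rw [innerSL_apply_apply, fderiv_stepMap_apply P hd hm hG hinv]
  have h2 := hlip.norm_sub_le (stepMap P x) (stepMap P x')
  rw [h1, h1, ← map_sub, innerSL_apply_norm, ← stepMap_sub, ← stepMap_sub] at h2
  have h3 := pow_le_pow_left₀ (norm_nonneg _) h2 2
  rw [mul_pow, norm_stepMap_sq, norm_stepMap_sq, mul_left_comm] at h3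
  exact le_of_mul_le_mul_left h3 hm'

theorem cocoercive_scaledGrad (hd : 1 ≤ d) (hm : m ≠ 0) {G : Hilb d → ℝ}
    (hG : Differentiable ℝ G) (hinv : RearrangementInvariant G) {κ : ℝ≥0} (hκ : 0 < κ)
    (hlip : LipschitzWith κ (fderiv ℝ G)) (hconv : ConvexOn ℝ univ G) (x x' : Fin m → Pt d) :
    (2 * (κ : ℝ))⁻¹ * ∑ k, ‖scaledGrad (discretize P G) x k - scaledGrad (discretize P G) x' k‖ ^ 2
      ≤ ∑ k, inner ℝ (scaledGrad (discretize P G) x k - scaledGrad (discretize P G) x' k)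
        (x k - x' k) := by
  have hm0 : (m : ℝ) ≠ 0 := by exact_mod_cast hm
  refine cocoercive_sum (f := fun y => (m : ℝ) * discretize P G y) (by exact_mod_cast hκ)
    (fun y => ((hasFDerivAt_discretize P hG y).differentiableAt.hasFDerivAt).const_mul (m : ℝ))
    (fun y h => ?_) (sum_norm_scaledGrad_sub_sq_le P hd hm hG hinv hlip) ?_ x x'
  · rw [smul_apply, fderiv_discretize_apply P hd hm hG hinv, smul_eq_mul,
      mul_inv_cancel_left₀ hm0]
  · exact (hconv.comp_linearMap (stepCLM P).toLinearMap).smul (Nat.cast_nonneg m)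

theorem norm_prod_sq_le' {X Y : Type*} [SeminormedAddCommGroup X] [SeminormedAddCommGroup Y]
    (x : X) (y : Y) : ‖(x, y)‖ ^ 2 ≤ ‖x‖ ^ 2 + ‖y‖ ^ 2 := norm_prod_sq_le (x, y)

/-- The gradient `(D_q L + m D F^{(m)}, D_v L)` of the particle Lagrangian is cocoercive, uniformly
in the number of particles. -/
theorem cocoercive_lagrangian (hd : 1 ≤ d) (hm : m ≠ 0) {L : Pt d × Pt d → ℝ}
    (hL : Differentiable ℝ L) {κ : ℝ≥0} (hκ : 0 < κ) (hlip : LipschitzWith κ (fderiv ℝ L))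
    {F : Hilb d → ℝ} (hF : Differentiable ℝ F) (hFlip : LipschitzWith κ (fderiv ℝ F))
    (hFinv : RearrangementInvariant F)
    (hconv : ConvexOn ℝ univ fun z : Hilb d × Hilb d => liftedLagrangian L F z.1 z.2)
    (x x' v v' : Fin m → Pt d) :
    (6 * (κ : ℝ))⁻¹ * (∑ k, ‖gradFst L (x k, v k) + scaledGrad (discretize P F) x k
        - (gradFst L (x' k, v' k) + scaledGrad (discretize P F) x' k)‖ ^ 2
      + ∑ k, ‖gradSnd L (x k, v k) - gradSnd L (x' k, v' k)‖ ^ 2)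
    ≤ ∑ k, inner ℝ (gradFst L (x k, v k) + scaledGrad (discretize P F) x k
        - (gradFst L (x' k, v' k) + scaledGrad (discretize P F) x' k)) (x k - x' k)
      + ∑ k, inner ℝ (gradSnd L (x k, v k) - gradSnd L (x' k, v' k)) (v k - v' k) := by
  have hm0 : (m : ℝ) ≠ 0 := by exact_mod_cast hm
  have hκ' : (0 : ℝ) < κ := by exact_mod_cast hκ
  let pos : (Fin m ⊕ Fin m → Pt d) →L[ℝ] (Fin m → Pt d) :=
    ContinuousLinearMap.pi fun k => ContinuousLinearMap.proj (Sum.inl k)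
  let vel : (Fin m ⊕ Fin m → Pt d) →L[ℝ] (Fin m → Pt d) :=
    ContinuousLinearMap.pi fun k => ContinuousLinearMap.proj (Sum.inr k)
  have hpos : ∀ y k, pos y k = y (Sum.inl k) := fun y k => rfl
  have hvel : ∀ y k, vel y k = y (Sum.inr k) := fun y k => rfl
  have h := cocoercive_sum (ι := Fin m ⊕ Fin m) (V := Pt d)
    (f := fun y => ∑ k, L (y (Sum.inl k), y (Sum.inr k)) + (m : ℝ) * discretize P F (pos y))
    (f' := fun y => ∑ k, (fderiv ℝ L (y (Sum.inl k), y (Sum.inr k))).comp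
        ((ContinuousLinearMap.proj (Sum.inl k)).prod (ContinuousLinearMap.proj (Sum.inr k)))
      + (m : ℝ) • (fderiv ℝ (discretize P F) (pos y)).comp pos)
    (g := fun y => Sum.elim
      (fun k => gradFst L (y (Sum.inl k), y (Sum.inr k)) + scaledGrad (discretize P F) (pos y) k)
      (fun k => gradSnd L (y (Sum.inl k), y (Sum.inr k)))) (κ := 3 * κ) (by positivity)
    ?_ ?_ ?_ ?_ (Sum.elim x v) (Sum.elim x' v')
  · simp only [Fintype.sum_sum_type, Sum.elim_inl, Sum.elim_inr] at h
    rw [← mul_assoc, show (2 : ℝ) * 3 = 6 by norm_num] at h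
    exact h
  · intro y
    refine (HasFDerivAt.fun_sum fun k _ => ?_).add ?_
    · exact (hL _).hasFDerivAt.comp y
        (((ContinuousLinearMap.proj (R := ℝ) (φ := fun _ : Fin m ⊕ Fin m => Pt d)
          (Sum.inl k)).prod (ContinuousLinearMap.proj (Sum.inr k))).hasFDerivAt (x := y))
    · exact ((hasFDerivAt_discretize P hF (pos y)).differentiableAt.hasFDerivAt.comp y
        pos.hasFDerivAt).const_mul (m : ℝ)
  · intro y h
    simp only [add_apply, sum_apply, ContinuousLinearMap.comp_apply,
      smul_apply, fderiv_discretize_apply P hd hm hF hFinv, Fintype.sum_sum_type, Sum.elim_inl,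
      Sum.elim_inr, smul_eq_mul, mul_inv_cancel_left₀ hm0, inner_add_left, Finset.sum_add_distrib,
      ContinuousLinearMap.prod_apply, ContinuousLinearMap.proj_apply, fderiv_eq_inner_grad, hpos]
    ring
  · intro y y'
    simp only [Fintype.sum_sum_type, Sum.elim_inl, Sum.elim_inr]
    have h1 := sum_norm_scaledGrad_sub_sq_le P hd hm hF hFinv hFlip (pos y) (pos y')
    simp only [hpos] at h1
    have h2 : ∀ k, ‖gradFst L (y (Sum.inl k), y (Sum.inr k)) + scaledGrad (discretize P F) (pos y) k
        - (gradFst L (y' (Sum.inl k), y' (Sum.inr k)) + scaledGrad (discretize P F) (pos y') k)‖ ^ 2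
        ≤ 2 * (κ ^ 2 * (‖y (Sum.inl k) - y' (Sum.inl k)‖ ^ 2
            + ‖y (Sum.inr k) - y' (Sum.inr k)‖ ^ 2))
          + 2 * ‖scaledGrad (discretize P F) (pos y) k
            - scaledGrad (discretize P F) (pos y') k‖ ^ 2 := by
      intro k
      rw [add_sub_add_comm]
      have e1 := norm_gradFst_sub_le hlip (y (Sum.inl k), y (Sum.inr k))
        (y' (Sum.inl k), y' (Sum.inr k))
      have e2 := pow_le_pow_left₀ (norm_nonneg _) e1 2
      rw [mul_pow, Prod.mk_sub_mk] at e2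
      have e3 := norm_prod_sq_le' (y (Sum.inl k) - y' (Sum.inl k))
        (y (Sum.inr k) - y' (Sum.inr k))
      have e4 := mul_le_mul_of_nonneg_left e3 (sq_nonneg (κ : ℝ))
      have e5 := pow_le_pow_left₀ (norm_nonneg _) (norm_add_le
        (gradFst L (y (Sum.inl k), y (Sum.inr k)) - gradFst L (y' (Sum.inl k), y' (Sum.inr k)))
        (scaledGrad (discretize P F) (pos y) k - scaledGrad (discretize P F) (pos y') k)) 2
      have e6 := add_sq_le (a := ‖gradFst L (y (Sum.inl k), y (Sum.inr k))
        - gradFst L (y' (Sum.inl k), y' (Sum.inr k))‖)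
        (b := ‖scaledGrad (discretize P F) (pos y) k - scaledGrad (discretize P F) (pos y') k‖)
      linarith
    have h3 : ∀ k, ‖gradSnd L (y (Sum.inl k), y (Sum.inr k))
        - gradSnd L (y' (Sum.inl k), y' (Sum.inr k))‖ ^ 2
        ≤ κ ^ 2 * (‖y (Sum.inl k) - y' (Sum.inl k)‖ ^ 2
            + ‖y (Sum.inr k) - y' (Sum.inr k)‖ ^ 2) := by
      intro k
      have e1 := norm_gradSnd_sub_le hlip (y (Sum.inl k), y (Sum.inr k))
        (y' (Sum.inl k), y' (Sum.inr k))
      have e2 := pow_le_pow_left₀ (norm_nonneg _) e1 2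
      rw [mul_pow, Prod.mk_sub_mk] at e2
      exact e2.trans (mul_le_mul_of_nonneg_left (norm_prod_sq_le' _ _) (sq_nonneg (κ : ℝ)))
    have h4 := Finset.sum_le_sum fun k (_ : k ∈ Finset.univ) => h2 k
    have h5 := Finset.sum_le_sum fun k (_ : k ∈ Finset.univ) => h3 k
    simp only [Finset.sum_add_distrib, ← Finset.mul_sum] at h4 h5
    have h6 : 0 ≤ (κ : ℝ) ^ 2 * ∑ k, ‖y (Sum.inl k) - y' (Sum.inl k)‖ ^ 2 := by positivity
    have h7 : 0 ≤ (κ : ℝ) ^ 2 * ∑ k, ‖y (Sum.inr k) - y' (Sum.inr k)‖ ^ 2 := by positivity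
    rw [mul_pow]
    linarith
  · have h1 : (fun y : Fin m ⊕ Fin m → Pt d =>
        ∑ k, L (y (Sum.inl k), y (Sum.inr k)) + (m : ℝ) * discretize P F (pos y))
        = fun y => (m : ℝ) • liftedLagrangian L F (stepMap P (pos y)) (stepMap P (vel y)) := by
      funext y
      rw [liftedLagrangian_stepMap, smul_eq_mul, mul_add, mul_inv_cancel_left₀ hm0]
      rfl
    rw [h1]
    exact (hconv.comp_linearMap
      (((stepCLM P).comp pos).prod ((stepCLM P).comp vel)).toLinearMap).smul (Nat.cast_nonneg m)

end Particles

/-! ### Stability of the extremals -/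

section Stability

variable {d m : ℕ}

/-- Restriction of a configuration to the particles in `S`, the others being put at the origin,
as an element of the Euclidean product. -/
noncomputable def restrictTo (S : Finset (Fin m)) :
    (Fin m → Pt d) →L[ℝ] PiLp 2 fun _ : Fin m => Pt d :=
  ((PiLp.continuousLinearEquiv 2 ℝ fun _ : Fin m => Pt d).symm :
    (Fin m → Pt d) →L[ℝ] PiLp 2 fun _ : Fin m => Pt d).comp
  (ContinuousLinearMap.pi fun k =>
    if k ∈ S then ContinuousLinearMap.proj (R := ℝ) (φ := fun _ : Fin m => Pt d) k else 0)

theorem restrictTo_apply (S : Finset (Fin m)) (y : Fin m → Pt d) (k : Fin m) :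
    restrictTo S y k = if k ∈ S then y k else 0 := by
  by_cases hk : k ∈ S <;> simp [restrictTo, hk]

theorem norm_restrictTo_sq (S : Finset (Fin m)) (y : Fin m → Pt d) :
    ‖restrictTo S y‖ ^ 2 = ∑ k ∈ S, ‖y k‖ ^ 2 := by
  rw [PiLp.norm_sq_eq_of_L2, ← Finset.sum_filter_add_sum_filter_not _ (fun k => k ∈ S)]
  rw [Finset.sum_eq_zero (s := Finset.univ.filter fun k => ¬ k ∈ S), add_zero]
  · refine Finset.sum_congr (by simp) fun k hk => ?_
    rw [restrictTo_apply, if_pos hk]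
  · intro k hk
    rw [restrictTo_apply, if_neg (Finset.mem_filter.1 hk).2]; simp

theorem inner_restrictTo (S : Finset (Fin m)) (y z : Fin m → Pt d) :
    inner ℝ (restrictTo S y) (restrictTo S z) = ∑ k ∈ S, inner ℝ (y k) (z k) := by
  rw [PiLp.inner_apply, ← Finset.sum_filter_add_sum_filter_not _ (fun k => k ∈ S)]
  rw [Finset.sum_eq_zero (s := Finset.univ.filter fun k => ¬ k ∈ S), add_zero]
  · refine Finset.sum_congr (by simp) fun k hk => ?_
    rw [restrictTo_apply, restrictTo_apply, if_pos hk, if_pos hk]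
  · intro k hk
    rw [restrictTo_apply, if_neg (Finset.mem_filter.1 hk).2]; simp

theorem norm_restrictTo_le {S : Finset (Fin m)} {y : Fin m → Pt d} {c : ℝ} (hc : 0 ≤ c)
    (h : ∑ k ∈ S, ‖y k‖ ^ 2 ≤ c ^ 2) : ‖restrictTo S y‖ ≤ c := by
  rw [← norm_restrictTo_sq] at h
  exact (pow_le_pow_iff_left₀ (norm_nonneg _) hc two_ne_zero).1 h

theorem norm_le_norm_restrictTo {S : Finset (Fin m)} (y : Fin m → Pt d) {k : Fin m} (hk : k ∈ S) :
    ‖y k‖ ≤ ‖restrictTo S y‖ := by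
  refine (pow_le_pow_iff_left₀ (norm_nonneg _) (norm_nonneg _) two_ne_zero).1 ?_
  rw [norm_restrictTo_sq]
  exact Finset.single_le_sum (f := fun k => ‖y k‖ ^ 2) (fun _ _ => by positivity) hk

/-- The configuration that agrees with `x` on `S` and with `x'` elsewhere. -/
def mixed (S : Finset (Fin m)) (x x' : Fin m → Pt d) : Fin m → Pt d :=
  fun k => if k ∈ S then x k else x' k

theorem continuous_mixed (S : Finset (Fin m)) {x x' : ℝ → Fin m → Pt d} (hx : Continuous x)
    (hx' : Continuous x') : Continuous fun s => mixed S (x s) (x' s) := by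
  refine continuous_pi fun k => ?_
  by_cases hk : k ∈ S
  · simp only [mixed, if_pos hk]
    exact (continuous_apply k).comp hx
  · simp only [mixed, if_neg hk]
    exact (continuous_apply k).comp hx'

theorem continuous_scaledGrad (P : Equipartition d m) {G : Hilb d → ℝ} (hG : Differentiable ℝ G)
    (hG' : Continuous (fderiv ℝ G)) : Continuous (scaledGrad (discretize P G)) := by
  have h1 : Continuous fun x : Fin m → Pt d => fderiv ℝ (discretize P G) x := by
    have : (fun x : Fin m → Pt d => fderiv ℝ (discretize P G) x)
        = fun x => (fderiv ℝ G (stepMap P x)).comp (stepCLM P) :=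
      funext fun x => (hasFDerivAt_discretize P hG x).fderiv
    rw [this]
    exact (hG'.comp (stepCLM P).continuous).clm_comp continuous_const
  refine continuous_pi fun k => ?_
  have h2 : Continuous fun x => partialGrad (discretize P G) x k :=
    (InnerProductSpace.toDual ℝ (Pt d)).symm.continuous.comp (h1.clm_comp continuous_const)
  exact h2.const_smul (m : ℝ)

/-- Stability of arcs, uniform in the number of particles, for the particles of a set `S`. The
source terms are the failures of the difference of the two arcs, restricted to `S`, to solve the
system in which the particles outside of `S` follow the second arc. -/
theorem exists_arc_stability_const (hd : 1 ≤ d) {H L : Pt d × Pt d → ℝ} {F U₀ : Hilb d → ℝ}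
    {κ : ℝ≥0} (hκ : 0 < κ) (hHlip : LipschitzWith κ (fderiv ℝ H)) (hL : Differentiable ℝ L)
    (hlip : LipschitzWith κ (fderiv ℝ L))
    (hF : Differentiable ℝ F) (hFlip : LipschitzWith κ (fderiv ℝ F))
    (hFinv : RearrangementInvariant F) (hU : Differentiable ℝ U₀)
    (hUlip : LipschitzWith κ (fderiv ℝ U₀)) (hUinv : RearrangementInvariant U₀)
    (hconv : ConvexOn ℝ univ fun z : Hilb d × Hilb d => liftedLagrangian L F z.1 z.2)
    (hUconv : ConvexOn ℝ univ U₀) {T : ℝ} (hT : 0 ≤ T) :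
    ∃ C : ℝ, 0 < C ∧ ∀ (m : ℕ) (_ : m ≠ 0) (P : Equipartition d m) (S : Finset (Fin m)) (t φ : ℝ)
      (x v p r x' v' p' r' : ℝ → Fin m → Pt d), t ∈ Icc 0 T → IsArc H L t x v p r →
      IsArc H L t x' v' p' r' → 0 ≤ φ →
      (∀ s ∈ Icc 0 t, ∑ k ∈ S, ‖r s k - r' s k
        - (gradFst L (x s k, v s k) + scaledGrad (discretize P F) (mixed S (x s) (x' s)) k
          - (gradFst L (x' s k, v' s k) + scaledGrad (discretize P F) (x' s) k))‖ ^ 2 ≤ φ ^ 2) →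
      (∑ k ∈ S, ‖p 0 k - p' 0 k
        - (scaledGrad (discretize P U₀) (mixed S (x 0) (x' 0)) k
          - scaledGrad (discretize P U₀) (x' 0) k)‖ ^ 2 ≤ φ ^ 2) →
      ∀ s ∈ Icc 0 t, ‖restrictTo S (x s - x' s)‖ ≤ C * (‖restrictTo S (x t - x' t)‖ + φ) ∧
        ‖restrictTo S (p s - p' s)‖ ≤ C * (‖restrictTo S (x t - x' t)‖ + φ) := by
  have hκ' : (0 : ℝ) < κ := by exact_mod_cast hκ
  obtain ⟨C, hC, hstab⟩ := exists_stability_const (c := (6 * (κ : ℝ))⁻¹) (K := κ) (T := T)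
    (by positivity) hκ'.le hT
  refine ⟨C, hC, ?_⟩
  intro m hm P S t φ x v p r x' v' p' r' ht h h' hφ hf hg
  have hxc := h.continuous_position
  have hxc' := h'.continuous_position
  have hmixc := continuous_mixed S hxc hxc'
  have hΓ := continuous_scaledGrad P hF hFlip.continuous
  have hLc : Continuous (gradFst L) :=
    (InnerProductSpace.toDual ℝ (Pt d)).symm.continuous.comp
      (hlip.continuous.clm_comp continuous_const)
  set f : ℝ → Fin m → Pt d := fun s k => r s k - r' s k
        - (gradFst L (x s k, v s k) + scaledGrad (discretize P F) (mixed S (x s) (x' s)) k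
          - (gradFst L (x' s k, v' s k) + scaledGrad (discretize P F) (x' s) k)) with hfdef
  set g : Fin m → Pt d := fun k => p 0 k - p' 0 k
        - (scaledGrad (discretize P U₀) (mixed S (x 0) (x' 0)) k
          - scaledGrad (discretize P U₀) (x' 0) k) with hgdef
  have hfc : Continuous f := by
    refine continuous_pi fun k => ?_
    have e : ∀ {z : ℝ → Fin m → Pt d}, Continuous z → Continuous fun s => z s k := fun hz =>
      (continuous_apply k).comp hz
    exact ((e h.continuous_force).sub (e h'.continuous_force)).sub
      (((hLc.comp ((e hxc).prodMk (e h.continuous_velocity))).add (e (hΓ.comp hmixc))).sub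
        ((hLc.comp ((e hxc').prodMk (e h'.continuous_velocity))).add (e (hΓ.comp hxc'))))
  refine hstab (PiLp 2 fun _ : Fin m => Pt d) t φ (fun s => restrictTo S (x s - x' s))
    (fun s => restrictTo S (v s - v' s)) (fun s => restrictTo S (p s - p' s))
    (fun s => restrictTo S (r s - r' s)) (fun s => restrictTo S (f s)) (restrictTo S g) ht
    ?_ ?_ ?_ ?_ ?_ ?_ ?_ ?_ ?_ ?_
  · exact fun s => (restrictTo S).hasFDerivAt.comp_hasDerivAt s
      ((h.hasDerivAt_position s).sub (h'.hasDerivAt_position s))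
  · exact fun s => (restrictTo S).hasFDerivAt.comp_hasDerivAt s
      ((h.hasDerivAt_momentum s).sub (h'.hasDerivAt_momentum s))
  · exact (restrictTo S).continuous.comp (h.continuous_velocity.sub h'.continuous_velocity)
  · exact (restrictTo S).continuous.comp (h.continuous_force.sub h'.continuous_force)
  · exact (restrictTo S).continuous.comp hfc
  · intro s hs
    have hcoc := cocoercive_lagrangian P hd hm hL hκ hlip hF hFlip hFinv hconv
      (mixed S (x s) (x' s)) (x' s) (mixed S (v s) (v' s)) (v' s)
    have e1 : ∀ k ∈ S, gradFst L (mixed S (x s) (x' s) k, mixed S (v s) (v' s) k)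
        + scaledGrad (discretize P F) (mixed S (x s) (x' s)) k
        - (gradFst L (x' s k, v' s k) + scaledGrad (discretize P F) (x' s) k)
        = (r s - r' s - f s) k := by
      intro k hk
      simp only [mixed, if_pos hk, hfdef, Pi.sub_apply]
      abel
    have e2 : ∀ k ∈ S, gradSnd L (mixed S (x s) (x' s) k, mixed S (v s) (v' s) k)
        - gradSnd L (x' s k, v' s k) = (p s - p' s) k := by
      intro k hk
      simp only [mixed, if_pos hk, Pi.sub_apply]
      rw [h.momentum_eq s hs, h'.momentum_eq s hs]
    have e3 : ∀ y y' : Fin m → Pt d, ∀ k ∈ S, mixed S y y' k - y' k = (y - y') k := by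
      intro y y' k hk; simp [mixed, hk]
    have e4 : ∀ y y' : Fin m → Pt d, ∀ k ∉ S, mixed S y y' k - y' k = 0 := by
      intro y y' k hk; simp [mixed, hk]
    rw [← map_sub, norm_restrictTo_sq, norm_restrictTo_sq, inner_restrictTo, inner_restrictTo]
    have hS : S ⊆ Finset.univ := Finset.subset_univ S
    rw [← Finset.sum_subset hS (f := fun k => inner ℝ (gradFst L (mixed S (x s) (x' s) k,
        mixed S (v s) (v' s) k) + scaledGrad (discretize P F) (mixed S (x s) (x' s)) k
        - (gradFst L (x' s k, v' s k) + scaledGrad (discretize P F) (x' s) k))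
        (mixed S (x s) (x' s) k - x' s k)) (fun k _ hk => by rw [e4 _ _ k hk, inner_zero_right]),
      ← Finset.sum_subset hS (f := fun k => inner ℝ (gradSnd L (mixed S (x s) (x' s) k,
        mixed S (v s) (v' s) k) - gradSnd L (x' s k, v' s k)) (mixed S (v s) (v' s) k - v' s k))
        (fun k _ hk => by rw [e4 _ _ k hk, inner_zero_right])] at hcoc
    refine le_trans (le_trans ?_ hcoc) (le_of_eq (congrArg₂ (· + ·)
      (Finset.sum_congr rfl fun k hk => by rw [e1 k hk, e3 _ _ k hk])
      (Finset.sum_congr rfl fun k hk => by rw [e2 k hk, e3 _ _ k hk])))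
    gcongr ?_ * ?_
    rw [add_comm]
    refine add_le_add ?_ ?_
    · rw [Finset.sum_congr rfl fun k hk => by rw [← e1 k hk]]
      exact Finset.sum_le_sum_of_subset_of_nonneg hS fun _ _ _ => by positivity
    · rw [Finset.sum_congr rfl fun k hk => by rw [← e2 k hk]]
      exact Finset.sum_le_sum_of_subset_of_nonneg hS fun _ _ _ => by positivity
  · have hcoc := cocoercive_scaledGrad P hd hm hU hUinv hκ hUlip hUconv
      (mixed S (x 0) (x' 0)) (x' 0)
    have e1 : ∀ k, scaledGrad (discretize P U₀) (mixed S (x 0) (x' 0)) k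
        - scaledGrad (discretize P U₀) (x' 0) k = (p 0 - p' 0 - g) k := by
      intro k
      simp only [hgdef, Pi.sub_apply]
      abel
    have hS : S ⊆ Finset.univ := Finset.subset_univ S
    simp only [e1] at hcoc
    rw [← map_sub, norm_restrictTo_sq, inner_restrictTo]
    rw [← Finset.sum_subset hS (f := fun k => inner ℝ ((p 0 - p' 0 - g) k)
        (mixed S (x 0) (x' 0) k - x' 0 k)) (fun k _ hk => by simp [mixed, hk])] at hcoc
    refine le_trans (le_trans ?_ hcoc) (le_of_eq (Finset.sum_congr rfl fun k hk => by
      rw [show mixed S (x 0) (x' 0) k - x' 0 k = (x 0 - x' 0) k by simp [mixed, hk]]))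
    gcongr ?_ * ?_
    · gcongr; norm_num
    · exact Finset.sum_le_sum_of_subset_of_nonneg hS fun _ _ _ => by positivity
  · intro s hs
    refine norm_restrictTo_le (by positivity) ?_
    have e1 : ∀ k ∈ S, ‖(v s - v' s) k‖ ^ 2
        ≤ κ ^ 2 * ‖(x s - x' s) k‖ ^ 2 + κ ^ 2 * ‖(p s - p' s) k‖ ^ 2 := by
      intro k _
      rw [Pi.sub_apply, h.velocity_eq s hs, h'.velocity_eq s hs]
      have e1 := norm_gradSnd_sub_le hHlip (x s k, p s k) (x' s k, p' s k)
      have e2 := pow_le_pow_left₀ (norm_nonneg _) e1 2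
      rw [mul_pow, Prod.mk_sub_mk] at e2
      rw [← mul_add]
      exact e2.trans (mul_le_mul_of_nonneg_left (norm_prod_sq_le' _ _) (sq_nonneg (κ : ℝ)))
    refine (Finset.sum_le_sum e1).trans ?_
    rw [Finset.sum_add_distrib, ← Finset.mul_sum, ← Finset.mul_sum, ← norm_restrictTo_sq,
      ← norm_restrictTo_sq, mul_pow, ← mul_add]
    gcongr
    nlinarith [norm_nonneg (restrictTo S (x s - x' s)), norm_nonneg (restrictTo S (p s - p' s)),
      mul_nonneg (norm_nonneg (restrictTo S (x s - x' s))) (norm_nonneg (restrictTo S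
          (p s - p' s)))]
  · exact fun s hs => norm_restrictTo_le hφ (hf s hs)
  · exact norm_restrictTo_le hφ hg

end Stability

/-! ### Localization of the extremals -/

section Localization

variable {d m : ℕ}

/-- The standing hypotheses on the Hamiltonian, the Lagrangian and the two functionals, in the form
in which they are used: the smoothness and the duality of `H` and `L`, the Lipschitz bounds of all
the gradients, and convexity. -/
structure IsRegular {d : ℕ} (κ : ℝ≥0) (H L : Pt d × Pt d → ℝ) (F U₀ : Hilb d → ℝ) : Prop where
  one_le : 1 ≤ d
  kappa_pos : 0 < κ
  contDiff_hamiltonian : ContDiff ℝ 3 H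
  contDiff_lagrangian : ContDiff ℝ 3 L
  dual : LegendreDual H L
  lipschitz_hamiltonian : LipschitzWith κ (fderiv ℝ H)
  lipschitz_lagrangian : LipschitzWith κ (fderiv ℝ L)
  differentiable_potential : Differentiable ℝ F
  lipschitz_potential : LipschitzWith κ (fderiv ℝ F)
  invariant_potential : RearrangementInvariant F
  differentiable_initial : Differentiable ℝ U₀
  lipschitz_initial : LipschitzWith κ (fderiv ℝ U₀)
  invariant_initial : RearrangementInvariant U₀
  convexOn_lagrangian : ConvexOn ℝ univ fun z : Hilb d × Hilb d => liftedLagrangian L F z.1 z.2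
  convexOn_initial : ConvexOn ℝ univ U₀

/-- A linear map on `𝕄^m` is controlled by its values on the basis vectors. -/
theorem norm_apply_le_of_basisVec {G : Type*} [NormedAddCommGroup G] [NormedSpace ℝ G]
    (ℓ : (Fin m → Pt d) →L[ℝ] G) {β : Fin m → ℝ} (h : ∀ k a, ‖ℓ (basisVec k a)‖ ≤ β k)
    (x : Fin m → Pt d) : ‖ℓ x‖ ≤ d * ∑ k, β k * ‖x k‖ := by
  conv_lhs => rw [eq_sum_basisVec x]
  simp only [map_sum, map_smul]
  have h1 : ∀ k, ‖∑ a, x k a • ℓ (basisVec k a)‖ ≤ d * (β k * ‖x k‖) := by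
    intro k
    refine (norm_sum_le _ _).trans ?_
    have h2 : ∀ a ∈ Finset.univ, ‖x k a • ℓ (basisVec k a)‖ ≤ β k * ‖x k‖ := by
      intro a _
      rw [norm_smul, mul_comm]
      have := PiLp.norm_apply_le (x k) a
      exact mul_le_mul (h k a) this (norm_nonneg _) ((norm_nonneg _).trans (h k a))
    refine (Finset.sum_le_sum h2).trans ?_
    simp
  refine (norm_sum_le _ _).trans ((Finset.sum_le_sum fun k _ => h1 k).trans ?_)
  rw [Finset.mul_sum]

theorem norm_fderiv_apply_sub_le {E G : Type*} [NormedAddCommGroup E] [NormedSpace ℝ E]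
    [NormedAddCommGroup G] [NormedSpace ℝ G] {f : E → G} (hf : ContDiff ℝ 2 f) {x y e : E} {B : ℝ}
    (hB : ∀ z ∈ segment ℝ y x, ‖(fderiv ℝ (fderiv ℝ f) z).flip e (x - y)‖ ≤ B) :
    ‖fderiv ℝ f x e - fderiv ℝ f y e‖ ≤ B := by
  have hD : ∀ z, HasFDerivAt (fderiv ℝ f) (fderiv ℝ (fderiv ℝ f) z) z := fun z =>
    ((hf.fderiv_right (m := 1) (by norm_num)).differentiable (by norm_num) z).hasFDerivAt
  have hline : ∀ s ∈ Icc (0 : ℝ) 1, HasDerivWithinAt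
      (fun s : ℝ => fderiv ℝ f (y + s • (x - y)) e)
      ((fderiv ℝ (fderiv ℝ f) (y + s • (x - y))).flip e (x - y)) (Icc 0 1) s := by
    intro s _
    have h1 : HasDerivAt (fun s : ℝ => y + s • (x - y)) (x - y) s := by
      simpa using ((hasDerivAt_id s).smul_const (x - y)).const_add y
    have h2 := (hD (y + s • (x - y))).comp_hasDerivAt s h1
    exact ((ContinuousLinearMap.apply ℝ G e).hasFDerivAt.comp_hasDerivAt s h2).hasDerivWithinAt
  have := norm_image_sub_le_of_norm_deriv_le_segment' hline (C := B)
    (fun s hs => hB _ (by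
      rw [segment_eq_image']
      exact ⟨s, ⟨hs.1, hs.2.le⟩, rfl⟩)) 1 (by simp)
  simpa using this

theorem mem_particleBall_iff (hm : m ≠ 0) {r : ℝ} (hr : 0 ≤ r) {q : Fin m → Pt d} :
    q ∈ particleBall d m r ↔ ‖restrictTo Finset.univ q‖ ≤ √m * r := by
  have hm' : (0 : ℝ) < m := by positivity
  rw [← pow_le_pow_iff_left₀ (norm_nonneg _) (by positivity) two_ne_zero, norm_restrictTo_sq,
    mul_pow, Real.sq_sqrt hm'.le]
  simp only [particleBall, mem_ofPred_eq]
  rw [inv_mul_le_iff₀ hm']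

theorem particleBall_mono {r r' : ℝ} (hr : 0 ≤ r) (h : r ≤ r') :
    particleBall d m r ⊆ particleBall d m r' := fun q hq => by
  simp only [particleBall, mem_ofPred_eq] at hq ⊢
  nlinarith

theorem convex_particleBall (hm : m ≠ 0) {r : ℝ} (hr : 0 ≤ r) :
    Convex ℝ (particleBall d m r) := by
  have h : particleBall d m r
      = (restrictTo (d := d) (m := m) Finset.univ) ⁻¹' Metric.closedBall 0 (√m * r) := by
    ext q
    rw [mem_particleBall_iff hm hr]
    simp
  rw [h]
  exact (convex_closedBall _ _).linear_preimage (restrictTo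
      (d := d) (m := m) Finset.univ).toLinearMap

theorem mixed_mem_particleBall {r : ℝ} {x x' : Fin m → Pt d} (S : Finset (Fin m))
    (hx : x ∈ particleBall d m r) (hx' : x' ∈ particleBall d m r) :
    mixed S x x' ∈ particleBall d m (2 * r) := by
  simp only [particleBall, mem_ofPred_eq] at hx hx' ⊢
  have h : ∑ j, ‖mixed S x x' j‖ ^ 2 ≤ ∑ j, ‖x j‖ ^ 2 + ∑ j, ‖x' j‖ ^ 2 := by
    rw [← Finset.sum_add_distrib]
    refine Finset.sum_le_sum fun j _ => ?_
    by_cases hj : j ∈ S <;> simp only [mixed, hj, if_true, if_false] <;>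
      nlinarith [sq_nonneg ‖x j‖, sq_nonneg ‖x' j‖]
  have h2 := mul_le_mul_of_nonneg_left h (inv_nonneg.2 (Nat.cast_nonneg (α := ℝ) m))
  rw [mul_add] at h2
  nlinarith [sq_nonneg r]

/-- Off the diagonal, the Hessian estimate says that the force on a particle depends on each of
the other particles by an amount of order `1/m`. -/
theorem HessianEstimate.norm_scaledGrad_sub_le (hm : m ≠ 0) {G : (Fin m → Pt d) → ℝ} {R C : ℝ}
    (hR : 0 ≤ R) (hC : 0 ≤ C) (hG : HessianEstimate G R C) {x y : Fin m → Pt d}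
        (hx : x ∈ particleBall d m R)
    (hy : y ∈ particleBall d m R) {k : Fin m} (hk : x k = y k) :
    ‖scaledGrad G x k - scaledGrad G y k‖ ≤ d ^ 2 * C / m * ∑ l, ‖x l - y l‖ := by
  have hm' : (0 : ℝ) < m := by positivity
  obtain ⟨w, hw⟩ : ∃ w, w = scaledGrad G x k - scaledGrad G y k := ⟨_, rfl⟩
  rw [← hw]
  have key : ∀ w', inner ℝ w w' = m * (fderiv ℝ G x (Pi.single k w')
      - fderiv ℝ G y (Pi.single k w')) := by
    intro w'
    simp only [hw, scaledGrad, inner_sub_left, real_inner_smul_left, inner_partialGrad]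
    ring
  have hw2 : ‖w‖ ^ 2 = m * (fderiv ℝ G x (Pi.single k w) - fderiv ℝ G y (Pi.single k w)) := by
    rw [← real_inner_self_eq_norm_sq, key]
  have hseg : ∀ z ∈ segment ℝ y x, ‖(fderiv ℝ (fderiv ℝ G) z).flip (Pi.single k w) (x - y)‖
      ≤ d ^ 2 * C / m ^ 2 * ‖w‖ * ∑ l, ‖x l - y l‖ := by
    intro z hz
    have hzb := (convex_particleBall hm hR).segment_subset hy hx hz
    have h1 : ∀ l a, ‖((fderiv ℝ (fderiv ℝ G) z).flip (Pi.single k w)) (basisVec l a)‖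
        ≤ if l = k then d * (C / m * ‖w‖) else d * (C / m ^ 2 * ‖w‖) := by
      intro l a
      rw [ContinuousLinearMap.flip_apply]
      have h2 := norm_apply_le_of_basisVec (fderiv ℝ (fderiv ℝ G) z (basisVec l a))
        (β := fun j => if l = j then C / m else C / m ^ 2) (fun j b => by
          have := hG.2 z hzb l j a b
          rw [iteratedFDeriv_two_apply] at this
          simpa using this) (Pi.single k w)
      refine h2.trans (le_of_eq ?_)
      rw [Finset.sum_eq_single k (fun j _ hj => by simp [hj]) (by simp)]
      split_ifs <;> simp
    have h3 := norm_apply_le_of_basisVec _ h1 (x - y)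
    refine h3.trans (le_of_eq ?_)
    rw [Finset.mul_sum, Finset.mul_sum]
    refine Finset.sum_congr rfl fun l _ => ?_
    by_cases hl : l = k
    · subst hl; simp [hk]
    · simp only [hl, if_false, Pi.sub_apply]; ring
  have hmv : ‖fderiv ℝ G x (Pi.single k w) - fderiv ℝ G y (Pi.single k w)‖
      ≤ d ^ 2 * C / m ^ 2 * ‖w‖ * ∑ l, ‖x l - y l‖ := by
    exact norm_fderiv_apply_sub_le hG.1 hseg
  rcases eq_or_ne ‖w‖ 0 with h0 | h0
  · have hs : (0 : ℝ) ≤ ∑ l, ‖x l - y l‖ := Finset.sum_nonneg fun _ _ => norm_nonneg _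
    rw [h0]
    exact mul_nonneg (div_nonneg (mul_nonneg (sq_nonneg _) hC) hm'.le) hs
  · have hpos : 0 < ‖w‖ := lt_of_le_of_ne (norm_nonneg _) (Ne.symm h0)
    have h1 : ‖w‖ ^ 2 ≤ m * (d ^ 2 * C / m ^ 2 * ‖w‖ * ∑ l, ‖x l - y l‖) := by
      rw [hw2]
      exact mul_le_mul_of_nonneg_left ((le_abs_self _).trans hmv) hm'.le
    have h2 : ‖w‖ * ‖w‖ ≤ (d ^ 2 * C / m * ∑ l, ‖x l - y l‖) * ‖w‖ := by
      calc _ = ‖w‖ ^ 2 := by ring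
        _ ≤ _ := h1
        _ = _ := by field_simp
    exact le_of_mul_le_mul_right h2 hpos

theorem sum_norm_scaledGrad_sq_le [IsProbabilityMeasure (cubeMeasure d)] (P : Equipartition d m)
    (hd : 1 ≤ d) (hm : m ≠ 0) {G : Hilb d → ℝ}
    (hG : Differentiable ℝ G) (hinv : RearrangementInvariant G) (x : Fin m → Pt d) :
    ∑ k, ‖scaledGrad (discretize P G) x k‖ ^ 2 ≤ m * ‖fderiv ℝ G (stepMap P x)‖ ^ 2 := by
  have hm' : (0 : ℝ) < m := by positivity
  set y := scaledGrad (discretize P G) x with hy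
  have h1 := fderiv_stepMap_apply P hd hm hG hinv x (stepMap P y)
  rw [real_inner_self_eq_norm_sq] at h1
  have h2 : ‖stepMap P y‖ ^ 2 ≤ ‖fderiv ℝ G (stepMap P x)‖ * ‖stepMap P y‖ := by
    rw [← h1]
    exact (le_abs_self _).trans ((fderiv ℝ G (stepMap P x)).le_opNorm _)
  have h3 : ‖stepMap P y‖ ≤ ‖fderiv ℝ G (stepMap P x)‖ := by
    nlinarith [norm_nonneg (stepMap P y), norm_nonneg (fderiv ℝ G (stepMap P x))]
  have h4 := pow_le_pow_left₀ (norm_nonneg _) h3 2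
  rw [norm_stepMap_sq] at h4
  rwa [inv_mul_le_iff₀ hm'] at h4

end Localization

section Localization

variable {d : ℕ} {κ : ℝ≥0} {H L : Pt d × Pt d → ℝ} {F U₀ : Hilb d → ℝ}

theorem IsRegular.differentiable_lagrangian (D : IsRegular κ H L F U₀) : Differentiable ℝ L :=
  D.contDiff_lagrangian.differentiable (by norm_num)

theorem IsRegular.differentiable_hamiltonian (D : IsRegular κ H L F U₀) : Differentiable ℝ H :=
  D.contDiff_hamiltonian.differentiable (by norm_num)

/-- The stability constant of `exists_arc_stability_const`, for the data at hand. -/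
theorem IsRegular.exists_arc_stability_const (D : IsRegular κ H L F U₀) {T : ℝ} (hT : 0 ≤ T) :
    ∃ C : ℝ, 0 < C ∧ ∀ (m : ℕ) (_ : m ≠ 0) (P : Equipartition d m) (S : Finset (Fin m)) (t φ : ℝ)
      (x v p r x' v' p' r' : ℝ → Fin m → Pt d), t ∈ Icc 0 T → IsArc H L t x v p r →
      IsArc H L t x' v' p' r' → 0 ≤ φ →
      (∀ s ∈ Icc 0 t, ∑ k ∈ S, ‖r s k - r' s k
        - (gradFst L (x s k, v s k) + scaledGrad (discretize P F) (mixed S (x s) (x' s)) k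
          - (gradFst L (x' s k, v' s k) + scaledGrad (discretize P F) (x' s) k))‖ ^ 2 ≤ φ ^ 2) →
      (∑ k ∈ S, ‖p 0 k - p' 0 k
        - (scaledGrad (discretize P U₀) (mixed S (x 0) (x' 0)) k
          - scaledGrad (discretize P U₀) (x' 0) k)‖ ^ 2 ≤ φ ^ 2) →
      ∀ s ∈ Icc 0 t, ‖restrictTo S (x s - x' s)‖ ≤ C * (‖restrictTo S (x t - x' t)‖ + φ) ∧
        ‖restrictTo S (p s - p' s)‖ ≤ C * (‖restrictTo S (x t - x' t)‖ + φ) :=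
  ParticleHJ.exists_arc_stability_const D.one_le D.kappa_pos D.lipschitz_hamiltonian
    D.differentiable_lagrangian D.lipschitz_lagrangian D.differentiable_potential
    D.lipschitz_potential D.invariant_potential D.differentiable_initial D.lipschitz_initial
    D.invariant_initial D.convexOn_lagrangian D.convexOn_initial hT

/-- Two extremals are controlled by the difference of their end points. For two extremals there
are two source terms: none from the Lagrangian, and from the functionals only the influence of the
particles outside of `S`. -/
theorem IsRegular.exists_extremal_stability_const (D : IsRegular κ H L F U₀) {T : ℝ} (hT : 0 ≤ T) :
    ∃ C : ℝ, 0 < C ∧ ∀ (m : ℕ) (_ : m ≠ 0) (P : Equipartition d m) (S : Finset (Fin m)) (t φ : ℝ)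
      (x v p r x' v' p' r' : ℝ → Fin m → Pt d), t ∈ Icc 0 T → IsExtremal P H L F U₀ t x v p r →
      IsExtremal P H L F U₀ t x' v' p' r' → 0 ≤ φ →
      (∀ s ∈ Icc 0 t, ∑ k ∈ S, ‖scaledGrad (discretize P F) (x s) k
        - scaledGrad (discretize P F) (mixed S (x s) (x' s)) k‖ ^ 2 ≤ φ ^ 2) →
      (∑ k ∈ S, ‖scaledGrad (discretize P U₀) (x 0) k
        - scaledGrad (discretize P U₀) (mixed S (x 0) (x' 0)) k‖ ^ 2 ≤ φ ^ 2) →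
      ∀ s ∈ Icc 0 t, ‖restrictTo S (x s - x' s)‖ ≤ C * (‖restrictTo S (x t - x' t)‖ + φ) ∧
        ‖restrictTo S (p s - p' s)‖ ≤ C * (‖restrictTo S (x t - x' t)‖ + φ) := by
  obtain ⟨C, hC, hst⟩ := D.exists_arc_stability_const hT
  refine ⟨C, hC, ?_⟩
  intro m hm P S t φ x v p r x' v' p' r' ht h h' hφ hf hg
  refine hst m hm P S t φ x v p r x' v' p' r' ht h.toIsArc h'.toIsArc hφ (fun s hs => ?_) ?_
  · refine le_trans (le_of_eq (Finset.sum_congr rfl fun k _ => ?_)) (hf s hs)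
    rw [h.force_eq s hs, h'.force_eq s hs]
    congr 2; abel
  · refine le_trans (le_of_eq (Finset.sum_congr rfl fun k _ => ?_)) hg
    rw [h.initial_momentum, h'.initial_momentum]
    congr 2; abel

theorem mixed_univ {m : ℕ} (x x' : Fin m → Pt d) : mixed Finset.univ x x' = x := by
  funext k; simp [mixed]

/-- Extremals depend in a Lipschitz way on their end point. -/
theorem IsRegular.exists_extremal_lipschitz_const (D : IsRegular κ H L F U₀) {T : ℝ} (hT : 0 ≤ T) :
    ∃ C : ℝ, 0 < C ∧ ∀ (m : ℕ) (_ : m ≠ 0) (P : Equipartition d m) (t : ℝ)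
      (x v p r x' v' p' r' : ℝ → Fin m → Pt d), t ∈ Icc 0 T → IsExtremal P H L F U₀ t x v p r →
      IsExtremal P H L F U₀ t x' v' p' r' →
      ∀ s ∈ Icc 0 t, ‖restrictTo Finset.univ (x s - x' s)‖ ≤
        C * ‖restrictTo Finset.univ (x t - x' t)‖ ∧
        ‖restrictTo Finset.univ (p s - p' s)‖ ≤ C * ‖restrictTo Finset.univ (x t - x' t)‖ := by
  obtain ⟨C, hC, hst⟩ := D.exists_extremal_stability_const hT
  refine ⟨C, hC, ?_⟩
  intro m hm P t x v p r x' v' p' r' ht h h' s hs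
  have := hst m hm P Finset.univ t 0 x v p r x' v' p' r' ht h h' le_rfl
    (fun s _ => by simp [mixed_univ]) (by simp [mixed_univ]) s hs
  simpa using this

/-- Extremals that end in a ball stay in a ball, uniformly in the number of particles: compare with
the arc that rests at the origin. -/
theorem IsRegular.exists_radius (D : IsRegular κ H L F U₀) {T : ℝ} (hT : 0 ≤ T) {r : ℝ}
    (hr : 0 ≤ r) :
    ∃ R : ℝ, 0 < R ∧ ∀ (m : ℕ) (_ : m ≠ 0) (P : Equipartition d m) (t : ℝ)
      (x v p f : ℝ → Fin m → Pt d), t ∈ Icc 0 T → IsExtremal P H L F U₀ t x v p f →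
      x t ∈ particleBall d m r →
      ∀ s ∈ Icc 0 t, x s ∈ particleBall d m R ∧ p s ∈ particleBall d m R := by
  obtain ⟨C, hC, hst⟩ := D.exists_arc_stability_const hT
  set c : Pt d := gradSnd L (0, 0) with hc
  set A : ℝ := 2 * (‖gradFst L (0, 0)‖ + ‖c‖ + ‖fderiv ℝ F 0‖ + ‖fderiv ℝ U₀ 0‖) with hA
  have hA0 : 0 ≤ A := by positivity
  refine ⟨C * (r + A) + ‖c‖ + 1, by positivity, ?_⟩
  intro m hm P t x v p f ht h hxt s hs
  have := P.isProbabilityMeasure hm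
  have hm' : (0 : ℝ) < m := by positivity
  have hrest : IsArc H L t (fun _ => (0 : Fin m → Pt d)) (fun _ => 0) (fun _ _ => c)
      (fun _ => 0) := by
    refine ⟨fun s => hasDerivAt_const _ _, fun s => hasDerivAt_const _ _, continuous_const,
      continuous_const, fun s _ k => ?_, fun s _ k => ?_⟩
    · exact ((D.dual.symm.grad_eq D.differentiable_lagrangian D.differentiable_hamiltonian
        D.lipschitz_lagrangian 0 0).1).symm
    · rfl
  have h0 : stepMap P (0 : Fin m → Pt d) = 0 := by rw [← stepCLM_apply, map_zero]
  have hF0 := sum_norm_scaledGrad_sq_le P D.one_le hm D.differentiable_potential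
    D.invariant_potential (0 : Fin m → Pt d)
  have hU0 := sum_norm_scaledGrad_sq_le P D.one_le hm D.differentiable_initial
    D.invariant_initial (0 : Fin m → Pt d)
  rw [h0] at hF0 hU0
  have hb : ∀ (a : Pt d) (g : Fin m → Pt d) (B : ℝ), ∑ k, ‖g k‖ ^ 2 ≤ m * B ^ 2 → 0 ≤ B →
      2 * (‖a‖ + B) ≤ A → ∑ k, ‖a + g k‖ ^ 2 ≤ (√m * A) ^ 2 := by
    intro a g B hB hB0 hBA
    have h1 : ∀ k ∈ Finset.univ, ‖a + g k‖ ^ 2 ≤ 2 * ‖a‖ ^ 2 + 2 * ‖g k‖ ^ 2 := by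
      intro k _
      have := norm_add_le a (g k)
      nlinarith [norm_nonneg (a + g k), sq_nonneg (‖a‖ - ‖g k‖)]
    refine (Finset.sum_le_sum h1).trans ?_
    rw [Finset.sum_add_distrib, ← Finset.mul_sum, ← Finset.mul_sum, mul_pow, Real.sq_sqrt hm'.le]
    simp only [Finset.sum_const, Finset.card_univ, Fintype.card_fin, nsmul_eq_mul]
    have h2 : (2 * (‖a‖ + B)) ^ 2 ≤ A ^ 2 := pow_le_pow_left₀ (by positivity) hBA 2
    have h3 := mul_le_mul_of_nonneg_left h2 hm'.le
    nlinarith [mul_nonneg hm'.le (mul_nonneg (norm_nonneg a) hB0), mul_nonneg hm'.le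
        (sq_nonneg ‖a‖),
      mul_nonneg hm'.le (sq_nonneg B)]
  have key := hst m hm P Finset.univ t (√m * A) x v p f (fun _ => 0) (fun _ => 0) (fun _ _ => c)
    (fun _ => 0) ht h.toIsArc hrest (by positivity) (fun s hs => by
      refine le_trans (le_of_eq (Finset.sum_congr rfl fun k _ => ?_))
        (hb (gradFst L (0, 0)) (scaledGrad (discretize P F) 0) ‖fderiv ℝ F 0‖ hF0 (norm_nonneg _)
          (by rw [hA]; nlinarith [norm_nonneg c, norm_nonneg (fderiv ℝ U₀ 0)]))
      rw [mixed_univ, h.force_eq s hs]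
      congr 2
      simp) (by
      refine le_trans (le_of_eq (Finset.sum_congr rfl fun k _ => ?_))
        (hb (-c) (scaledGrad (discretize P U₀) 0) ‖fderiv ℝ U₀ 0‖ hU0 (norm_nonneg _)
          (by rw [hA, norm_neg]; nlinarith [norm_nonneg (gradFst L (0, 0)),
            norm_nonneg (fderiv ℝ F 0)]))
      rw [mixed_univ, h.initial_momentum]
      congr 2
      abel) s hs
  have hxt' := (mem_particleBall_iff hm hr).1 hxt
  have hball : C * (‖restrictTo Finset.univ (x t - 0)‖ + √m * A) ≤ √m * (C * (r + A)) := by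
    rw [sub_zero]
    nlinarith
  refine ⟨(mem_particleBall_iff hm (by positivity)).2 ?_,
    (mem_particleBall_iff hm (by positivity)).2 ?_⟩
  · have h1 := key.1.trans hball
    rw [sub_zero] at h1
    refine h1.trans (mul_le_mul_of_nonneg_left ?_ (Real.sqrt_nonneg _))
    linarith [norm_nonneg c]
  · have h1 := key.2.trans hball
    have h2 : ‖restrictTo Finset.univ (fun _ : Fin m => c)‖ ≤ √m * ‖c‖ := by
      refine norm_restrictTo_le (by positivity) ?_
      rw [mul_pow, Real.sq_sqrt hm'.le]
      simp
    have h3 : restrictTo Finset.univ (p s)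
        = restrictTo Finset.univ (p s - fun _ => c) + restrictTo Finset.univ (fun _ : Fin m => c) := by
      rw [← map_add, sub_add_cancel]
    rw [h3]
    refine (norm_add_le _ _).trans ((add_le_add h1 h2).trans ?_)
    rw [← mul_add]
    refine mul_le_mul_of_nonneg_left ?_ (Real.sqrt_nonneg _)
    linarith

/-- The size, relative to the displacement of particle `i` at the final time, of the displacement
of particle `j`. -/
noncomputable def decay {m : ℕ} (i j : Fin m) : ℝ := if j = i then 1 else (m : ℝ)⁻¹

theorem decay_nonneg {m : ℕ} (i j : Fin m) : 0 ≤ decay i j := by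
  unfold decay; split_ifs <;> positivity

/-- If the end point of an extremal is changed in the particle `i` only, then every other particle
of the extremal moves by an amount of order `1/m`. This is proved in three steps: the stability
estimate for all particles; the estimate for all particles but `i`, which feel the particle `i`
through a force of order `1/m`; finally the estimate for a single particle `j`. -/
theorem IsRegular.exists_localization_const (D : IsRegular κ H L F U₀) {T : ℝ} (hT : 0 ≤ T)
    {A : ℝ → ℝ} (hA : ∀ r, 0 < r → 0 < A r) {r : ℝ} (hr : 0 ≤ r) :
    ∃ C : ℝ, 0 < C ∧ ∀ (m : ℕ) (_ : m ≠ 0) (P : Equipartition d m),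
      (∀ r, 0 < r → HessianEstimate (discretize P F) r (A r)) →
      (∀ r, 0 < r → HessianEstimate (discretize P U₀) r (A r)) →
      ∀ (t : ℝ) (x v p f x' v' p' f' : ℝ → Fin m → Pt d), t ∈ Icc 0 T →
      IsExtremal P H L F U₀ t x v p f → IsExtremal P H L F U₀ t x' v' p' f' →
      x t ∈ particleBall d m r → x' t ∈ particleBall d m r →
      ∀ (i : Fin m) (y : Pt d), x t - x' t = Pi.single i y → ∀ s ∈ Icc 0 t, ∀ j,
        ‖x s j - x' s j‖ ≤ C * decay i j * ‖y‖ ∧ ‖p s j - p' s j‖ ≤ C * decay i j * ‖y‖ := by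
  obtain ⟨C, hC, hst⟩ := D.exists_extremal_stability_const hT
  obtain ⟨R, hR, hrad⟩ := D.exists_radius hT hr
  set B : ℝ := d ^ 2 * A (2 * R) with hB
  have hA' : 0 < A (2 * R) := hA _ (by positivity)
  have hB0 : 0 ≤ B := by positivity
  set C₂ : ℝ := C * (B * C) with hC₂
  set C₃ : ℝ := C * (B * (C + C₂)) with hC₃
  have hC₂0 : 0 ≤ C₂ := by positivity
  have hC₃0 : 0 ≤ C₃ := by positivity
  refine ⟨C + C₃, by positivity, ?_⟩
  intro m hm P hFE hUE t x v p f x' v' p' f' ht h h' hxt hxt' i y hy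
  have hm' : (0 : ℝ) < m := by positivity
  have hx : ∀ s ∈ Icc 0 t, x s ∈ particleBall d m (2 * R) := fun s hs =>
    particleBall_mono hR.le (by linarith) (hrad m hm P t x v p f ht h hxt s hs).1
  have hmix : ∀ S, ∀ s ∈ Icc 0 t, mixed S (x s) (x' s) ∈ particleBall d m (2 * R) := fun S s hs =>
    mixed_mem_particleBall S (hrad m hm P t x v p f ht h hxt s hs).1
      (hrad m hm P t x' v' p' f' ht h' hxt' s hs).1
  have h0t : (0 : ℝ) ∈ Icc 0 t := ⟨le_rfl, ht.1⟩
  have hsrc : ∀ G, HessianEstimate (discretize P G) (2 * R) (A (2 * R)) → ∀ (S : Finset (Fin m)),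
      ∀ k ∈ S, ∀ s ∈ Icc 0 t, ‖scaledGrad (discretize P G) (x s) k
        - scaledGrad (discretize P G) (mixed S (x s) (x' s)) k‖
        ≤ B / m * ∑ l, if l ∈ S then 0 else ‖x s l - x' s l‖ := by
    intro G hG S k hk s hs
    have h1 := hG.norm_scaledGrad_sub_le hm (by positivity) hA'.le (hx s hs) (hmix S s hs) (k := k)
      (by simp [mixed, hk])
    refine h1.trans (le_of_eq ?_)
    congr 1
    refine Finset.sum_congr rfl fun l _ => ?_
    by_cases hl : l ∈ S <;> simp [mixed, hl]
  have hFE' := hFE (2 * R) (by positivity)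
  have hUE' := hUE (2 * R) (by positivity)
  -- all particles
  have step1 : ∀ s ∈ Icc 0 t, ∀ j, ‖x s j - x' s j‖ ≤ C * ‖y‖ ∧ ‖p s j - p' s j‖ ≤ C * ‖y‖ := by
    intro s hs j
    have h1 := hst m hm P Finset.univ t 0 x v p f x' v' p' f' ht h h' le_rfl
      (fun s _ => by simp [mixed_univ]) (by simp [mixed_univ]) s hs
    have h2 : ‖restrictTo Finset.univ (x t - x' t)‖ ≤ ‖y‖ := by
      refine norm_restrictTo_le (norm_nonneg _) (le_of_eq ?_)
      rw [hy, Finset.sum_eq_single i] <;> simp +contextual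
    rw [add_zero] at h1
    exact ⟨(norm_le_norm_restrictTo (x s - x' s) (Finset.mem_univ j)).trans (h1.1.trans
        (by gcongr)),
      (norm_le_norm_restrictTo (p s - p' s) (Finset.mem_univ j)).trans (h1.2.trans (by gcongr))⟩
  -- all particles but `i`
  have step2 : ∀ s ∈ Icc 0 t, ‖restrictTo (Finset.univ.erase i) (x s - x' s)‖
      ≤ C₂ * ‖y‖ / √m := by
    intro s hs
    have hs' : ∀ G, HessianEstimate (discretize P G) (2 * R) (A (2 * R)) → ∀ s ∈ Icc 0 t,
        ∑ k ∈ Finset.univ.erase i, ‖scaledGrad (discretize P G) (x s) k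
        - scaledGrad (discretize P G) (mixed (Finset.univ.erase i) (x s) (x' s)) k‖ ^ 2
        ≤ (B * C * ‖y‖ / √m) ^ 2 := by
      intro G hG s hs
      have h1 : ∀ k ∈ Finset.univ.erase i, ‖scaledGrad (discretize P G) (x s) k
          - scaledGrad (discretize P G) (mixed (Finset.univ.erase i) (x s) (x' s)) k‖ ^ 2
          ≤ (B / m * (C * ‖y‖)) ^ 2 := by
        intro k hk
        refine pow_le_pow_left₀ (norm_nonneg _) ((hsrc G hG _ k hk s hs).trans ?_) 2
        refine mul_le_mul_of_nonneg_left ?_ (by positivity)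
        rw [Finset.sum_eq_single i] <;> simp +contextual [(step1 s hs i).1]
      refine (Finset.sum_le_sum h1).trans ?_
      rw [div_pow, Real.sq_sqrt hm'.le, Finset.sum_const, nsmul_eq_mul]
      have h2 : ((Finset.univ.erase i).card : ℝ) ≤ m := by
        have := Finset.card_erase_le (s := Finset.univ) (a := i)
        rw [Finset.card_univ, Fintype.card_fin] at this
        exact_mod_cast this
      refine (mul_le_mul_of_nonneg_right h2 (by positivity)).trans (le_of_eq ?_)
      field_simp
    have h1 := (hst m hm P (Finset.univ.erase i) t (B * C * ‖y‖ / √m) x v p f x' v' p' f' ht h h'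
      (by positivity) (hs' F hFE') (hs' U₀ hUE' 0 h0t) s hs).1
    have h2 : restrictTo (Finset.univ.erase i) (x t - x' t) = 0 := by
      rw [← norm_le_zero_iff]
      refine norm_restrictTo_le le_rfl (le_of_eq ?_)
      rw [hy, Finset.sum_eq_zero]
      · simp
      · intro k hk
        rw [Pi.single_eq_of_ne (Finset.ne_of_mem_erase hk)]; simp
    rw [h2, norm_zero, zero_add] at h1
    refine h1.trans (le_of_eq ?_)
    rw [hC₂]; ring
  -- one particle
  intro s hs j
  by_cases hj : j = i
  · have h1 := step1 s hs j
    simp only [decay, hj, if_true, mul_one] at h1 ⊢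
    exact ⟨h1.1.trans (by gcongr; linarith), h1.2.trans (by gcongr; linarith)⟩
  have hsum : ∀ s ∈ Icc 0 t, ∑ l, (if l ∈ ({j} : Finset (Fin m)) then 0 else ‖x s l - x' s l‖)
      ≤ (C + C₂) * ‖y‖ := by
    intro s hs
    have h1 : ∑ l, (if l ∈ ({j} : Finset (Fin m)) then 0 else ‖x s l - x' s l‖)
        ≤ ∑ l, ‖x s l - x' s l‖ := by
      refine Finset.sum_le_sum fun l _ => ?_
      split_ifs
      · exact norm_nonneg _
      · exact le_rfl
    have h2 : ∑ l ∈ Finset.univ.erase i, ‖x s l - x' s l‖ ≤ C₂ * ‖y‖ := by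
      have h3 : (∑ l ∈ Finset.univ.erase i, ‖x s l - x' s l‖) ^ 2
          ≤ m * ∑ l ∈ Finset.univ.erase i, ‖x s l - x' s l‖ ^ 2 := by
        refine (sq_sum_le_card_mul_sum_sq).trans ?_
        refine mul_le_mul_of_nonneg_right ?_ (Finset.sum_nonneg fun _ _ => sq_nonneg _)
        have := Finset.card_erase_le (s := Finset.univ) (a := i)
        rw [Finset.card_univ, Fintype.card_fin] at this
        exact_mod_cast this
      have h4 := norm_restrictTo_sq (Finset.univ.erase i) (x s - x' s)
      simp only [Pi.sub_apply] at h4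
      rw [← h4] at h3
      have h5 := pow_le_pow_left₀ (norm_nonneg _) (step2 s hs) 2
      rw [div_pow, Real.sq_sqrt hm'.le, le_div_iff₀ hm'] at h5
      refine (pow_le_pow_iff_left₀ (Finset.sum_nonneg fun _ _ => norm_nonneg _) (by positivity)
        two_ne_zero).1 ?_
      linarith
    have h3 := (step1 s hs i).1
    refine h1.trans ?_
    rw [← Finset.add_sum_erase _ _ (Finset.mem_univ i)]
    linarith
  have hs' : ∀ G, HessianEstimate (discretize P G) (2 * R) (A (2 * R)) → ∀ s ∈ Icc 0 t,
      ∑ k ∈ ({j} : Finset (Fin m)), ‖scaledGrad (discretize P G) (x s) k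
      - scaledGrad (discretize P G) (mixed {j} (x s) (x' s)) k‖ ^ 2
      ≤ (B / m * ((C + C₂) * ‖y‖)) ^ 2 := by
    intro G hG s hs
    rw [Finset.sum_singleton]
    refine pow_le_pow_left₀ (norm_nonneg _) ((hsrc G hG _ j (by simp) s hs).trans ?_) 2
    exact mul_le_mul_of_nonneg_left (hsum s hs) (by positivity)
  have h1 := hst m hm P {j} t (B / m * ((C + C₂) * ‖y‖)) x v p f x' v' p' f' ht h h'
    (by positivity) (hs' F hFE') (hs' U₀ hUE' 0 h0t) s hs
  have h2 : restrictTo {j} (x t - x' t) = 0 := by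
    rw [← norm_le_zero_iff]
    refine norm_restrictTo_le le_rfl (le_of_eq ?_)
    rw [hy, Finset.sum_singleton, Pi.single_eq_of_ne hj]
    simp
  rw [h2, norm_zero, zero_add] at h1
  have h3 : C * (B / m * ((C + C₂) * ‖y‖)) ≤ (C + C₃) * decay i j * ‖y‖ := by
    have : C * (B / m * ((C + C₂) * ‖y‖)) = C₃ * (m : ℝ)⁻¹ * ‖y‖ := by
      rw [hC₃]; ring
    rw [this]
    simp only [decay, hj, if_false]
    gcongr
    linarith
  exact ⟨(norm_le_norm_restrictTo (x s - x' s) (Finset.mem_singleton_self j)).trans (h1.1.trans h3),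
    (norm_le_norm_restrictTo (p s - p' s) (Finset.mem_singleton_self j)).trans (h1.2.trans h3)⟩

end Localization

/-! ### The field of extremals -/

section GlobalInverse

open Filter Topology

variable {E : Type*} [NormedAddCommGroup E] [NormedSpace ℝ E]

theorem AntilipschitzWith.le_norm_fderiv {G : Type*} [NormedAddCommGroup G] [NormedSpace ℝ G]
    {f : E → G} {K : ℝ≥0} (hf : AntilipschitzWith K f) {x : E} (hd : DifferentiableAt ℝ f x)
    (v : E) : ‖v‖ ≤ K * ‖fderiv ℝ f x v‖ := by
  have h1 : HasDerivAt (fun h : ℝ => f (x + h • v)) (fderiv ℝ f x v) 0 := by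
    have h2 : HasDerivAt (fun h : ℝ => x + h • v) v 0 := by
      simpa using ((hasDerivAt_id (0 : ℝ)).smul_const v).const_add x
    have h3 : HasFDerivAt f (fderiv ℝ f x) (x + (0 : ℝ) • v) := by
      simpa using hd.hasFDerivAt
    exact h3.comp_hasDerivAt (0 : ℝ) h2
  have h2 := (hasDerivAt_iff_tendsto_slope_zero.1 h1).norm.const_mul (K : ℝ)
  refine ge_of_tendsto h2 ?_
  filter_upwards [self_mem_nhdsWithin] with h hh
  have hh0 : (0 : ℝ) < |h| := abs_pos.2 hh
  have h3 := hf.le_mul_dist (x + h • v) x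
  rw [dist_eq_norm, dist_eq_norm, add_sub_cancel_left, norm_smul, Real.norm_eq_abs] at h3
  rw [norm_smul, norm_inv, Real.norm_eq_abs, zero_add, zero_smul, add_zero]
  have h4 : (K : ℝ) * (|h|⁻¹ * ‖f (x + h • v) - f x‖) = |h|⁻¹ * (K * ‖f (x + h • v) - f x‖) := by
    ring
  rw [h4, le_inv_mul_iff₀ hh0]
  exact h3

/-- A smooth self-map of a finite dimensional space that expands distances, up to a factor, is a
global diffeomorphism: its range is open by the inverse function theorem and closed by
properness. -/
theorem exists_contDiff_inverse_of_antilipschitz [FiniteDimensional ℝ E] {f : E → E} {K : ℝ≥0}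
    {n : WithTop ℕ∞} (hn : n ≠ 0) (hf : ContDiff ℝ n f) (hK : AntilipschitzWith K f) :
    ∃ g : E → E, ContDiff ℝ n g ∧ (∀ y, f (g y) = y) ∧ ∀ x, g (f x) = x := by
  have hdiff : Differentiable ℝ f := hf.differentiable hn
  have hinj : ∀ x, Function.Injective (fderiv ℝ f x : E →ₗ[ℝ] E) := by
    intro x
    rw [← LinearMap.ker_eq_bot, LinearMap.ker_eq_bot']
    intro v hv
    have h1 := hK.le_norm_fderiv (hdiff x) v
    rw [show fderiv ℝ f x v = 0 from hv, norm_zero, mul_zero] at h1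
    exact norm_le_zero_iff.1 h1
  set f' : E → E ≃L[ℝ] E := fun x =>
    (LinearEquiv.ofInjectiveEndo _ (hinj x)).toContinuousLinearEquiv with hf'
  have hf'd : ∀ x, HasFDerivAt f (f' x : E →L[ℝ] E) x := by
    intro x
    have : (f' x : E →L[ℝ] E) = fderiv ℝ f x := by
      ext v; rfl
    rw [this]
    exact (hdiff x).hasFDerivAt
  have hstrict : ∀ x, HasStrictFDerivAt f (f' x : E →L[ℝ] E) x := fun x =>
    hf.contDiffAt.hasStrictFDerivAt' (hf'd x) hn
  have hopen : IsOpenMap f := isOpenMap_of_hasStrictFDerivAt_equiv hstrict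
  have hproper : IsProperMap f := by
    rw [isProperMap_iff_tendsto_cocompact]
    refine ⟨hf.continuous, ?_⟩
    rw [← Metric.cobounded_eq_cocompact]
    exact hK.tendsto_cobounded
  have hsurj : Function.Surjective f := by
    rw [← Set.range_eq_univ]
    exact IsClopen.eq_univ ⟨hproper.isClosedMap.isClosed_range, hopen.isOpen_range⟩
      ⟨f 0, mem_range_self 0⟩
  set e : E ≃ₜ E := (Equiv.ofBijective f ⟨hK.injective, hsurj⟩).toHomeomorphOfContinuousOpen
    hf.continuous hopen with he
  exact ⟨e.symm, e.contDiff_symm hf'd hf, fun y => e.apply_symm_apply y,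
    fun x => e.symm_apply_apply x⟩

end GlobalInverse

section Flow

variable {d m : ℕ}

/-- The vector field `(x, p) ↦ (D_p H, -D_q H + m D F)` of the Hamiltonian system on the phase space
of `m` particles. -/
noncomputable def hamiltonianField (H : Pt d × Pt d → ℝ) (G : (Fin m → Pt d) → ℝ)
    (w : (Fin m → Pt d) × (Fin m → Pt d)) : (Fin m → Pt d) × (Fin m → Pt d) :=
  (fun k => gradSnd H (w.1 k, w.2 k), fun k => -gradFst H (w.1 k, w.2 k) + scaledGrad G w.1 k)

theorem contDiff_scaledGrad {n : ℕ} {G : (Fin m → Pt d) → ℝ} (hG : ContDiff ℝ (n + 1) G) :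
    ContDiff ℝ n (scaledGrad G) := by
  refine contDiff_pi.2 fun k => ?_
  have h1 : ContDiff ℝ n (fderiv ℝ G) := hG.fderiv_right le_rfl
  have h2 : ContDiff ℝ n fun x => partialGrad G x k :=
    (InnerProductSpace.toDual ℝ (Pt d)).symm.contDiff.comp (h1.clm_comp contDiff_const)
  exact (contDiff_const (c := (m : ℝ))).smul h2

theorem contDiff_hamiltonianField {n : ℕ} {H : Pt d × Pt d → ℝ} {G : (Fin m → Pt d) → ℝ}
    (hH : ContDiff ℝ (n + 1) H) (hG : ContDiff ℝ (n + 1) G) :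
    ContDiff ℝ n (hamiltonianField H G) := by
  have h0 : ∀ k : Fin m, ContDiff ℝ n
      fun w : (Fin m → Pt d) × (Fin m → Pt d) => (w.1 k, w.2 k) := fun k =>
    ((contDiff_apply ℝ (Pt d) k).comp contDiff_fst).prodMk
      ((contDiff_apply ℝ (Pt d) k).comp contDiff_snd)
  refine ContDiff.prodMk (contDiff_pi.2 fun k => ?_) (contDiff_pi.2 fun k => ?_)
  · exact (contDiff_gradSnd hH).comp (h0 k)
  · exact ((contDiff_gradFst hH).comp (h0 k)).neg.add
      ((contDiff_pi.1 (contDiff_scaledGrad hG) k).comp contDiff_fst)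

variable {κ : ℝ≥0} {H L : Pt d × Pt d → ℝ} {F U₀ : Hilb d → ℝ}

theorem norm_restrictTo_univ_le (y : Fin m → Pt d) : ‖restrictTo Finset.univ y‖ ≤ √m * ‖y‖ := by
  refine norm_restrictTo_le (by positivity) ?_
  rw [mul_pow, Real.sq_sqrt (Nat.cast_nonneg m)]
  refine (Finset.sum_le_sum fun k _ => pow_le_pow_left₀ (norm_nonneg _)
      (norm_le_pi_norm y k) 2).trans ?_
  simp

theorem norm_le_norm_restrictTo_univ (y : Fin m → Pt d) : ‖y‖ ≤ ‖restrictTo Finset.univ y‖ :=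
  (pi_norm_le_iff_of_nonneg (norm_nonneg _)).2 fun _ =>
    norm_le_norm_restrictTo y (Finset.mem_univ _)

theorem IsRegular.exists_lipschitzWith_hamiltonianField (D : IsRegular κ H L F U₀) (hm : m ≠ 0)
    (P : Equipartition d m) :
    ∃ k : ℝ≥0, LipschitzWith k (hamiltonianField H (discretize P F)) := by
  have := P.isProbabilityMeasure hm
  refine ⟨κ + κ * Real.toNNReal (√m), LipschitzWith.of_dist_le_mul fun w w' => ?_⟩
  rw [dist_eq_norm, dist_eq_norm]
  have hpt : ∀ k, ‖(w.1 k, w.2 k) - (w'.1 k, w'.2 k)‖ ≤ ‖w - w'‖ := by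
    intro k
    rw [Prod.mk_sub_mk, Prod.norm_mk]
    exact max_le ((norm_le_pi_norm (w - w').1 k).trans (norm_fst_le _))
      ((norm_le_pi_norm (w - w').2 k).trans (norm_snd_le _))
  have hΓ : ∀ k, ‖scaledGrad (discretize P F) w.1 k - scaledGrad (discretize P F) w'.1 k‖
      ≤ κ * √m * ‖w - w'‖ := by
    intro k
    have h1 := sum_norm_scaledGrad_sub_sq_le P D.one_le hm D.differentiable_potential
      D.invariant_potential D.lipschitz_potential w.1 w'.1
    have h2 := norm_restrictTo_univ_le (w.1 - w'.1)
    have h3 := norm_restrictTo_sq Finset.univ (w.1 - w'.1)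
    have h4 := norm_le_norm_restrictTo
      (scaledGrad (discretize P F) w.1 - scaledGrad (discretize P F) w'.1) (Finset.mem_univ k)
    have h5 : ‖restrictTo Finset.univ
        (scaledGrad (discretize P F) w.1 - scaledGrad (discretize P F) w'.1)‖
        ≤ κ * (√m * ‖w.1 - w'.1‖) := by
      refine norm_restrictTo_le (by positivity) (h1.trans ?_)
      simp only [Pi.sub_apply] at h3
      rw [← h3, mul_pow]
      gcongr
    refine h4.trans (h5.trans ?_)
    rw [mul_assoc]
    gcongr
    exact norm_fst_le (w - w')
  have hc : ((κ + κ * Real.toNNReal (√m) : ℝ≥0) : ℝ) = κ + κ * √m := by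
    push_cast
    rw [Real.coe_toNNReal _ (Real.sqrt_nonneg _)]
  rw [hc, Prod.norm_def]
  refine max_le ((pi_norm_le_iff_of_nonneg (by positivity)).2 fun k => ?_)
    ((pi_norm_le_iff_of_nonneg (by positivity)).2 fun k => ?_)
  · refine (norm_gradSnd_sub_le D.lipschitz_hamiltonian (w.1 k, w.2 k) (w'.1 k, w'.2 k)).trans ?_
    have := mul_le_mul_of_nonneg_left (hpt k) κ.2
    refine this.trans ?_
    have h3 : 0 ≤ (κ : ℝ) * √m * ‖w - w'‖ := by positivity
    rw [add_mul]
    exact le_add_of_nonneg_right h3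
  · have h1 := norm_gradFst_sub_le D.lipschitz_hamiltonian (w.1 k, w.2 k) (w'.1 k, w'.2 k)
    have h2 := h1.trans (mul_le_mul_of_nonneg_left (hpt k) κ.2)
    have h3 : (hamiltonianField H (discretize P F) w - hamiltonianField H (discretize P F) w').2 k
        = -(gradFst H (w.1 k, w.2 k) - gradFst H (w'.1 k, w'.2 k))
          + (scaledGrad (discretize P F) w.1 k - scaledGrad (discretize P F) w'.1 k) := by
      simp only [hamiltonianField, Prod.snd_sub, Pi.sub_apply]
      abel
    rw [h3, add_mul]
    refine (norm_add_le _ _).trans ?_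
    rw [norm_neg]
    exact add_le_add h2 (hΓ k)

/-- Solutions of the integrated Hamiltonian system are extremals: Legendre duality turns the
equations for `H` into the equations for `L`. -/
theorem IsRegular.exists_isExtremal (D : IsRegular κ H L F U₀) (P : Equipartition d m)
    {T : ℝ} (hT : 0 ≤ T) (hV : Continuous (hamiltonianField H (discretize P F)))
    {z : Fin m → Pt d} {w : C(Icc 0 T, (Fin m → Pt d) × (Fin m → Pt d))}
    (hw : w = constOp _ (z, scaledGrad (discretize P U₀) z)
      + primitiveOp T hT ((⟨_, hV⟩ : C(_, _)).comp w)) :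
    ∃ x v p f, IsExtremal P H L F U₀ T x v p f ∧ x 0 = z ∧
      ∀ s : Icc 0 T, w s = (x s, p s) := by
  set V : C((Fin m → Pt d) × (Fin m → Pt d), (Fin m → Pt d) × (Fin m → Pt d)) := ⟨_, hV⟩ with hVdef
  set y : ℝ → (Fin m → Pt d) × (Fin m → Pt d) := fun s =>
    (z, scaledGrad (discretize P U₀) z) + primitive T hT (V.comp w) s with hy
  have hyw : ∀ s : Icc 0 T, w s = y s := by
    intro s
    conv_lhs => rw [hw]
    simp [hy]
  have hyd : ∀ s, HasDerivAt y (V (w (projIcc 0 T hT s))) s := fun s =>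
    (hasDerivAt_primitive hT (V.comp w) s).const_add _
  have hcont : Continuous fun s => V (w (projIcc 0 T hT s)) :=
    V.continuous.comp (continuous_extend hT w)
  have hVy : ∀ s ∈ Icc 0 T, V (w (projIcc 0 T hT s)) = hamiltonianField H (discretize P F) (y s) := by
    intro s hs
    rw [projIcc_of_mem hT hs, hyw ⟨s, hs⟩]
    rfl
  have hy0 : y 0 = (z, scaledGrad (discretize P U₀) z) := by
    simp [hy, primitive]
  refine ⟨fun s => (y s).1, fun s => (V (w (projIcc 0 T hT s))).1, fun s => (y s).2,
    fun s => (V (w (projIcc 0 T hT s))).2, ⟨⟨fun s => (hyd s).fst, fun s => (hyd s).snd,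
    continuous_fst.comp hcont, continuous_snd.comp hcont, fun s hs k => ?_, fun s hs k => ?_⟩,
    fun s hs k => ?_, ?_⟩, ?_, fun s => hyw s⟩
  · simp only [hVy s hs, hamiltonianField]
  · simp only [hVy s hs, hamiltonianField]
    exact (D.dual.grad_eq D.differentiable_hamiltonian D.differentiable_lagrangian
      D.lipschitz_hamiltonian _ _).1.symm
  · simp only [hVy s hs, hamiltonianField]
    rw [(D.dual.grad_eq D.differentiable_hamiltonian D.differentiable_lagrangian
      D.lipschitz_hamiltonian _ _).2]
  · simp only [hy0]
  · simp only [hy0]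

/-- The extremals foliate space-time: through every point `(t, q)` passes exactly one extremal, and
it depends smoothly on `q`. -/
theorem IsRegular.exists_extremal_field (D : IsRegular κ H L F U₀) (hm : m ≠ 0)
    (P : Equipartition d m) (hF : ContDiff ℝ 3 (discretize P F))
    (hU : ContDiff ℝ 3 (discretize P U₀)) {T : ℝ} (hT : 0 ≤ T) :
    ∃ (hV : Continuous (hamiltonianField H (discretize P F)))
      (Φ : (Fin m → Pt d) → C(Icc 0 T, (Fin m → Pt d) × (Fin m → Pt d)))
      (Z : Icc 0 T → (Fin m → Pt d) → Fin m → Pt d),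
      ContDiff ℝ 2 Φ ∧ (∀ t, ContDiff ℝ 2 (Z t)) ∧
      Continuous (fun y : Icc 0 T × (Fin m → Pt d) => Z y.1 y.2) ∧
      (∀ t q, (Φ (Z t q) t).1 = q) ∧ (∀ t z, Z t (Φ z t).1 = z) ∧
      ∀ z, Φ z = constOp _ (z, scaledGrad (discretize P U₀) z)
        + primitiveOp T hT ((⟨_, hV⟩ : C(_, _)).comp (Φ z)) := by
  have hVs : ContDiff ℝ (2 : ℕ) (hamiltonianField H (discretize P F)) :=
    contDiff_hamiltonianField (n := 2) (by exact_mod_cast D.contDiff_hamiltonian)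
      (by exact_mod_cast hF)
  obtain ⟨k, hk⟩ := D.exists_lipschitzWith_hamiltonianField hm P
  obtain ⟨Φ₀, hΦ₀, hfix₀⟩ := exists_contDiff_flow (n := 2) (by norm_num)
    (V := ⟨_, hVs.continuous⟩) hVs hk T hT
  have hU' : ContDiff ℝ (2 : ℕ) (scaledGrad (discretize P U₀)) :=
    contDiff_scaledGrad (n := 2) (by exact_mod_cast hU)
  set Φ := fun z : Fin m → Pt d => Φ₀ (z, scaledGrad (discretize P U₀) z) with hΦdef
  have hΦ : ContDiff ℝ 2 Φ := by
    have := hΦ₀.comp (contDiff_id.prodMk hU')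
    exact_mod_cast this
  have hfix : ∀ z, Φ z = constOp _ (z, scaledGrad (discretize P U₀) z)
        + primitiveOp T hT ((⟨_, hVs.continuous⟩ : C(_, _)).comp (Φ z)) := fun z => hfix₀ _
  obtain ⟨C, hC, hst⟩ := D.exists_extremal_lipschitz_const hT
  have hanti : ∀ t : Icc 0 T, AntilipschitzWith (Real.toNNReal (C * √m)) fun z => (Φ z t).1 := by
    intro t
    refine AntilipschitzWith.of_le_mul_dist fun z z' => ?_
    obtain ⟨x, v, p, f, hx, hx0, hxw⟩ := D.exists_isExtremal P hT hVs.continuous (hfix z)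
    obtain ⟨x', v', p', f', hx', hx0', hxw'⟩ := D.exists_isExtremal P hT hVs.continuous (hfix z')
    have h1 := (hst m hm P t x v p f x' v' p' f' t.2 (hx.mono t.2.2) (hx'.mono t.2.2) 0
      ⟨le_rfl, t.2.1⟩).1
    rw [hx0, hx0'] at h1
    rw [hxw, hxw', dist_eq_norm, dist_eq_norm, Real.coe_toNNReal _ (by positivity)]
    refine (norm_le_norm_restrictTo_univ _).trans (h1.trans ?_)
    rw [mul_assoc]
    exact mul_le_mul_of_nonneg_left (norm_restrictTo_univ_le _) hC.le
  have hsm : ∀ t : Icc 0 T, ContDiff ℝ 2 fun z => (Φ z t).1 := by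
    intro t
    let ev : C(Icc 0 T, (Fin m → Pt d) × (Fin m → Pt d)) →L[ℝ] (Fin m → Pt d) × (Fin m → Pt d) :=
      ContinuousMap.evalCLM ℝ t
    have h1 : ContDiff ℝ 2 fun z => Φ z t := ev.contDiff.comp hΦ
    exact contDiff_fst.comp h1
  choose Z hZ hZ1 hZ2 using fun t : Icc 0 T =>
    exists_contDiff_inverse_of_antilipschitz (by norm_num) (hsm t) (hanti t)
  refine ⟨hVs.continuous, Φ, Z, hΦ, hZ, ?_, hZ1, hZ2, hfix⟩
  rw [continuous_iff_continuousAt]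
  rintro ⟨t, q⟩
  have h1 : Continuous fun y : Icc 0 T × (Fin m → Pt d) =>
      C * √m * dist y.2 (Φ (Z t q) y.1).1 :=
    continuous_const.mul (continuous_snd.dist
      (continuous_fst.comp ((Φ (Z t q)).continuous.comp continuous_fst)))
  rw [ContinuousAt, tendsto_iff_dist_tendsto_zero]
  have h2 : Filter.Tendsto (fun y : Icc 0 T × (Fin m → Pt d) =>
      C * √m * dist y.2 (Φ (Z t q) y.1).1) (nhds (t, q)) (nhds 0) := by
    have := h1.tendsto (t, q)
    simpa [hZ1] using this
  refine squeeze_zero (fun _ => dist_nonneg) (fun y => ?_) h2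
  have := (hanti y.1).le_mul_dist (Z y.1 y.2) (Z t q)
  rw [hZ1, Real.coe_toNNReal _ (by positivity)] at this
  exact this

end Flow

/-! ### The value function along the field of extremals -/

section Value

open Filter Topology

variable {d m : ℕ} {κ : ℝ≥0} {H L : Pt d × Pt d → ℝ} {F U₀ : Hilb d → ℝ}

/-- A smooth foliation of `[0, T] × 𝕄^m` by extremals: `flow z` is the trajectory, in phase space,
of the extremal that starts at `z`, and `start t q` is the starting point of the one that passes
through `q` at time `t`. -/
structure ExtremalField (P : Equipartition d m) (H : Pt d × Pt d → ℝ) (F U₀ : Hilb d → ℝ) (T : ℝ)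
    (hT : 0 ≤ T) where
  continuous_field : Continuous (hamiltonianField H (discretize P F))
  flow : (Fin m → Pt d) → C(Icc 0 T, (Fin m → Pt d) × (Fin m → Pt d))
  start : Icc 0 T → (Fin m → Pt d) → Fin m → Pt d
  contDiff_flow : ContDiff ℝ 2 flow
  contDiff_start : ∀ t, ContDiff ℝ 2 (start t)
  continuous_start : Continuous fun y : Icc 0 T × (Fin m → Pt d) => start y.1 y.2
  flow_start : ∀ t q, (flow (start t q) t).1 = q
  start_flow : ∀ t z, start t (flow z t).1 = z
  flow_eq : ∀ z, flow z = constOp _ (z, scaledGrad (discretize P U₀) z)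
        + primitiveOp T hT ((⟨_, continuous_field⟩ : C(_, _)).comp (flow z))

theorem IsRegular.nonempty_extremalField (D : IsRegular κ H L F U₀) (hm : m ≠ 0)
    (P : Equipartition d m) (hF : ContDiff ℝ 3 (discretize P F))
    (hU : ContDiff ℝ 3 (discretize P U₀)) {T : ℝ} (hT : 0 ≤ T) :
    Nonempty (ExtremalField P H F U₀ T hT) := by
  obtain ⟨hV, Φ, Z, h1, h2, h3, h4, h5, h6⟩ := D.exists_extremal_field hm P hF hU hT
  exact ⟨⟨hV, Φ, Z, h1, h2, h3, h4, h5, h6⟩⟩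

namespace ExtremalField

variable {P : Equipartition d m} {T : ℝ} {hT : 0 ≤ T} (X : ExtremalField P H F U₀ T hT)

/-- The momentum at time `t` of the extremal that passes through `q` at time `t`. -/
def momentum (t : Icc 0 T) (q : Fin m → Pt d) : Fin m → Pt d := (X.flow (X.start t q) t).2

theorem flow_start_self (t : Icc 0 T) (q : Fin m → Pt d) :
    X.flow (X.start t q) t = (q, X.momentum t q) :=
  Prod.ext (X.flow_start t q) rfl

theorem exists_isExtremal (D : IsRegular κ H L F U₀) (z : Fin m → Pt d) :
    ∃ x v p f, IsExtremal P H L F U₀ T x v p f ∧ x 0 = z ∧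
      ∀ s : Icc 0 T, X.flow z s = (x s, p s) :=
  D.exists_isExtremal P hT X.continuous_field (X.flow_eq z)

theorem contDiff_trajectory (t : Icc 0 T) : ContDiff ℝ 2 fun q => X.flow (X.start t q) :=
  X.contDiff_flow.comp (X.contDiff_start t)

theorem contDiff_momentum (t : Icc 0 T) : ContDiff ℝ 2 (X.momentum t) := by
  let ev : C(Icc 0 T, (Fin m → Pt d) × (Fin m → Pt d)) →L[ℝ] (Fin m → Pt d) × (Fin m → Pt d) :=
    ContinuousMap.evalCLM ℝ t
  have h1 : ContDiff ℝ 2 fun q => X.flow (X.start t q) t :=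
    ev.contDiff.comp (X.contDiff_trajectory t)
  exact contDiff_snd.comp h1

theorem continuous_flow_apply :
    Continuous fun y : (Fin m → Pt d) × Icc 0 T => X.flow y.1 y.2 :=
  (X.contDiff_flow.continuous.comp continuous_fst).eval continuous_snd

theorem continuous_momentum :
    Continuous fun y : Icc 0 T × (Fin m → Pt d) => X.momentum y.1 y.2 :=
  continuous_snd.comp (X.continuous_flow_apply.comp (X.continuous_start.prodMk continuous_fst))

end ExtremalField

/-- The scalar product of `𝕄^m` inherited from `L²(Ω)`. -/
noncomputable def meanInner (d m : ℕ) : (Fin m → Pt d) →L[ℝ] (Fin m → Pt d) →L[ℝ] ℝ :=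
  (m : ℝ)⁻¹ • ∑ k, (innerSL ℝ : Pt d →L[ℝ] Pt d →L[ℝ] ℝ).bilinearComp
    (ContinuousLinearMap.proj (R := ℝ) (φ := fun _ : Fin m => Pt d) k)
    (ContinuousLinearMap.proj (R := ℝ) (φ := fun _ : Fin m => Pt d) k)

theorem meanInner_apply (p h : Fin m → Pt d) :
    meanInner d m p h = (m : ℝ)⁻¹ * ∑ k, inner ℝ (p k) (h k) := by
  simp [meanInner, ContinuousLinearMap.bilinearComp]

theorem partialGrad_of_hasFDerivAt {G : (Fin m → Pt d) → ℝ} {q p : Fin m → Pt d}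
    (h : HasFDerivAt G (meanInner d m p) q) (k : Fin m) :
    partialGrad G q k = (m : ℝ)⁻¹ • p k := by
  refine ext_inner_right ℝ fun w => ?_
  rw [inner_partialGrad, h.fderiv, meanInner_apply, inner_smul_left,
    Finset.sum_eq_single k]
  · simp
  · intro j _ hj
    rw [Pi.single_eq_of_ne hj, inner_zero_right]
  · simp

/-- The running cost at a point of the phase space. -/
noncomputable def runningCost (P : Equipartition d m) (H L : Pt d × Pt d → ℝ) (F : Hilb d → ℝ)
    (w : (Fin m → Pt d) × (Fin m → Pt d)) : ℝ :=
  (m : ℝ)⁻¹ * ∑ k, L (w.1 k, gradSnd H (w.1 k, w.2 k)) + discretize P F w.1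

theorem IsRegular.contDiff_hamiltonianPart (D : IsRegular κ H L F U₀) (k : Fin m) :
    ContDiff ℝ (2 : ℕ) fun w : (Fin m → Pt d) × (Fin m → Pt d) => gradSnd H (w.1 k, w.2 k) :=
  (contDiff_gradSnd (n := 2) (by exact_mod_cast D.contDiff_hamiltonian)).comp
    (((contDiff_apply ℝ (Pt d) k).comp contDiff_fst).prodMk
      ((contDiff_apply ℝ (Pt d) k).comp contDiff_snd))

theorem IsRegular.continuous_runningCost (D : IsRegular κ H L F U₀) (P : Equipartition d m) :
    Continuous (runningCost P H L F) := by
  have h1 : ∀ k : Fin m, Continuous fun w : (Fin m → Pt d) × (Fin m → Pt d) =>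
      L (w.1 k, gradSnd H (w.1 k, w.2 k)) := fun k =>
    D.contDiff_lagrangian.continuous.comp
      (((continuous_apply k).comp continuous_fst).prodMk (D.contDiff_hamiltonianPart k).continuous)
  have h2 : Continuous (discretize P F) :=
    D.differentiable_potential.continuous.comp (stepCLM P).continuous
  exact (continuous_const.mul (continuous_finsetSum _ fun k _ => h1 k)).add (h2.comp continuous_fst)

namespace ExtremalField

variable {P : Equipartition d m} {T : ℝ} {hT : 0 ≤ T} (X : ExtremalField P H F U₀ T hT)

theorem particleValue_flow (D : IsRegular κ H L F U₀) (hm : m ≠ 0) (t : Icc 0 T)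
    (z : Fin m → Pt d) :
    particleValue P L F U₀ t (X.flow z t).1 = discretize P U₀ z
      + ∫ s in (0 : ℝ)..t, runningCost P H L F (X.flow z (projIcc 0 T hT s)) := by
  have := P.isProbabilityMeasure hm
  obtain ⟨x, v, p, f, hx, hx0, hxw⟩ := X.exists_isExtremal D z
  have h1 := (hx.mono t.2.2).isLeast D.one_le hm D.differentiable_lagrangian D.lipschitz_lagrangian
    D.differentiable_potential D.lipschitz_potential D.invariant_potential D.differentiable_initial
    D.lipschitz_initial D.invariant_initial D.convexOn_lagrangian D.convexOn_initial t.2.1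
  rw [hxw, particleValue, discretize, h1, hx0, action, add_comm]
  refine congrArg₂ (· + ·) rfl (intervalIntegral.integral_congr fun s hs => ?_)
  rw [uIcc_of_le t.2.1] at hs
  have hs' : s ∈ Icc 0 T := ⟨hs.1, hs.2.trans t.2.2⟩
  simp only [projIcc_of_mem hT hs', hxw, runningCost, liftedLagrangian_stepMap,
    hx.velocity_eq s hs']

/-- The value function at time `t` has the subgradient `p/m`, where `p` is the final momentum of the
extremal. -/
theorem subgradient (D : IsRegular κ H L F U₀) (hm : m ≠ 0) (t : Icc 0 T)
    (q q' : Fin m → Pt d) :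
    particleValue P L F U₀ t q + meanInner d m (X.momentum t q) (q' - q)
      ≤ particleValue P L F U₀ t q' := by
  have := P.isProbabilityMeasure hm
  obtain ⟨x, v, p, f, hx, hx0, hxw⟩ := X.exists_isExtremal D (X.start t q)
  have h1 := (hx.mono t.2.2).subgradient D.one_le hm D.differentiable_lagrangian
    D.lipschitz_lagrangian D.differentiable_potential D.lipschitz_potential D.invariant_potential
    D.differentiable_initial D.lipschitz_initial D.invariant_initial D.convexOn_lagrangian
    D.convexOn_initial t.2.1 q'
  have h2 := hxw t
  rw [X.flow_start_self, Prod.mk.injEq] at h2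
  rw [← h2.1, ← h2.2] at h1
  rw [meanInner_apply]
  exact h1

theorem continuous_particleValue (X : ExtremalField P H F U₀ T hT) (D : IsRegular κ H L F U₀)
    (hm : m ≠ 0) :
    Continuous fun y : Icc 0 T × (Fin m → Pt d) => particleValue P L F U₀ y.1 y.2 := by
  have h1 : (fun y : Icc 0 T × (Fin m → Pt d) => particleValue P L F U₀ y.1 y.2)
      = fun y => discretize P U₀ (X.start y.1 y.2)
        + ∫ s in (0 : ℝ)..y.1, runningCost P H L F (X.flow (X.start y.1 y.2) (projIcc 0 T hT s)) := by
    funext y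
    rw [← X.particleValue_flow D hm, X.flow_start]
  rw [h1]
  have h2 : Continuous (discretize P U₀) :=
    D.differentiable_initial.continuous.comp (stepCLM P).continuous
  refine (h2.comp X.continuous_start).add ?_
  refine intervalIntegral.continuous_parametric_intervalIntegral_of_continuous ?_
    (continuous_subtype_val.comp continuous_fst)
  exact (D.continuous_runningCost P).comp (X.continuous_flow_apply.comp
    ((X.continuous_start.comp continuous_fst).prodMk
      ((continuous_projIcc (h := hT)).comp continuous_snd)))

theorem particleValue_zero (X : ExtremalField P H F U₀ T hT) (D : IsRegular κ H L F U₀)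
    (hm : m ≠ 0) (q : Fin m → Pt d) :
    particleValue P L F U₀ 0 q = discretize P U₀ q := by
  have h := X.particleValue_flow D hm ⟨0, le_rfl, hT⟩ q
  have h2 : (X.flow q ⟨0, le_rfl, hT⟩).1 = q := by
    obtain ⟨x, v, p, f, hx, hx0, hxw⟩ := X.exists_isExtremal D q
    rw [hxw]; exact hx0
  rw [h2] at h
  simpa using h

/-- The value function is differentiable in time and space, and its derivatives are those given by
the Hamilton-Jacobi equation. Near `(t, q)` it is squeezed between the affine functions given by the
subgradients at the points of the extremal through `(t, q)`, and at the point itself. -/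
theorem hasFDerivAt_particleValue (D : IsRegular κ H L F U₀) (hm : m ≠ 0) (t : Icc 0 T)
    (ht : (t : ℝ) ∈ Ioo 0 T) (q : Fin m → Pt d) :
    HasFDerivAt (fun y : ℝ × (Fin m → Pt d) => particleValue P L F U₀ y.1 y.2)
      ((discretize P F q - particleHamiltonian H q ((m : ℝ)⁻¹ • X.momentum t q)) •
        ContinuousLinearMap.fst ℝ ℝ (Fin m → Pt d)
        + (meanInner d m (X.momentum t q)).comp (ContinuousLinearMap.snd ℝ ℝ (Fin m → Pt d)))
      ((t : ℝ), q) := by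
  have hm' : (m : ℝ) ≠ 0 := by exact_mod_cast hm
  obtain ⟨x, v, p, f, hx, hx0, hxw⟩ := X.exists_isExtremal D (X.start t q)
  have hxt : x t = q ∧ p t = X.momentum t q := by
    have h2 := hxw t
    rw [X.flow_start_self, Prod.mk.injEq] at h2
    exact ⟨h2.1.symm, h2.2.symm⟩
  set z := X.start t q with hz
  set c : ℝ → ℝ := fun s => runningCost P H L F (X.flow z (projIcc 0 T hT s)) with hc
  have hcc : Continuous c := (D.continuous_runningCost P).comp (continuous_extend hT _)
  set J : ℝ → ℝ := fun s => discretize P U₀ z + ∫ τ in (0 : ℝ)..s, c τ with hJ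
  have hJd : HasDerivAt J (c t) t :=
    (intervalIntegral.integral_hasDerivAt_right (hcc.intervalIntegrable _ _)
      (hcc.stronglyMeasurableAtFilter _ _) hcc.continuousAt).const_add _
  have hJv : ∀ s (hs : s ∈ Icc 0 T), particleValue P L F U₀ s (x s) = J s := by
    intro s hs
    have := X.particleValue_flow D hm ⟨s, hs⟩ z
    rw [hxw] at this
    exact this
  set g : ℝ × (Fin m → Pt d) → ℝ := fun y => J y.1 + meanInner d m (p y.1) (y.2 - x y.1) with hg
  have hfst : HasFDerivAt (fun y : ℝ × (Fin m → Pt d) => y.1)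
      (ContinuousLinearMap.fst ℝ ℝ (Fin m → Pt d)) ((t : ℝ), q) := hasFDerivAt_fst
  have hxd : HasFDerivAt (fun y : ℝ × (Fin m → Pt d) => x y.1)
      ((ContinuousLinearMap.toSpanSingleton ℝ (v t)).comp (ContinuousLinearMap.fst ℝ ℝ _))
          ((t : ℝ), q) :=
    (hx.hasDerivAt_position t).hasFDerivAt.comp ((t : ℝ), q) hfst
  have hpd : HasFDerivAt (fun y : ℝ × (Fin m → Pt d) => p y.1)
      ((ContinuousLinearMap.toSpanSingleton ℝ (f t)).comp (ContinuousLinearMap.fst ℝ ℝ _))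
          ((t : ℝ), q) :=
    (hx.hasDerivAt_momentum t).hasFDerivAt.comp ((t : ℝ), q) hfst
  have hJd' : HasFDerivAt (fun y : ℝ × (Fin m → Pt d) => J y.1)
      ((ContinuousLinearMap.toSpanSingleton ℝ (c t)).comp (ContinuousLinearMap.fst ℝ ℝ _))
          ((t : ℝ), q) :=
    HasFDerivAt.comp (g := J) ((t : ℝ), q) hJd.hasFDerivAt hfst
  have hvel : ∀ k, v t k = gradSnd H (q k, X.momentum t q k) := fun k => by
    rw [hx.velocity_eq t t.2, hxt.1, hxt.2]
  have hct : c t = (m : ℝ)⁻¹ * ∑ k, L (q k, v t k) + discretize P F q := by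
    simp only [hc, projIcc_val, hz, X.flow_start_self, runningCost, hvel]
  -- the energy identity is the case of equality in the Fenchel inequality
  have hen : c t - meanInner d m (X.momentum t q) (v t)
      = discretize P F q - particleHamiltonian H q ((m : ℝ)⁻¹ • X.momentum t q) := by
    have h1 : ∀ k, H (q k, X.momentum t q k) = inner ℝ (X.momentum t q k) (v t k)
        - L (q k, v t k) := by
      intro k
      rw [hvel]
      have := D.dual.fenchel_eq D.differentiable_hamiltonian D.lipschitz_hamiltonian (q k)
          (X.momentum t q k)
      linarith
    rw [hct, meanInner_apply, particleHamiltonian]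
    simp only [Pi.smul_apply, smul_inv_smul₀ hm', h1, Finset.sum_sub_distrib]
    ring
  have hgd : HasFDerivAt g
      ((discretize P F q - particleHamiltonian H q ((m : ℝ)⁻¹ • X.momentum t q)) •
        ContinuousLinearMap.fst ℝ ℝ (Fin m → Pt d)
        + (meanInner d m (X.momentum t q)).comp (ContinuousLinearMap.snd ℝ ℝ (Fin m → Pt d)))
      ((t : ℝ), q) := by
    have h1 := hJd'.add (((meanInner d m).hasFDerivAt.comp _ hpd).clm_apply
      ((hasFDerivAt_snd (𝕜 := ℝ) (p := ((t : ℝ), q))).sub hxd))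
    refine h1.congr_fderiv ?_
    refine ContinuousLinearMap.ext fun y => ?_
    rw [← hen]
    simp [hxt.1, hxt.2]
    ring
  have hsq : (fun y : ℝ × (Fin m → Pt d) => particleValue P L F U₀ y.1 y.2 - g y)
      =o[𝓝 ((t : ℝ), q)] fun y => y - ((t : ℝ), q) := by
    have hproj : ContinuousAt (fun y : ℝ × (Fin m → Pt d) => X.momentum
        (projIcc 0 T hT y.1) y.2 - p y.1)
        ((t : ℝ), q) :=
      (X.continuous_momentum.comp (((continuous_projIcc (h := hT)).comp continuous_fst).prodMk
        continuous_snd)).continuousAt.sub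
            (hx.continuous_momentum.continuousAt.comp continuousAt_fst)
    have h0 : (fun y : ℝ × (Fin m → Pt d) =>
        meanInner d m (X.momentum (projIcc 0 T hT y.1) y.2 - p y.1))
        =o[𝓝 ((t : ℝ), q)] fun _ => (1 : ℝ) := by
      rw [Asymptotics.isLittleO_one_iff]
      have := ((meanInner d m).continuous.continuousAt.comp hproj).tendsto
      simpa [hxt.2, Function.comp_def] using this
    have h1 : (fun y : ℝ × (Fin m → Pt d) => y.2 - x y.1)
        =O[𝓝 ((t : ℝ), q)] fun y => y - ((t : ℝ), q) := by
      have := ((hasFDerivAt_snd (𝕜 := ℝ) (p := ((t : ℝ), q))).sub hxd).isBigO_sub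
      simpa [hxt.1] using this
    have h2 : (fun y : ℝ × (Fin m → Pt d) =>
        meanInner d m (X.momentum (projIcc 0 T hT y.1) y.2 - p y.1) (y.2 - x y.1))
        =o[𝓝 ((t : ℝ), q)] fun y => y - ((t : ℝ), q) := by
      have h3 := h0.norm_left.mul_isBigO h1.norm_norm
      simp only [one_mul] at h3
      refine (Asymptotics.IsBigO.trans_isLittleO ?_ h3).of_norm_right
      exact Asymptotics.IsBigO.of_bound 1 (Eventually.of_forall fun y => by
        rw [one_mul, norm_mul, norm_norm, norm_norm]
        exact ContinuousLinearMap.le_opNorm _ _)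
    refine Asymptotics.IsBigO.trans_isLittleO ?_ h2
    refine Asymptotics.IsBigO.of_bound 1 ?_
    have hnear : ∀ᶠ y : ℝ × (Fin m → Pt d) in 𝓝 ((t : ℝ), q), y.1 ∈ Icc 0 T :=
      continuousAt_fst.eventually (Icc_mem_nhds ht.1 ht.2)
    filter_upwards [hnear] with y hy
    have e1 := X.subgradient D hm ⟨y.1, hy⟩ (x y.1) y.2
    have e2 := X.subgradient D hm ⟨y.1, hy⟩ y.2 (x y.1)
    have e3 : X.momentum ⟨y.1, hy⟩ (x y.1) = p y.1 := by
      have h4 := hxw ⟨y.1, hy⟩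
      have h5 := X.start_flow ⟨y.1, hy⟩ z
      rw [h4] at h5
      rw [momentum, h5, h4]
    simp only at e1 e2
    rw [e3, hJv y.1 hy] at e1
    rw [hJv y.1 hy, ← neg_sub y.2, map_neg] at e2
    rw [projIcc_of_mem hT hy, one_mul, Real.norm_eq_abs, Real.norm_eq_abs, map_sub (meanInner d m),
      sub_apply]
    have e4 : 0 ≤ particleValue P L F U₀ y.1 y.2 - g y := by simp only [hg]; linarith
    rw [abs_of_nonneg e4]
    refine le_trans ?_ (le_abs_self _)
    simp only [hg]; linarith
  have hval : particleValue P L F U₀ t q = g ((t : ℝ), q) := by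
    simp only [hg, hxt.1, sub_self, map_zero, add_zero]
    rw [← hJv t t.2, hxt.1]
  have := hgd.isLittleO.add hsq
  refine HasFDerivAt.of_isLittleO (this.congr_left fun y => ?_)
  simp only [hval]
  ring

end ExtremalField

end Value

/-! ### The viscosity solution and the derivatives of the value function -/

section Solution

open Filter Topology

variable {d m : ℕ} {κ : ℝ≥0} {H L : Pt d × Pt d → ℝ} {F U₀ : Hilb d → ℝ}

theorem continuousOn_uncurry_of_continuous {E : Type*} [TopologicalSpace E] {T : ℝ} (hT : 0 ≤ T)
    {g : ℝ → E → ℝ} (hg : Continuous fun y : Icc 0 T × E => g y.1 y.2) :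
    ContinuousOn (fun y : ℝ × E => g y.1 y.2) (Ico 0 T ×ˢ univ) := by
  have h1 : Continuous fun y : ℝ × E => (projIcc 0 T hT y.1, y.2) :=
    ((continuous_projIcc (h := hT)).comp continuous_fst).prodMk continuous_snd
  refine (hg.comp h1).continuousOn.congr fun y hy => ?_
  have hy' : y.1 ∈ Icc 0 T := Ico_subset_Icc_self hy.1
  simp only [Function.comp_apply, projIcc_of_mem hT hy']

namespace ExtremalField

variable {P : Equipartition d m} {T : ℝ} {hT : 0 ≤ T} (X : ExtremalField P H F U₀ T hT)

/-- The equation holds classically at interior times, by the derivative of the value function,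
so the sub- and supersolution inequalities follow from the first order conditions at an extremum. -/
theorem isViscositySolution (X : ExtremalField P H F U₀ T hT) (D : IsRegular κ H L F U₀)
    (hm : m ≠ 0) :
    IsViscositySolution T H (discretize P F) (discretize P U₀) (particleValue P L F U₀) := by
  refine ⟨?_, X.particleValue_zero D hm, fun φ hφ t ht q => ?_⟩
  · exact continuousOn_uncurry_of_continuous hT (X.continuous_particleValue D hm)
  have hu := X.hasFDerivAt_particleValue D hm ⟨t, Ioo_subset_Icc_self ht⟩ ht q
  set D' : ℝ × (Fin m → Pt d) →L[ℝ] ℝ := ((discretize P F q - particleHamiltonian H q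
      ((m : ℝ)⁻¹ • X.momentum ⟨t, Ioo_subset_Icc_self ht⟩ q)) •
        ContinuousLinearMap.fst ℝ ℝ (Fin m → Pt d)
        + (meanInner d m (X.momentum ⟨t, Ioo_subset_Icc_self ht⟩ q)).comp
          (ContinuousLinearMap.snd ℝ ℝ (Fin m → Pt d))) with hD'
  have hφd : HasFDerivAt φ (fderiv ℝ φ (t, q)) (t, q) :=
    (hφ.differentiable (by norm_num) (t, q)).hasFDerivAt
  have key : D' - fderiv ℝ φ (t, q) = 0 → deriv (fun s => φ (s, q)) t
        + particleHamiltonian H q (partialGrad (fun y => φ (t, y)) q) - discretize P F q = 0 := by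
    intro h0
    rw [sub_eq_zero] at h0
    rw [← h0] at hφd
    have h1 : HasDerivAt (fun s => φ (s, q)) (D' (1, 0)) t :=
      hφd.comp_hasDerivAt t ((hasDerivAt_id t).prodMk (hasDerivAt_const t q))
    have h2 : HasFDerivAt (fun y => φ (t, y))
        (meanInner d m (X.momentum ⟨t, Ioo_subset_Icc_self ht⟩ q)) q := by
      have h3 : HasFDerivAt (fun y : Fin m → Pt d => (t, y))
          (ContinuousLinearMap.inr ℝ ℝ (Fin m → Pt d)) q := hasFDerivAt_prodMk_right t q
      refine (HasFDerivAt.comp (g := φ) q hφd h3).congr_fderiv ?_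
      ext y
      simp [hD']
    have h4 : partialGrad (fun y => φ (t, y)) q
        = (m : ℝ)⁻¹ • X.momentum ⟨t, Ioo_subset_Icc_self ht⟩ q :=
      funext fun k => partialGrad_of_hasFDerivAt h2 k
    rw [h1.deriv, h4]
    simp [hD']
  exact ⟨fun h => (key (h.hasFDerivAt_eq_zero (hu.sub hφd))).le,
    fun h => (key (h.hasFDerivAt_eq_zero (hu.sub hφd))).ge⟩

theorem hasFDerivAt_particleValue_right (D : IsRegular κ H L F U₀) (hm : m ≠ 0) (t : Icc 0 T)
    (ht : (t : ℝ) ∈ Ioo 0 T) (q : Fin m → Pt d) :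
    HasFDerivAt (particleValue P L F U₀ t) (meanInner d m (X.momentum t q)) q := by
  have h3 : HasFDerivAt (fun y : Fin m → Pt d => ((t : ℝ), y))
      (ContinuousLinearMap.inr ℝ ℝ (Fin m → Pt d)) q := hasFDerivAt_prodMk_right _ q
  refine (HasFDerivAt.comp (g := fun y : ℝ × (Fin m → Pt d) => particleValue P L F U₀ y.1 y.2) q
    (X.hasFDerivAt_particleValue D hm t ht q) h3).congr_fderiv ?_
  ext y
  simp

theorem particleHamiltonian_inv_smul (hm : m ≠ 0) (q p : Fin m → Pt d) :
    particleHamiltonian H q ((m : ℝ)⁻¹ • p) = (m : ℝ)⁻¹ * ∑ k, H (q k, p k) := by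
  have hm' : (m : ℝ) ≠ 0 := by exact_mod_cast hm
  simp only [particleHamiltonian, Pi.smul_apply, smul_inv_smul₀ hm']

theorem hasDerivAt_particleValue_left (D : IsRegular κ H L F U₀) (hm : m ≠ 0) (t : Icc 0 T)
    (ht : (t : ℝ) ∈ Ioo 0 T) (q : Fin m → Pt d) :
    HasDerivAt (fun s => particleValue P L F U₀ s q)
      (discretize P F q - (m : ℝ)⁻¹ * ∑ k, H (q k, X.momentum t q k)) t := by
  rw [← particleHamiltonian_inv_smul hm]
  have := (X.hasFDerivAt_particleValue D hm t ht q).comp_hasDerivAt (t : ℝ)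
    ((hasDerivAt_id (t : ℝ)).prodMk (hasDerivAt_const (t : ℝ) q))
  simpa [Function.comp_def] using this

theorem fderiv_particleValue (D : IsRegular κ H L F U₀) (hm : m ≠ 0) (t : Icc 0 T)
    (ht : (t : ℝ) ∈ Ioo 0 T) :
    fderiv ℝ (particleValue P L F U₀ t) = fun q => meanInner d m (X.momentum t q) :=
  funext fun q => (X.hasFDerivAt_particleValue_right D hm t ht q).fderiv

theorem contDiff_particleValue (X : ExtremalField P H F U₀ T hT) (D : IsRegular κ H L F U₀)
    (hm : m ≠ 0) (t : Icc 0 T) (ht : (t : ℝ) ∈ Ioo 0 T) :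
    ContDiff ℝ 3 (particleValue P L F U₀ t) := by
  have h1 : ContDiff ℝ (2 + 1) (particleValue P L F U₀ t) := by
    refine contDiff_succ_iff_fderiv.2 ⟨fun q =>
      (X.hasFDerivAt_particleValue_right D hm t ht q).differentiableAt, by simp, ?_⟩
    rw [X.fderiv_particleValue D hm t ht]
    exact (meanInner d m).contDiff.comp (X.contDiff_momentum t)
  exact h1.of_le (by norm_num)

/-- The derivative of the trajectory that passes through `q` at time `t`, with respect to `q`. -/
noncomputable def variation (t : Icc 0 T) (q y : Fin m → Pt d) :
    C(Icc 0 T, (Fin m → Pt d) × (Fin m → Pt d)) :=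
  fderiv ℝ (fun q => X.flow (X.start t q)) q y

theorem hasFDerivAt_trajectory (t s : Icc 0 T) (q : Fin m → Pt d) :
    HasFDerivAt (fun q => X.flow (X.start t q) s) ((ContinuousMap.evalCLM ℝ s :
      C(Icc 0 T, (Fin m → Pt d) × (Fin m → Pt d)) →L[ℝ] _).comp
      (fderiv ℝ (fun q => X.flow (X.start t q)) q)) q := by
  let ev : C(Icc 0 T, (Fin m → Pt d) × (Fin m → Pt d)) →L[ℝ] (Fin m → Pt d) × (Fin m → Pt d) :=
    ContinuousMap.evalCLM ℝ s
  exact ev.hasFDerivAt.comp q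
    ((X.contDiff_trajectory t).differentiable (by norm_num) q).hasFDerivAt

theorem hasDerivAt_trajectory (t s : Icc 0 T) (q y : Fin m → Pt d) :
    HasDerivAt (fun ε : ℝ => X.flow (X.start t (q + ε • y)) s) (X.variation t q y s) 0 := by
  have h1 : HasDerivAt (fun ε : ℝ => q + ε • y) y 0 := by
    simpa using ((hasDerivAt_id (0 : ℝ)).smul_const y).const_add q
  have h2 : HasFDerivAt (fun q => X.flow (X.start t q) s) ((ContinuousMap.evalCLM ℝ s :
      C(Icc 0 T, (Fin m → Pt d) × (Fin m → Pt d)) →L[ℝ] _).comp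
      (fderiv ℝ (fun q => X.flow (X.start t q)) q)) (q + (0 : ℝ) • y) := by
    rw [zero_smul, add_zero]
    exact X.hasFDerivAt_trajectory t s q
  exact h2.comp_hasDerivAt (0 : ℝ) h1

theorem fderiv_momentum (t : Icc 0 T) (q y : Fin m → Pt d) :
    fderiv ℝ (X.momentum t) q y = (X.variation t q y t).2 := by
  have h : HasFDerivAt (X.momentum t) _ q := (X.hasFDerivAt_trajectory t t q).snd
  rw [h.fderiv]
  rfl

theorem fderiv_fderiv_particleValue (D : IsRegular κ H L F U₀) (hm : m ≠ 0) (t : Icc 0 T)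
    (ht : (t : ℝ) ∈ Ioo 0 T) (q a b : Fin m → Pt d) :
    fderiv ℝ (fderiv ℝ (particleValue P L F U₀ t)) q a b
      = meanInner d m (X.variation t q a t).2 b := by
  rw [X.fderiv_particleValue D hm t ht]
  have h1 : HasFDerivAt (fun q => meanInner d m (X.momentum t q))
      ((meanInner d m).comp (fderiv ℝ (X.momentum t) q)) q :=
    (meanInner d m).hasFDerivAt.comp q
      ((X.contDiff_momentum t).differentiable (by norm_num) q).hasFDerivAt
  rw [h1.fderiv, ContinuousLinearMap.comp_apply, X.fderiv_momentum]

end ExtremalField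

theorem norm_restrictTo_basisVec (i : Fin m) (a : Fin d) :
    ‖restrictTo Finset.univ (basisVec i a)‖ ≤ 1 := by
  refine norm_restrictTo_le zero_le_one (le_of_eq ?_)
  rw [basisVec, Finset.sum_eq_single i] <;> simp +contextual

theorem add_smul_basisVec_mem_particleBall (hm : m ≠ 0) {r ε : ℝ} (hr : 0 ≤ r) (hε : |ε| ≤ 1)
    {q : Fin m → Pt d} (hq : q ∈ particleBall d m r) (i : Fin m) (a : Fin d) :
    q + ε • basisVec i a ∈ particleBall d m (r + 1) := by
  rw [mem_particleBall_iff hm hr] at hq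
  rw [mem_particleBall_iff hm (by positivity), map_add, map_smul, mul_add, mul_one]
  refine (norm_add_le _ _).trans (add_le_add hq ?_)
  rw [norm_smul, Real.norm_eq_abs]
  have h1 : (1 : ℝ) ≤ √m := by
    rw [Real.one_le_sqrt]
    exact_mod_cast Nat.one_le_iff_ne_zero.2 hm
  exact (mul_le_one₀ hε (norm_nonneg _) (norm_restrictTo_basisVec i a)).trans h1

/-- The trajectories of the extremals and their derivatives depend on the `i`-th particle of the end
point in the way described by `exists_localization_const`. -/
theorem IsRegular.exists_trajectory_const (D : IsRegular κ H L F U₀) {T : ℝ} (hT : 0 ≤ T)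
    {A : ℝ → ℝ} (hA : ∀ r, 0 < r → 0 < A r) {r : ℝ} (hr : 0 ≤ r) :
    ∃ C : ℝ, 0 < C ∧ ∀ (m : ℕ) (_ : m ≠ 0) (P : Equipartition d m),
      (∀ r, 0 < r → HessianEstimate (discretize P F) r (A r)) →
      (∀ r, 0 < r → HessianEstimate (discretize P U₀) r (A r)) →
      ∀ (X : ExtremalField P H F U₀ T hT) (t s : Icc 0 T), s ≤ t →
      ∀ q ∈ particleBall d m r, ∀ (i : Fin m) (a : Fin d) (j : Fin m),
        (∀ ε : ℝ, |ε| ≤ 1 →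
          ‖(X.flow (X.start t (q + ε • basisVec i a)) s).1 j - (X.flow (X.start t q) s).1 j‖
            ≤ C * decay i j * |ε| ∧
          ‖(X.flow (X.start t (q + ε • basisVec i a)) s).2 j - (X.flow (X.start t q) s).2 j‖
            ≤ C * decay i j * |ε|) ∧
        ‖(X.variation t q (basisVec i a) s).1 j‖ ≤ C * decay i j ∧
        ‖(X.variation t q (basisVec i a) s).2 j‖ ≤ C * decay i j := by
  obtain ⟨C, hC, hloc⟩ := D.exists_localization_const hT hA (r := r + 1) (by positivity)
  refine ⟨C, hC, ?_⟩
  intro m hm P hFE hUE X t s hst q hq i a j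
  have hdiff : ∀ ε : ℝ, |ε| ≤ 1 →
          ‖(X.flow (X.start t (q + ε • basisVec i a)) s).1 j - (X.flow (X.start t q) s).1 j‖
            ≤ C * decay i j * |ε| ∧
          ‖(X.flow (X.start t (q + ε • basisVec i a)) s).2 j - (X.flow (X.start t q) s).2 j‖
            ≤ C * decay i j * |ε| := by
    intro ε hε
    obtain ⟨x, v, p, f, hx, -, hxw⟩ := X.exists_isExtremal D (X.start t (q + ε • basisVec i a))
    obtain ⟨x', v', p', f', hx', -, hxw'⟩ := X.exists_isExtremal D (X.start t q)
    have e1 : x t = q + ε • basisVec i a := by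
      rw [← X.flow_start t (q + ε • basisVec i a), hxw]
    have e2 : x' t = q := by
      conv_rhs => rw [← X.flow_start t q, hxw']
    have h1 := hloc m hm P hFE hUE t x v p f x' v' p' f' t.2 (hx.mono t.2.2) (hx'.mono t.2.2)
      (by rw [e1]; exact add_smul_basisVec_mem_particleBall hm hr hε hq i a)
      (by rw [e2]; exact particleBall_mono hr (by linarith) hq)
      i (ε • EuclideanSpace.single a 1) (by
        rw [e1, e2, add_sub_cancel_left, basisVec, Pi.single_smul]) s ⟨s.2.1, hst⟩ j
    rw [norm_smul, PiLp.norm_single, norm_one, mul_one, Real.norm_eq_abs] at h1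
    rw [hxw, hxw']
    exact h1
  have hd1 := X.hasDerivAt_trajectory t s q (basisVec i a)
  have hnear : ∀ᶠ ε : ℝ in 𝓝 0, |ε| ≤ 1 := by
    filter_upwards [Metric.closedBall_mem_nhds (0 : ℝ) one_pos] with ε hε
    simpa using hε
  have hdec := decay_nonneg i j
  refine ⟨hdiff, ?_, ?_⟩
  · refine ((hasDerivAt_pi.1 hd1.fst) j).le_of_lip' (by positivity) ?_
    filter_upwards [hnear] with ε hε
    simpa using (hdiff ε hε).1
  · refine ((hasDerivAt_pi.1 hd1.snd) j).le_of_lip' (by positivity) ?_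
    filter_upwards [hnear] with ε hε
    simpa using (hdiff ε hε).2

/-! ### The estimate for the Hessian -/

theorem abs_meanInner_basisVec_le (hm : m ≠ 0) (p : Fin m → Pt d) (j : Fin m) (b : Fin d) :
    |meanInner d m p (basisVec j b)| ≤ (m : ℝ)⁻¹ * ‖p j‖ := by
  rw [meanInner_apply, Finset.sum_eq_single j, abs_mul, abs_of_nonneg (by positivity)]
  · refine mul_le_mul_of_nonneg_left ?_ (by positivity)
    refine (abs_real_inner_le_norm _ _).trans ?_
    simp [basisVec]
  · intro k _ hk
    simp [basisVec, Pi.single_eq_of_ne hk]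
  · simp

/-- The Hessian of the value function is the derivative of the momentum along a variation of the
trajectory, and the localization bound makes its `(i, j)` block of order `m⁻²` off the diagonal. -/
theorem IsRegular.exists_hessianEstimate (D : IsRegular κ H L F U₀) {T : ℝ} (hT : 0 ≤ T)
    {A : ℝ → ℝ} (hA : ∀ r, 0 < r → 0 < A r) {r : ℝ} (hr : 0 ≤ r) :
    ∃ C : ℝ, 0 < C ∧ ∀ (m : ℕ) (_ : m ≠ 0) (P : Equipartition d m),
      (∀ r, 0 < r → HessianEstimate (discretize P F) r (A r)) →
      (∀ r, 0 < r → HessianEstimate (discretize P U₀) r (A r)) →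
      ExtremalField P H F U₀ T hT → ∀ t ∈ Ioo 0 T,
      HessianEstimate (particleValue P L F U₀ t) r C := by
  obtain ⟨C, hC, htr⟩ := D.exists_trajectory_const hT hA hr
  refine ⟨C, hC, ?_⟩
  intro m hm P hFE hUE X t ht
  have ht' := Ioo_subset_Icc_self ht
  have hm' : (0 : ℝ) < m := by positivity
  refine ⟨(X.contDiff_particleValue D hm ⟨t, ht'⟩ ht).of_le (by norm_num), ?_⟩
  intro q hq i j a b
  have h1 := (htr m hm P hFE hUE X ⟨t, ht'⟩ ⟨t, ht'⟩ le_rfl q hq i a j).2.2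
  rw [iteratedFDeriv_two_apply]
  simp only [Matrix.cons_val_zero, Matrix.cons_val_one]
  rw [X.fderiv_fderiv_particleValue D hm ⟨t, ht'⟩ ht]
  refine (abs_meanInner_basisVec_le hm _ j b).trans
    ((mul_le_mul_of_nonneg_left h1 (by positivity)).trans (le_of_eq ?_))
  unfold decay
  by_cases hij : i = j
  · simp only [hij, if_true]
    field_simp
  · simp only [hij, Ne.symm hij, if_false]
    field_simp

end Solution

/-! ### The estimate for the time derivative -/

section TimeDerivative

open Filter Topology

variable {d m : ℕ} {κ : ℝ≥0} {H L : Pt d × Pt d → ℝ} {F U₀ : Hilb d → ℝ}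

theorem restrictTo_univ_variation_le {P : Equipartition d m} {T : ℝ} {hT : 0 ≤ T}
    (X : ExtremalField P H F U₀ T hT) (D : IsRegular κ H L F U₀) {C : ℝ}
    (hC : ∀ (t : ℝ)
      (x v p r x' v' p' r' : ℝ → Fin m → Pt d), t ∈ Icc 0 T → IsExtremal P H L F U₀ t x v p r →
      IsExtremal P H L F U₀ t x' v' p' r' →
      ∀ s ∈ Icc 0 t, ‖restrictTo Finset.univ (x s - x' s)‖ ≤
        C * ‖restrictTo Finset.univ (x t - x' t)‖ ∧
        ‖restrictTo Finset.univ (p s - p' s)‖ ≤ C * ‖restrictTo Finset.univ (x t - x' t)‖)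
    (hC0 : 0 ≤ C) (t : Icc 0 T) (q y : Fin m → Pt d) :
    ‖restrictTo Finset.univ (X.variation t q y t).2‖ ≤ C * ‖restrictTo Finset.univ y‖ := by
  have hd1 := (restrictTo Finset.univ).hasFDerivAt.comp_hasDerivAt (0 : ℝ)
    (X.hasDerivAt_trajectory t t q y).snd
  refine hd1.le_of_lip' (by positivity) (Eventually.of_forall fun ε => ?_)
  obtain ⟨x, v, p, f, hx, -, hxw⟩ := X.exists_isExtremal D (X.start t (q + ε • y))
  obtain ⟨x', v', p', f', hx', -, hxw'⟩ := X.exists_isExtremal D (X.start t q)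
  have e1 : x t = q + ε • y := by
    rw [← X.flow_start t (q + ε • y), hxw]
  have e2 : x' t = q := by
    conv_rhs => rw [← X.flow_start t q, hxw']
  have h1 := (hC t x v p f x' v' p' f' t.2 (hx.mono t.2.2) (hx'.mono t.2.2) t ⟨t.2.1, le_rfl⟩).2
  rw [e1, e2, add_sub_cancel_left, map_smul, norm_smul] at h1
  simp only [Function.comp_apply, zero_smul, add_zero, hxw, hxw', sub_zero]
  rw [← map_sub]
  refine h1.trans (le_of_eq ?_)
  ring

theorem abs_meanInner_le (p h : Fin m → Pt d) :
    |meanInner d m p h| ≤ (m : ℝ)⁻¹ * (‖restrictTo Finset.univ p‖ * ‖restrictTo Finset.univ h‖) := by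
  rw [meanInner_apply, ← inner_restrictTo, abs_mul, abs_of_nonneg (by positivity)]
  exact mul_le_mul_of_nonneg_left (abs_real_inner_le_norm _ _) (by positivity)

theorem norm_restrictTo_comp_le (hm : m ≠ 0) {g : Pt d × Pt d → Pt d} {K R : ℝ} (hK : 0 ≤ K)
    (hR : 0 ≤ R) (hg : ∀ z z', ‖g z - g z'‖ ≤ K * ‖z - z'‖) {q p : Fin m → Pt d}
    (hq : q ∈ particleBall d m R) (hp : p ∈ particleBall d m R) :
    ‖restrictTo Finset.univ (fun k => g (q k, p k))‖ ≤ √m * (2 * (‖g 0‖ + K * R)) := by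
  have hm' : (0 : ℝ) < m := by positivity
  refine norm_restrictTo_le (by positivity) ?_
  simp only [particleBall, mem_ofPred_eq, inv_mul_le_iff₀ hm'] at hq hp
  have h1 : ∀ k ∈ Finset.univ, ‖g (q k, p k)‖ ^ 2
      ≤ 2 * ‖g 0‖ ^ 2 + 2 * K ^ 2 * (‖q k‖ ^ 2 + ‖p k‖ ^ 2) := by
    intro k _
    have e1 := hg (q k, p k) 0
    rw [sub_zero] at e1
    have e2 := norm_prod_sq_le' (q k) (p k)
    have e3 := norm_add_le (g (q k, p k) - g 0) (g 0)
    rw [sub_add_cancel] at e3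
    have e4 := pow_le_pow_left₀ (norm_nonneg _) e1 2
    have e5 := mul_le_mul_of_nonneg_left e2 (sq_nonneg K)
    nlinarith [norm_nonneg (g (q k, p k)), sq_nonneg (‖g (q k, p k) - g 0‖ - ‖g 0‖)]
  refine (Finset.sum_le_sum h1).trans ?_
  rw [Finset.sum_add_distrib, ← Finset.mul_sum, ← Finset.mul_sum, Finset.sum_add_distrib, mul_pow,
    Real.sq_sqrt hm'.le]
  simp only [Finset.sum_const, Finset.card_univ, Fintype.card_fin, nsmul_eq_mul]
  have e1 := mul_le_mul_of_nonneg_left (add_le_add hq hp) (sq_nonneg K)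
  have e2 : 0 ≤ m * (‖g 0‖ * (K * R)) := by positivity
  have e3 : 0 ≤ (m : ℝ) * ‖g 0‖ ^ 2 := by positivity
  have e4 : 0 ≤ (m : ℝ) * (K ^ 2 * R ^ 2) := by positivity
  nlinarith

/-- A bound of the derivative with respect to the norm of `L²(Ω)` bounds the sum of the squared
partial gradients. -/
theorem sum_norm_partialGrad_sq_le (hm : m ≠ 0) {G : (Fin m → Pt d) → ℝ} {q : Fin m → Pt d} {c : ℝ}
    (hc : 0 ≤ c) (h : ∀ y, √m * |fderiv ℝ G q y| ≤ c * ‖restrictTo Finset.univ y‖) :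
    ∑ i, (m : ℝ) * ‖partialGrad G q i‖ ^ 2 ≤ c ^ 2 := by
  have hm' : (0 : ℝ) < m := by positivity
  set γ := partialGrad G q with hγ
  have h1 : fderiv ℝ G q γ = ∑ i, ‖γ i‖ ^ 2 := by
    have : γ = ∑ i, Pi.single i (γ i) := (Finset.univ_sum_single γ).symm
    conv_lhs => rw [this]
    rw [map_sum]
    refine Finset.sum_congr rfl fun i _ => ?_
    rw [← inner_partialGrad, ← real_inner_self_eq_norm_sq]
  have h2 := h γ
  rw [h1, ← norm_restrictTo_sq, abs_of_nonneg (sq_nonneg _)] at h2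
  rw [← Finset.mul_sum, ← norm_restrictTo_sq]
  have h3 : √m * ‖restrictTo Finset.univ γ‖ ≤ c := by
    rcases eq_or_ne ‖restrictTo Finset.univ γ‖ 0 with h0 | h0
    · rw [h0]; simpa using hc
    · have hpos : 0 < ‖restrictTo Finset.univ γ‖ := lt_of_le_of_ne (norm_nonneg _) (Ne.symm h0)
      refine le_of_mul_le_mul_right (le_trans (le_of_eq ?_) h2) hpos
      ring
  have h4 := pow_le_pow_left₀ (by positivity) h3 2
  rwa [mul_pow, Real.sq_sqrt hm'.le] at h4

/-- By the Hamilton-Jacobi equation `∂_t U = F - H(q, D_q U)`. The gradient of the right-hand side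
is bounded in mean square through the variation of the trajectories. -/
theorem IsRegular.exists_gradientEstimate (D : IsRegular κ H L F U₀) {T : ℝ} (hT : 0 ≤ T)
    {r : ℝ} (hr : 0 ≤ r) :
    ∃ C : ℝ, 0 < C ∧ ∀ (m : ℕ) (_ : m ≠ 0) (P : Equipartition d m),
      ContDiff ℝ 3 (discretize P F) → ExtremalField P H F U₀ T hT → ∀ t ∈ Ioo 0 T,
      (∀ q, DifferentiableAt ℝ (fun s => particleValue P L F U₀ s q) t) ∧
      GradientEstimate (fun q => deriv (fun s => particleValue P L F U₀ s q) t) r C := by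
  obtain ⟨C, hC, hst⟩ := D.exists_extremal_lipschitz_const hT
  obtain ⟨R, hR, hrad⟩ := D.exists_radius hT hr
  set c : ℝ := (‖fderiv ℝ F 0‖ + κ * r) + 2 * (‖gradFst H 0‖ + κ * (r + R))
    + 2 * (‖gradSnd H 0‖ + κ * (r + R)) * C with hc
  have hc0 : 0 ≤ c := by positivity
  refine ⟨c ^ 2 + 1, by positivity, ?_⟩
  intro m hm P hF3 X t ht
  have := P.isProbabilityMeasure hm
  have hm' : (0 : ℝ) < m := by positivity
  set τ : Icc 0 T := ⟨t, Ioo_subset_Icc_self ht⟩ with hτ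
  refine ⟨fun q => (X.hasDerivAt_particleValue_left D hm τ ht q).differentiableAt, ?_⟩
  have hfun : (fun q => deriv (fun s => particleValue P L F U₀ s q) t)
      = fun q => discretize P F q - (m : ℝ)⁻¹ * ∑ k, H (q k, X.momentum τ q k) :=
    funext fun q => (X.hasDerivAt_particleValue_left D hm τ ht q).deriv
  rw [hfun]
  have hpk : ∀ k : Fin m, ContDiff ℝ 1 fun q : Fin m → Pt d => (q k, X.momentum τ q k) := fun k =>
    (contDiff_apply ℝ (Pt d) k).prodMk
      ((contDiff_apply ℝ (Pt d) k).comp ((X.contDiff_momentum τ).of_le (by norm_num)))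
  have hsmooth : ContDiff ℝ 1 fun q => discretize P F q
      - (m : ℝ)⁻¹ * ∑ k, H (q k, X.momentum τ q k) :=
    (hF3.of_le (by norm_num)).sub (contDiff_const.mul (ContDiff.sum fun k _ =>
      (D.contDiff_hamiltonian.of_le (by norm_num)).comp (hpk k)))
  refine ⟨hsmooth, fun q hq => ?_⟩
  refine (sum_norm_partialGrad_sq_le hm hc0 fun y => ?_).trans (by linarith)
  have hp : X.momentum τ q ∈ particleBall d m R := by
    obtain ⟨x, v, p, f, hx, -, hxw⟩ := X.exists_isExtremal D (X.start τ q)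
    have h2 := hxw τ
    rw [X.flow_start_self, Prod.mk.injEq] at h2
    rw [h2.2]
    exact (hrad m hm P τ x v p f τ.2 (hx.mono τ.2.2) (by rw [← h2.1]; exact hq) τ
      ⟨τ.2.1, le_rfl⟩).2
  have hq' : q ∈ particleBall d m (r + R) := particleBall_mono hr (by linarith) hq
  have hp' : X.momentum τ q ∈ particleBall d m (r + R) :=
    particleBall_mono hR.le (by linarith) hp
  set y' : Fin m → Pt d := (X.variation τ q y τ).2 with hy'
  have hmom : HasFDerivAt (X.momentum τ) (fderiv ℝ (X.momentum τ) q) q :=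
    ((X.contDiff_momentum τ).differentiable (by norm_num) q).hasFDerivAt
  have hk : ∀ k, HasFDerivAt (fun q => H (q k, X.momentum τ q k))
      ((fderiv ℝ H (q k, X.momentum τ q k)).comp
        ((ContinuousLinearMap.proj (R := ℝ) (φ := fun _ : Fin m => Pt d) k).prod
          ((ContinuousLinearMap.proj (R := ℝ) (φ := fun _ : Fin m => Pt d) k).comp
            (fderiv ℝ (X.momentum τ) q)))) q := fun k =>
    (D.differentiable_hamiltonian _).hasFDerivAt.comp q
      (((ContinuousLinearMap.proj (R := ℝ) (φ := fun _ : Fin m => Pt d) k).hasFDerivAt).prodMk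
        ((ContinuousLinearMap.proj
          (R := ℝ) (φ := fun _ : Fin m => Pt d) k).hasFDerivAt.comp q hmom))
  have hder : fderiv ℝ (fun q => discretize P F q
      - (m : ℝ)⁻¹ * ∑ k, H (q k, X.momentum τ q k)) q y
      = fderiv ℝ F (stepMap P q) (stepMap P y)
        - (meanInner d m (fun k => gradFst H (q k, X.momentum τ q k)) y
          + meanInner d m (fun k => gradSnd H (q k, X.momentum τ q k)) y') := by
    have h1 : HasFDerivAt (fun q => discretize P F q
        - (m : ℝ)⁻¹ * ∑ k, H (q k, X.momentum τ q k)) _ q :=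
      (hasFDerivAt_discretize P D.differentiable_potential q).sub
      ((HasFDerivAt.fun_sum (u := Finset.univ) fun k _ => hk k).const_mul (m : ℝ)⁻¹)
    rw [h1.fderiv, meanInner_apply, meanInner_apply, ← mul_add, ← Finset.sum_add_distrib]
    simp only [sub_apply, smul_apply, sum_apply, ContinuousLinearMap.comp_apply,
      ContinuousLinearMap.prod_apply, ContinuousLinearMap.proj_apply, stepCLM_apply, smul_eq_mul,
      X.fderiv_momentum, fderiv_eq_inner_grad]
    rfl
  rw [hder]
  have e1 : √m * |fderiv ℝ F (stepMap P q) (stepMap P y)|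
      ≤ (‖fderiv ℝ F 0‖ + κ * r) * ‖restrictTo Finset.univ y‖ := by
    have h1 : ‖stepMap P q‖ ≤ r := by
      refine (pow_le_pow_iff_left₀ (norm_nonneg _) hr two_ne_zero).1 ?_
      rw [norm_stepMap_sq]; exact hq
    have h2 : ‖fderiv ℝ F (stepMap P q)‖ ≤ ‖fderiv ℝ F 0‖ + κ * r := by
      have h3 := D.lipschitz_potential.norm_sub_le (stepMap P q) 0
      rw [sub_zero] at h3
      have h4 := norm_add_le (fderiv ℝ F (stepMap P q) - fderiv ℝ F 0) (fderiv ℝ F 0)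
      rw [sub_add_cancel] at h4
      have h5 := mul_le_mul_of_nonneg_left h1 κ.coe_nonneg
      linarith
    have h3 : √m * ‖stepMap P y‖ = ‖restrictTo Finset.univ y‖ := by
      rw [← sq_eq_sq₀ (by positivity) (norm_nonneg _), mul_pow, Real.sq_sqrt hm'.le,
        norm_stepMap_sq, norm_restrictTo_sq, mul_inv_cancel_left₀ hm'.ne']
    have h4 := (fderiv ℝ F (stepMap P q)).le_opNorm (stepMap P y)
    rw [← h3, mul_left_comm]
    refine mul_le_mul_of_nonneg_left ?_ (Real.sqrt_nonneg _)
    exact h4.trans (mul_le_mul_of_nonneg_right h2 (norm_nonneg _))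
  have e2 : ∀ (g : Pt d × Pt d → Pt d), (∀ z z', ‖g z - g z'‖ ≤ κ * ‖z - z'‖) →
      ∀ h : Fin m → Pt d, √m * |meanInner d m (fun k => g (q k, X.momentum τ q k)) h|
        ≤ 2 * (‖g 0‖ + κ * (r + R)) * ‖restrictTo Finset.univ h‖ := by
    intro g hg h
    have h1 := norm_restrictTo_comp_le hm κ.2 (by positivity) hg hq' hp'
    have h2 := abs_meanInner_le (fun k => g (q k, X.momentum τ q k)) h
    calc √m * |meanInner d m (fun k => g (q k, X.momentum τ q k)) h|
        ≤ √m * ((m : ℝ)⁻¹ * (√m * (2 * (‖g 0‖ + κ * (r + R))) * ‖restrictTo Finset.univ h‖)) := by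
          refine mul_le_mul_of_nonneg_left (h2.trans ?_) (Real.sqrt_nonneg _)
          exact mul_le_mul_of_nonneg_left (mul_le_mul_of_nonneg_right h1 (norm_nonneg _))
            (by positivity)
      _ = (m : ℝ)⁻¹ * (√m * √m) * (2 * (‖g 0‖ + κ * (r + R)) * ‖restrictTo Finset.univ h‖) := by
          ring
      _ = _ := by
          rw [Real.mul_self_sqrt hm'.le, inv_mul_cancel₀ hm'.ne', one_mul]
  have e3 := e2 (gradFst H) (fun z z' => norm_gradFst_sub_le D.lipschitz_hamiltonian z z') y
  have e4 := e2 (gradSnd H) (fun z z' => norm_gradSnd_sub_le D.lipschitz_hamiltonian z z') y'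
  have e5 := restrictTo_univ_variation_le X D (hst m hm P) hC.le τ q y
  have e6 := mul_le_mul_of_nonneg_left e5
    (show 0 ≤ 2 * (‖gradSnd H 0‖ + κ * (r + R)) by positivity)
  set a := fderiv ℝ F (stepMap P q) (stepMap P y)
  set b := meanInner d m (fun k => gradFst H (q k, X.momentum τ q k)) y
  set e := meanInner d m (fun k => gradSnd H (q k, X.momentum τ q k)) y'
  have e7 : |a - (b + e)| ≤ |a| + (|b| + |e|) :=
    (abs_sub _ _).trans (add_le_add le_rfl (abs_add_le _ _))
  have e8 := mul_le_mul_of_nonneg_left e7 (Real.sqrt_nonneg m)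
  rw [hc, add_mul, add_mul]
  rw [mul_add, mul_add] at e8
  rw [← mul_assoc] at e6
  linarith

end TimeDerivative

/-! ### Variations of the extremals and the symplectic form -/

section Symplectic

open Filter Topology

variable {d m : ℕ} {κ : ℝ≥0} {H L : Pt d × Pt d → ℝ} {F U₀ : Hilb d → ℝ}

/-- The symplectic form of the phase space. -/
noncomputable def symplecticForm (d m : ℕ) : (Fin m → Pt d) × (Fin m → Pt d) →L[ℝ]
    (Fin m → Pt d) × (Fin m → Pt d) →L[ℝ] ℝ :=
  (meanInner d m).bilinearComp (ContinuousLinearMap.snd ℝ _ _) (ContinuousLinearMap.fst ℝ _ _)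
    - (meanInner d m).bilinearComp (ContinuousLinearMap.fst ℝ _ _) (ContinuousLinearMap.snd ℝ _ _)

theorem symplecticForm_apply (w w' : (Fin m → Pt d) × (Fin m → Pt d)) :
    symplecticForm d m w w' = meanInner d m w.2 w'.1 - meanInner d m w.1 w'.2 := by
  simp [symplecticForm, ContinuousLinearMap.bilinearComp]

theorem meanInner_comm (p h : Fin m → Pt d) : meanInner d m p h = meanInner d m h p := by
  simp only [meanInner_apply, real_inner_comm]

theorem symplecticForm_swap (w w' : (Fin m → Pt d) × (Fin m → Pt d)) :
    symplecticForm d m w w' = -symplecticForm d m w' w := by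
  rw [symplecticForm_apply, symplecticForm_apply, meanInner_comm w.2, meanInner_comm w.1]
  ring

theorem meanInner_scaledGrad (hm : m ≠ 0) (G : (Fin m → Pt d) → ℝ) (x h : Fin m → Pt d) :
    meanInner d m (scaledGrad G x) h = fderiv ℝ G x h := by
  have hm' : (m : ℝ) ≠ 0 := by exact_mod_cast hm
  have h1 : h = ∑ k, Pi.single k (h k) := (Finset.univ_sum_single h).symm
  conv_rhs => rw [h1]
  rw [map_sum, meanInner_apply, Finset.mul_sum]
  refine Finset.sum_congr rfl fun k _ => ?_
  rw [scaledGrad, real_inner_smul_left, inv_mul_cancel_left₀ hm', inner_partialGrad]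

theorem meanInner_fderiv_scaledGrad (hm : m ≠ 0) {G : (Fin m → Pt d) → ℝ} (hG : ContDiff ℝ 3 G)
    (x u h : Fin m → Pt d) :
    meanInner d m (fderiv ℝ (scaledGrad G) x u) h = fderiv ℝ (fderiv ℝ G) x u h := by
  have h1 : HasFDerivAt (scaledGrad G) (fderiv ℝ (scaledGrad G) x) x :=
    ((contDiff_scaledGrad (n := 2) (by exact_mod_cast hG)).differentiable
      (by norm_num) x).hasFDerivAt
  have h2 := (meanInner d m).hasFDerivAt.comp x h1
  have h3 : (meanInner d m) ∘ (scaledGrad G) = fderiv ℝ G := by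
    funext x
    ext h : 1
    exact meanInner_scaledGrad hm G x h
  rw [h3] at h2
  rw [h2.fderiv]
  rfl

/-- The phase of a single particle. -/
noncomputable def particlePhase (d : ℕ) {m : ℕ} (k : Fin m) :
    (Fin m → Pt d) × (Fin m → Pt d) →L[ℝ] Pt d × Pt d :=
  ((ContinuousLinearMap.proj (R := ℝ) (φ := fun _ : Fin m => Pt d) k).comp
    (ContinuousLinearMap.fst ℝ _ _)).prod
  ((ContinuousLinearMap.proj (R := ℝ) (φ := fun _ : Fin m => Pt d) k).comp
    (ContinuousLinearMap.snd ℝ _ _))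

@[simp] theorem particlePhase_apply (k : Fin m) (w : (Fin m → Pt d) × (Fin m → Pt d)) :
    particlePhase d k w = (w.1 k, w.2 k) := rfl

theorem symplecticForm_hamiltonianField (hm : m ≠ 0) (G : (Fin m → Pt d) → ℝ)
    (w u : (Fin m → Pt d) × (Fin m → Pt d)) :
    symplecticForm d m (hamiltonianField H G w) u
      = fderiv ℝ G w.1 u.1
        - (m : ℝ)⁻¹ * ∑ k, fderiv ℝ H (particlePhase d k w) (particlePhase d k u) := by
  rw [symplecticForm_apply, ← meanInner_scaledGrad hm]
  simp only [meanInner_apply, hamiltonianField, particlePhase_apply, fderiv_eq_inner_grad,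
    inner_add_left, inner_neg_left, Finset.sum_add_distrib, Finset.sum_neg_distrib]
  ring

/-- The linearization of the Hamiltonian field is symmetric with respect to the symplectic form,
being the second derivative of the Hamiltonian. -/
theorem symplecticForm_fderiv_hamiltonianField (hm : m ≠ 0) (hH : ContDiff ℝ 3 H)
    {G : (Fin m → Pt d) → ℝ} (hG : ContDiff ℝ 3 G)
    (w u u' : (Fin m → Pt d) × (Fin m → Pt d)) :
    symplecticForm d m (fderiv ℝ (hamiltonianField H G) w u) u'
      = fderiv ℝ (fderiv ℝ G) w.1 u.1 u'.1
        - (m : ℝ)⁻¹ * ∑ k, fderiv ℝ (fderiv ℝ H) (particlePhase d k w) (particlePhase d k u)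
          (particlePhase d k u') := by
  have hV : HasFDerivAt (hamiltonianField H G) (fderiv ℝ (hamiltonianField H G) w) w :=
    ((contDiff_hamiltonianField (n := 2) (by exact_mod_cast hH)
      (by exact_mod_cast hG)).differentiable (by norm_num) w).hasFDerivAt
  have h1 := ((symplecticForm d m).hasFDerivAt.comp w hV).clm_apply
    (hasFDerivAt_const u' w)
  have hGd : HasFDerivAt (fderiv ℝ G) (fderiv ℝ (fderiv ℝ G) w.1) w.1 :=
    ((hG.fderiv_right (m := 2) (by norm_num)).differentiable (by norm_num) _).hasFDerivAt
  have hHd : ∀ z, HasFDerivAt (fderiv ℝ H) (fderiv ℝ (fderiv ℝ H) z) z := fun z =>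
    ((hH.fderiv_right (m := 2) (by norm_num)).differentiable (by norm_num) _).hasFDerivAt
  have hGd' := (HasFDerivAt.comp (g := fderiv ℝ G) w hGd
    (hasFDerivAt_fst (𝕜 := ℝ) (p := w))).clm_apply (hasFDerivAt_const u'.1 w)
  have hHd' := fun k : Fin m => (HasFDerivAt.comp (g := fderiv ℝ H) w (hHd (particlePhase d k w))
    (particlePhase d k).hasFDerivAt).clm_apply (hasFDerivAt_const (particlePhase d k u') w)
  have h2 := hGd'.sub ((HasFDerivAt.fun_sum (u := Finset.univ) fun k _ => hHd' k).const_mul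
    (m : ℝ)⁻¹)
  have h3 := h1.unique (h2.congr_of_eventuallyEq (Eventually.of_forall fun w =>
    symplecticForm_hamiltonianField hm G w u'))
  have h4 := congrArg (fun D : (Fin m → Pt d) × (Fin m → Pt d) →L[ℝ] ℝ => D u) h3
  simpa using h4

namespace ExtremalField

variable {P : Equipartition d m} {T : ℝ} {hT : 0 ≤ T} (X : ExtremalField P H F U₀ T hT)

/-- The variations of the extremals solve the linearized system. -/
theorem exists_variation_eq (hH : ContDiff ℝ 3 H) (hF : ContDiff ℝ 3 (discretize P F))
    (hU : ContDiff ℝ 3 (discretize P U₀)) (t : Icc 0 T) (q a : Fin m → Pt d) :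
    ∃ y : ℝ → (Fin m → Pt d) × (Fin m → Pt d),
      (∀ s : Icc 0 T, X.variation t q a s = y s) ∧
      (∀ s : Icc 0 T, HasDerivAt y (fderiv ℝ (hamiltonianField H (discretize P F))
        (X.flow (X.start t q) s) (y s)) s) ∧
      (y 0).2 = fderiv ℝ (scaledGrad (discretize P U₀)) (X.start t q) (y 0).1 := by
  have hVs : ContDiff ℝ (2 : ℕ) (hamiltonianField H (discretize P F)) :=
    contDiff_hamiltonianField (n := 2) (by exact_mod_cast hH) (by exact_mod_cast hF)
  have hVd : ∀ w, HasFDerivAt (hamiltonianField H (discretize P F))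
      (fderiv ℝ (hamiltonianField H (discretize P F)) w) w := fun w =>
    (hVs.differentiable (by norm_num) w).hasFDerivAt
  set V' : C((Fin m → Pt d) × (Fin m → Pt d), ((Fin m → Pt d) × (Fin m → Pt d)) →L[ℝ]
      (Fin m → Pt d) × (Fin m → Pt d)) :=
    ⟨_, (hVs.continuous_fderiv (by norm_num))⟩ with hV'
  set W := fun q => X.flow (X.start t q) with hW
  have hWd : HasFDerivAt W (fderiv ℝ W q) q :=
    ((X.contDiff_trajectory t).differentiable (by norm_num) q).hasFDerivAt
  have hZd : HasFDerivAt (X.start t) (fderiv ℝ (X.start t) q) q :=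
    ((X.contDiff_start t).differentiable (by norm_num) q).hasFDerivAt
  have hΓd : HasFDerivAt (scaledGrad (discretize P U₀))
      (fderiv ℝ (scaledGrad (discretize P U₀)) (X.start t q)) (X.start t q) :=
    ((contDiff_scaledGrad (n := 2) (by exact_mod_cast hU)).differentiable
      (by norm_num) _).hasFDerivAt
  have hpost := (hasFDerivAt_postcomp (K := Icc 0 T) (f' := V') hVd
    ⟨_, X.continuous_field⟩ rfl (W q)).comp q hWd
  have hrhs := ((constOp (E := (Fin m → Pt d) × (Fin m → Pt d)) (Icc 0 T)).hasFDerivAt.comp q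
    (hZd.prodMk (hΓd.comp q hZd))).add ((primitiveOp T hT).hasFDerivAt.comp q hpost)
  have huniq := hWd.unique (hrhs.congr_of_eventuallyEq (Eventually.of_forall fun q =>
    X.flow_eq (X.start t q)))
  set η := fderiv ℝ (X.start t) q a with hη
  set A : C(Icc 0 T, (Fin m → Pt d) × (Fin m → Pt d)) :=
    pointwiseApply _ _ _ (V'.comp (W q)) (X.variation t q a) with hA
  have hvar : X.variation t q a = constOp _ (η, fderiv ℝ (scaledGrad (discretize P U₀))
      (X.start t q) η) + primitiveOp T hT A := by
    have := congrArg (fun D : (Fin m → Pt d) →L[ℝ] C(Icc 0 T, (Fin m → Pt d) × (Fin m → Pt d)) =>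
      D a) huniq
    exact this
  refine ⟨fun s => (η, fderiv ℝ (scaledGrad (discretize P U₀)) (X.start t q) η)
    + primitive T hT A s, fun s => ?_, fun s => ?_, ?_⟩
  · conv_lhs => rw [hvar]
    simp
  · have h1 := (hasDerivAt_primitive hT A s).const_add
      (η, fderiv ℝ (scaledGrad (discretize P U₀)) (X.start t q) η)
    rw [projIcc_val] at h1
    refine h1.congr_deriv ?_
    have h2 : X.variation t q a s = (η, fderiv ℝ (scaledGrad (discretize P U₀)) (X.start t q) η)
        + primitive T hT A s := by
      conv_lhs => rw [hvar]
      simp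
    beta_reduce
    rw [← h2]
    rfl
  · simp [primitive]

/-- The difference of the Hessians of the value function at two points, in terms of the second
derivatives of the data along the extremals through these points: the symplectic form of a variation
of the one and a variation of the other extremal would be constant if the two extremals were the
same. -/
theorem abs_fderiv_fderiv_particleValue_sub_le (D : IsRegular κ H L F U₀) (hm : m ≠ 0)
    (hF : ContDiff ℝ 3 (discretize P F)) (hU : ContDiff ℝ 3 (discretize P U₀)) (t : Icc 0 T)
    (ht : (t : ℝ) ∈ Ioo 0 T) (q q' a b : Fin m → Pt d) {B B₀ : ℝ}
    (hB₀ : ∀ s : Icc 0 T, (s : ℝ) = 0 →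
      |fderiv ℝ (fderiv ℝ (discretize P U₀)) (X.flow (X.start t q) s).1 (X.variation t q a s).1
        (X.variation t q' b s).1
      - fderiv ℝ (fderiv ℝ (discretize P U₀)) (X.flow (X.start t q') s).1 (X.variation t q a s).1
        (X.variation t q' b s).1| ≤ B₀)
    (hB : ∀ s : Icc 0 T, s ≤ t →
      |fderiv ℝ (fderiv ℝ (discretize P F)) (X.flow (X.start t q) s).1 (X.variation t q a s).1
        (X.variation t q' b s).1
      - fderiv ℝ (fderiv ℝ (discretize P F)) (X.flow (X.start t q') s).1 (X.variation t q a s).1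
        (X.variation t q' b s).1|
      + (m : ℝ)⁻¹ * ∑ k, |fderiv ℝ (fderiv ℝ H) (particlePhase d k (X.flow (X.start t q) s))
          (particlePhase d k (X.variation t q a s)) (particlePhase d k (X.variation t q' b s))
        - fderiv ℝ (fderiv ℝ H) (particlePhase d k (X.flow (X.start t q') s))
          (particlePhase d k (X.variation t q a s)) (particlePhase d k (X.variation t q' b s))|
      ≤ B) :
    |fderiv ℝ (fderiv ℝ (particleValue P L F U₀ t)) q a b
      - fderiv ℝ (fderiv ℝ (particleValue P L F U₀ t)) q' a b| ≤ B₀ + B * t := by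
  have hsym : ∀ {E : Type} [NormedAddCommGroup E] [NormedSpace ℝ E] {G : E → ℝ},
      ContDiff ℝ 3 G → ∀ x u u', fderiv ℝ (fderiv ℝ G) x u u' = fderiv ℝ (fderiv ℝ G) x u' u := by
    intro E _ _ G hG x u u'
    exact (hG.contDiffAt.isSymmSndFDerivAt (by simp; norm_num)) u u'
  obtain ⟨y, hy, hyd, hy0⟩ := X.exists_variation_eq D.contDiff_hamiltonian hF hU t q a
  obtain ⟨y', hy', hyd', hy0'⟩ := X.exists_variation_eq D.contDiff_hamiltonian hF hU t q' b
  set σ : ℝ → ℝ := fun s => symplecticForm d m (y s) (y' s) with hσ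
  have hfin : ∀ q a, (X.variation t q a t).1 = a := by
    intro q a
    have h1 : HasFDerivAt (fun q => (X.flow (X.start t q) t).1) _ q :=
      (X.hasFDerivAt_trajectory t t q).fst
    have h2 : HasFDerivAt (fun q => (X.flow (X.start t q) t).1)
        (ContinuousLinearMap.id ℝ (Fin m → Pt d)) q := by
      simp only [X.flow_start]
      exact hasFDerivAt_id q
    have h3 := congrArg (fun D : (Fin m → Pt d) →L[ℝ] (Fin m → Pt d) => D a) (h1.unique h2)
    exact h3
  have hσt : σ t = fderiv ℝ (fderiv ℝ (particleValue P L F U₀ t)) q a b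
      - fderiv ℝ (fderiv ℝ (particleValue P L F U₀ t)) q' a b := by
    rw [hsym (X.contDiff_particleValue D hm t ht) q', X.fderiv_fderiv_particleValue D hm t ht,
      X.fderiv_fderiv_particleValue D hm t ht, hσ]
    simp only
    rw [← hy, ← hy', symplecticForm_apply, hfin, hfin, meanInner_comm a]
  have h0 : (0 : ℝ) ∈ Icc 0 T := ⟨le_rfl, hT⟩
  have hstart : ∀ z, (X.flow z ⟨0, h0⟩).1 = z := by
    intro z
    obtain ⟨x, v, p, f, hx, hx0, hxw⟩ := X.exists_isExtremal D z
    rw [hxw]; exact hx0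
  have hσ0 : |σ 0| ≤ B₀ := by
    have h1 := hB₀ ⟨0, h0⟩ rfl
    rw [hstart, hstart, hy, hy'] at h1
    rw [hσ]
    simp only
    rw [symplecticForm_apply, meanInner_comm (y 0).1, hy0, hy0', meanInner_fderiv_scaledGrad hm hU,
      meanInner_fderiv_scaledGrad hm hU, hsym hU (X.start t q')]
    exact h1
  have hσd : ∀ s (hs : s ∈ Icc 0 T), HasDerivAt σ
      (symplecticForm d m (fderiv ℝ (hamiltonianField H (discretize P F))
        (X.flow (X.start t q) (projIcc 0 T hT s)) (y s)) (y' s)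
      + symplecticForm d m (y s) (fderiv ℝ (hamiltonianField H (discretize P F))
        (X.flow (X.start t q') (projIcc 0 T hT s)) (y' s))) s := fun s hs => by
    rw [projIcc_of_mem hT hs]
    exact ((symplecticForm d m).hasFDerivAt.comp_hasDerivAt s (hyd ⟨s, hs⟩)).clm_apply
        (hyd' ⟨s, hs⟩)
  have hmv := norm_image_sub_le_of_norm_deriv_le_segment' (f := σ) (a := 0) (b := t) (C := B)
    (fun s hs => (hσd s ⟨hs.1, hs.2.trans t.2.2⟩).hasDerivWithinAt) (fun s hs => ?_)
    t ⟨t.2.1, le_rfl⟩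
  · rw [hσt, sub_zero, Real.norm_eq_abs] at hmv
    have h1 := abs_sub_abs_le_abs_sub (fderiv ℝ (fderiv ℝ (particleValue P L F U₀ t)) q a b
      - fderiv ℝ (fderiv ℝ (particleValue P L F U₀ t)) q' a b) (σ 0)
    linarith
  · have hs' : s ∈ Icc 0 T := ⟨hs.1, hs.2.le.trans t.2.2⟩
    have h1 := hB ⟨s, hs'⟩ hs.2.le
    rw [hy ⟨s, hs'⟩, hy' ⟨s, hs'⟩] at h1
    rw [projIcc_of_mem hT hs', symplecticForm_swap (y s),
        symplecticForm_fderiv_hamiltonianField hm D.contDiff_hamiltonian hF,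
      symplecticForm_fderiv_hamiltonianField hm D.contDiff_hamiltonian hF, hsym hF _ (y' s).1]
    simp only [hsym D.contDiff_hamiltonian _ (particlePhase d _ (y' s)) (particlePhase d _ (y s))]
    refine le_trans ?_ h1
    rw [Real.norm_eq_abs]
    set α := fderiv ℝ (fderiv ℝ (discretize P F)) (X.flow (X.start t q) ⟨s, hs'⟩).1 (y s).1 (y' s).1
    set α' := fderiv ℝ (fderiv ℝ (discretize P F)) (X.flow (X.start t q') ⟨s, hs'⟩).1 (y s).1
        (y' s).1
    set β := fun k => fderiv ℝ (fderiv ℝ H) (particlePhase d k (X.flow (X.start t q) ⟨s, hs'⟩))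
      (particlePhase d k (y s)) (particlePhase d k (y' s))
    set β' := fun k => fderiv ℝ (fderiv ℝ H) (particlePhase d k (X.flow (X.start t q') ⟨s, hs'⟩))
      (particlePhase d k (y s)) (particlePhase d k (y' s))
    have h2 : α - (m : ℝ)⁻¹ * ∑ k, β k + -(α' - (m : ℝ)⁻¹ * ∑ k, β' k)
        = (α - α') - (m : ℝ)⁻¹ * ∑ k, (β k - β' k) := by
      rw [Finset.sum_sub_distrib]; ring
    refine (le_of_eq (congrArg _ h2)).trans ((abs_sub _ _).trans (add_le_add le_rfl ?_))
    rw [abs_mul, abs_of_nonneg (by positivity : (0 : ℝ) ≤ (m : ℝ)⁻¹)]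
    exact mul_le_mul_of_nonneg_left (Finset.abs_sum_le_sum_abs _ _) (by positivity)

end ExtremalField

end Symplectic

/-! ### The estimate for the third derivatives -/

section ThirdDerivative

open Filter Topology

section Line

variable {E : Type*} [NormedAddCommGroup E] [NormedSpace ℝ E]

theorem hasDerivAt_fderiv_fderiv_line {G : E → ℝ} (hG : ContDiff ℝ 3 G) (x y e e' : E) (s : ℝ) :
    HasDerivAt (fun s : ℝ => fderiv ℝ (fderiv ℝ G) (x + s • y) e e')
      (fderiv ℝ (fderiv ℝ (fderiv ℝ G)) (x + s • y) y e e') s := by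
  have h1 : HasDerivAt (fun s : ℝ => x + s • y) y s := by
    simpa using ((hasDerivAt_id s).smul_const y).const_add x
  have h2 : ContDiff ℝ 1 (fderiv ℝ (fderiv ℝ G)) :=
    (hG.fderiv_right (m := 2) (by norm_num)).fderiv_right (m := 1) (by norm_num)
  have h3 := (h2.differentiable (by norm_num) (x + s • y)).hasFDerivAt.comp_hasDerivAt s h1
  simpa using (h3.clm_apply (hasDerivAt_const s e)).clm_apply (hasDerivAt_const s e')

theorem abs_fderiv_fderiv_apply_sub_le {G : E → ℝ} (hG : ContDiff ℝ 3 G) {x y e e' : E} {B : ℝ}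
    (hB : ∀ z ∈ segment ℝ y x, |fderiv ℝ (fderiv ℝ (fderiv ℝ G)) z (x - y) e e'| ≤ B) :
    |fderiv ℝ (fderiv ℝ G) x e e' - fderiv ℝ (fderiv ℝ G) y e e'| ≤ B := by
  have := norm_image_sub_le_of_norm_deriv_le_segment' (C := B)
    (fun s (_ : s ∈ Icc (0 : ℝ) 1) =>
      (hasDerivAt_fderiv_fderiv_line hG y (x - y) e e' s).hasDerivWithinAt)
    (fun s hs => hB _ (by
      rw [segment_eq_image']
      exact ⟨s, ⟨hs.1, hs.2.le⟩, rfl⟩)) 1 (by simp)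
  simpa using this

theorem iteratedFDeriv_three_apply {G : E → ℝ} (x a b c : E) :
    iteratedFDeriv ℝ 3 G x ![a, b, c] = fderiv ℝ (fderiv ℝ (fderiv ℝ G)) x a b c := by
  rw [iteratedFDeriv_succ_apply_right, iteratedFDeriv_two_apply]
  rfl

theorem norm_fderiv_fderiv_sub_le_of_third {G : E → ℝ} (hG : ContDiff ℝ 3 G) {K : ℝ}
    (hK : ∀ x, ‖iteratedFDeriv ℝ 3 G x‖ ≤ K) (x y : E) :
    ‖fderiv ℝ (fderiv ℝ G) x - fderiv ℝ (fderiv ℝ G) y‖ ≤ K * ‖x - y‖ := by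
  have h2 : ContDiff ℝ 1 (fderiv ℝ (fderiv ℝ G)) :=
    (hG.fderiv_right (m := 2) (by norm_num)).fderiv_right (m := 1) (by norm_num)
  refine convex_univ.norm_image_sub_le_of_norm_fderiv_le (𝕜 := ℝ)
    (fun z _ => h2.differentiable (by norm_num) z) (fun z _ => ?_) (mem_univ y) (mem_univ x)
  rw [← norm_iteratedFDeriv_one, norm_iteratedFDeriv_fderiv, norm_iteratedFDeriv_fderiv]
  exact hK z

end Line

variable {d m : ℕ}

/-- The order of magnitude of the third derivatives of a mean field functional. -/
noncomputable def tripleWeight {m : ℕ} (i j k : Fin m) : ℝ :=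
  if i = j ∧ j = k then (m : ℝ)⁻¹ else ((m : ℝ) ^ 2)⁻¹

theorem inv_sq_le_tripleWeight (i j k : Fin m) : ((m : ℝ) ^ 2)⁻¹ ≤ tripleWeight i j k := by
  have hm : (1 : ℝ) ≤ m := by exact_mod_cast i.pos
  unfold tripleWeight
  split_ifs
  · exact inv_anti₀ (by positivity) (by nlinarith)
  · exact le_rfl

theorem tripleWeight_nonneg (i j k : Fin m) : 0 ≤ tripleWeight i j k :=
  le_trans (by positivity) (inv_sq_le_tripleWeight i j k)

theorem decay_le_one (i j : Fin m) : decay i j ≤ 1 := by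
  have hm : (1 : ℝ) ≤ m := by exact_mod_cast i.pos
  unfold decay
  split_ifs
  · exact le_rfl
  · exact inv_le_one_of_one_le₀ hm

theorem sum_decay_le (i : Fin m) : ∑ l, decay i l ≤ 2 := by
  have hm : (m : ℝ) ≠ 0 := by exact_mod_cast i.pos.ne'
  have h1 : ∀ l ∈ Finset.univ, decay i l ≤ (if l = i then 1 else 0) + (m : ℝ)⁻¹ := by
    intro l _
    unfold decay
    split_ifs
    · have : (0 : ℝ) ≤ (m : ℝ)⁻¹ := by positivity
      linarith
    · linarith
  refine (Finset.sum_le_sum h1).trans (le_of_eq ?_)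
  rw [Finset.sum_add_distrib]
  simp [hm]
  norm_num

theorem decay_mul_decay_le {i j : Fin m} (hij : i ≠ j) (l : Fin m) :
    decay i l * decay j l ≤ (m : ℝ)⁻¹ * (decay i l + decay j l) := by
  have hi := decay_nonneg i l
  have hj := decay_nonneg j l
  have hm : (0 : ℝ) ≤ (m : ℝ)⁻¹ := by positivity
  have h : decay i l = (m : ℝ)⁻¹ ∨ decay j l = (m : ℝ)⁻¹ := by
    by_cases hl : l = i
    · right
      simp [decay, hl, hij]
    · left
      simp [decay, hl]
  rcases h with h | h <;> rw [h] at * <;> nlinarith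

theorem sum_decay_mul_decay_le {i j : Fin m} (hij : i ≠ j) :
    ∑ l, decay i l * decay j l ≤ 4 * (m : ℝ)⁻¹ := by
  refine (Finset.sum_le_sum fun l _ => decay_mul_decay_le hij l).trans ?_
  rw [← Finset.mul_sum, Finset.sum_add_distrib, mul_comm]
  refine mul_le_mul_of_nonneg_right ?_ (by positivity)
  linarith [sum_decay_le i, sum_decay_le j]

/-- The contribution of the one-particle terms, which carry the factor `m⁻¹`. -/
theorem inv_mul_sum_decay_le (i j k : Fin m) :
    (m : ℝ)⁻¹ * ∑ l, decay i l * decay j l * decay k l ≤ 4 * tripleWeight i j k := by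
  have hm : (0 : ℝ) ≤ (m : ℝ)⁻¹ := by positivity
  have hn := fun i l : Fin m => decay_nonneg i l
  have h1 := fun i l : Fin m => decay_le_one i l
  by_cases hij : i = j
  · by_cases hjk : j = k
    · have h2 : ∑ l, decay i l * decay j l * decay k l ≤ ∑ l, decay i l :=
        Finset.sum_le_sum fun l _ => by
          rw [mul_assoc]
          exact mul_le_of_le_one_right (hn i l) (mul_le_one₀ (h1 j l) (hn k l) (h1 k l))
      rw [tripleWeight, if_pos ⟨hij, hjk⟩]
      nlinarith [sum_decay_le i]
    · have h2 : ∑ l, decay i l * decay j l * decay k l ≤ ∑ l, decay j l * decay k l :=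
        Finset.sum_le_sum fun l _ => by
          rw [mul_assoc]
          exact mul_le_of_le_one_left (mul_nonneg (hn j l) (hn k l)) (h1 i l)
      rw [tripleWeight, if_neg (fun h => hjk h.2), sq, mul_inv]
      nlinarith [sum_decay_mul_decay_le hjk]
  · have h2 : ∑ l, decay i l * decay j l * decay k l ≤ ∑ l, decay i l * decay j l :=
      Finset.sum_le_sum fun l _ =>
        mul_le_of_le_one_right (mul_nonneg (hn i l) (hn j l)) (h1 k l)
    rw [tripleWeight, if_neg (fun h => hij h.1), sq, mul_inv]
    nlinarith [sum_decay_mul_decay_le hij]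

/-- The weights of the third derivatives are stable under the decay of the trajectories. -/
theorem sum_tripleWeight_mul_decay_le (i j k : Fin m) :
    ∑ l, ∑ a, ∑ b, tripleWeight l a b * (decay i l * (decay j a * decay k b))
      ≤ 12 * tripleWeight i j k := by
  have hn := fun i l : Fin m => decay_nonneg i l
  have h1 : ∀ l a b : Fin m, tripleWeight l a b * (decay i l * (decay j a * decay k b))
      ≤ (if l = a then (if a = b then (m : ℝ)⁻¹ * (decay i l *
          (decay j a * decay k b)) else 0) else 0)
        + ((m : ℝ) ^ 2)⁻¹ * (decay i l * (decay j a * decay k b)) := by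
    intro l a b
    have h0 : 0 ≤ decay i l * (decay j a * decay k b) :=
      mul_nonneg (hn i l) (mul_nonneg (hn j a) (hn k b))
    have h2 : 0 ≤ ((m : ℝ) ^ 2)⁻¹ * (decay i l * (decay j a * decay k b)) :=
      mul_nonneg (by positivity) h0
    unfold tripleWeight
    by_cases hla : l = a
    · by_cases hab : a = b
      · rw [if_pos ⟨hla, hab⟩, if_pos hla, if_pos hab]
        linarith
      · rw [if_neg (fun h => hab h.2), if_pos hla, if_neg hab]
        linarith
    · rw [if_neg (fun h => hla h.1), if_neg hla]
      linarith
  refine (Finset.sum_le_sum fun l _ => Finset.sum_le_sum fun a _ => Finset.sum_le_sum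
    fun b _ => h1 l a b).trans ?_
  simp only [Finset.sum_add_distrib, Finset.sum_ite_eq, Finset.mem_univ, if_true,
      Finset.sum_ite_irrel,
    Finset.sum_const_zero, ← Finset.mul_sum, ← Finset.sum_mul]
  have e1 := inv_mul_sum_decay_le i j k
  simp only [mul_assoc] at e1
  have e2 : (∑ l, decay i l) * ((∑ l, decay j l) * ∑ l, decay k l) ≤ 2 * (2 * 2) := by
    have hs : ∀ i : Fin m, 0 ≤ ∑ l, decay i l := fun i => Finset.sum_nonneg fun l _ => hn i l
    exact mul_le_mul (sum_decay_le i) (mul_le_mul (sum_decay_le j) (sum_decay_le k) (hs k)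
      (by norm_num)) (mul_nonneg (hs j) (hs k)) (by norm_num)
  have e3 := inv_sq_le_tripleWeight i j k
  have e4 : (0 : ℝ) ≤ ((m : ℝ) ^ 2)⁻¹ := by positivity
  nlinarith

/-- A trilinear form on `𝕄^m` is controlled by its entries. -/
theorem abs_trilinear_le (Θ : (Fin m → Pt d) →L[ℝ] (Fin m → Pt d) →L[ℝ] (Fin m → Pt d) →L[ℝ] ℝ)
    {β : Fin m → Fin m → Fin m → ℝ}
    (h : ∀ l j k a b c, |Θ (basisVec l a) (basisVec j b) (basisVec k c)| ≤ β l j k)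
    (u v w : Fin m → Pt d) :
    |Θ u v w| ≤ d ^ 3 * ∑ l, ∑ j, ∑ k, β l j k * (‖u l‖ * (‖v j‖ * ‖w k‖)) := by
  have h1 : ∀ l a j b, ‖Θ (basisVec l a) (basisVec j b) w‖ ≤ d * ∑ k, β l j k * ‖w k‖ :=
    fun l a j b => norm_apply_le_of_basisVec (Θ (basisVec l a) (basisVec j b))
      (fun k c => h l j k a b c) w
  have h2 : ∀ l a, ‖Θ (basisVec l a) v w‖ ≤ d * ∑ j, (d * ∑ k, β l j k * ‖w k‖) * ‖v j‖ :=
    fun l a => norm_apply_le_of_basisVec ((Θ (basisVec l a)).flip w) (fun j b => h1 l a j b) v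
  have h3 := norm_apply_le_of_basisVec ((Θ.flip v).flip w) (fun l a => h2 l a) u
  refine h3.trans (le_of_eq ?_)
  simp only [Finset.mul_sum, Finset.sum_mul]
  refine Finset.sum_congr rfl fun l _ => Finset.sum_congr rfl fun j _ =>
    Finset.sum_congr rfl fun k _ => ?_
  ring

theorem ThirdDerivativeEstimate.abs_sub_le (hm : m ≠ 0) {G : (Fin m → Pt d) → ℝ} {R B : ℝ}
    (hR : 0 ≤ R) (hB : 0 ≤ B) (hG : ThirdDerivativeEstimate G R B) {x y u v : Fin m → Pt d}
    (hx : x ∈ particleBall d m R) (hy : y ∈ particleBall d m R) {i j k : Fin m} {C ε : ℝ}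
    (hC : 0 ≤ C) (hε : 0 ≤ ε)
    (hxy : ∀ l, ‖x l - y l‖ ≤ C * decay i l * ε) (hu : ∀ l, ‖u l‖ ≤ C * decay j l)
    (hv : ∀ l, ‖v l‖ ≤ C * decay k l) :
    |fderiv ℝ (fderiv ℝ G) x u v - fderiv ℝ (fderiv ℝ G) y u v|
      ≤ 12 * d ^ 3 * B * C ^ 3 * tripleWeight i j k * ε := by
  refine abs_fderiv_fderiv_apply_sub_le hG.1 fun z hz => ?_
  have hzb := (convex_particleBall hm hR).segment_subset hy hx hz
  have h1 : ∀ l a b (e f g : Fin d), |fderiv ℝ (fderiv ℝ (fderiv ℝ G)) z (basisVec l e)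
      (basisVec a f) (basisVec b g)| ≤ B * tripleWeight l a b := by
    intro l a b e f g
    have := hG.2 z hzb l a b e f g
    rw [iteratedFDeriv_three_apply] at this
    refine this.trans (le_of_eq ?_)
    unfold tripleWeight
    split_ifs <;> rw [div_eq_mul_inv]
  refine (abs_trilinear_le _ h1 (x - y) u v).trans ?_
  have h2 : ∀ l a b, B * tripleWeight l a b * (‖(x - y) l‖ * (‖u a‖ * ‖v b‖))
      ≤ B * C ^ 3 * ε * (tripleWeight l a b * (decay i l * (decay j a * decay k b))) := by
    intro l a b
    have e1 : ‖(x - y) l‖ * (‖u a‖ * ‖v b‖)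
        ≤ (C * decay i l * ε) * ((C * decay j a) * (C * decay k b)) :=
      mul_le_mul (hxy l) (mul_le_mul (hu a) (hv b) (norm_nonneg _)
        (mul_nonneg hC (decay_nonneg _ _))) (by positivity)
        (mul_nonneg (mul_nonneg hC (decay_nonneg _ _)) hε)
    refine (mul_le_mul_of_nonneg_left e1 (mul_nonneg hB (tripleWeight_nonneg _ _ _))).trans
      (le_of_eq ?_)
    ring
  have h3 := Finset.sum_le_sum fun l (_ : l ∈ Finset.univ) => Finset.sum_le_sum
    fun a (_ : a ∈ Finset.univ) => Finset.sum_le_sum fun b (_ : b ∈ Finset.univ) => h2 l a b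
  simp only [← Finset.mul_sum] at h3
  have h4 := mul_le_mul_of_nonneg_left (sum_tripleWeight_mul_decay_le i j k)
    (show 0 ≤ B * C ^ 3 * ε by positivity)
  refine (mul_le_mul_of_nonneg_left (h3.trans h4) (by positivity)).trans (le_of_eq ?_)
  ring

variable {κ : ℝ≥0} {H L : Pt d × Pt d → ℝ} {F U₀ : Hilb d → ℝ}

/-- The symplectic identity for two trajectories bounds the increment of the Hessian by sums of
increments of second derivatives of the data, weighted by the decay of the variations. -/
theorem IsRegular.exists_thirdDerivativeEstimate (D : IsRegular κ H L F U₀) {T : ℝ} (hT : 0 ≤ T)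
    {A A₃ : ℝ → ℝ} (hA : ∀ r, 0 < r → 0 < A r) (hA₃ : ∀ r, 0 < r → 0 ≤ A₃ r) {K : ℝ}
    (hK : ∀ z, ‖iteratedFDeriv ℝ 3 H z‖ ≤ K) {r : ℝ} (hr : 0 ≤ r) :
    ∃ C : ℝ, 0 < C ∧ ∀ (m : ℕ) (_ : m ≠ 0) (P : Equipartition d m),
      (∀ r, 0 < r → HessianEstimate (discretize P F) r (A r)) →
      (∀ r, 0 < r → HessianEstimate (discretize P U₀) r (A r)) →
      (∀ r, 0 < r → ThirdDerivativeEstimate (discretize P F) r (A₃ r)) →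
      (∀ r, 0 < r → ThirdDerivativeEstimate (discretize P U₀) r (A₃ r)) →
      ExtremalField P H F U₀ T hT → ∀ t ∈ Ioo 0 T,
      ThirdDerivativeEstimate (particleValue P L F U₀ t) r C := by
  obtain ⟨C, hC, htr⟩ := D.exists_trajectory_const hT hA (r := r + 1) (by positivity)
  obtain ⟨R, hR, hrad⟩ := D.exists_radius hT (r := r + 1) (by positivity)
  have hK0 : 0 ≤ K := (norm_nonneg _).trans (hK 0)
  have hA₃R := hA₃ R hR
  set M : ℝ := 12 * d ^ 3 * A₃ R * C ^ 3 with hM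
  have hM0 : 0 ≤ M := by positivity
  refine ⟨M + (M + 4 * K * C ^ 3) * T + 1, by positivity, ?_⟩
  intro m hm P hFE hUE hF3 hU3 X t ht
  set τ : Icc 0 T := ⟨t, Ioo_subset_Icc_self ht⟩ with hτ
  have hsm := X.contDiff_particleValue D hm τ ht
  refine ⟨hsm, fun q hq i j k a b c => ?_⟩
  rw [iteratedFDeriv_three_apply]
  have hball : ∀ q ∈ particleBall d m (r + 1), ∀ s : Icc 0 T, s ≤ τ →
      (X.flow (X.start τ q) s).1 ∈ particleBall d m R := by
    intro q hq s hs
    obtain ⟨x, v, p, f, hx, -, hxw⟩ := X.exists_isExtremal D (X.start τ q)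
    have h2 := hxw τ
    rw [X.flow_start_self, Prod.mk.injEq] at h2
    rw [hxw]
    exact (hrad m hm P τ x v p f τ.2 (hx.mono τ.2.2) (by rw [← h2.1]; exact hq) s
      ⟨s.2.1, hs⟩).1
  have hq1 : q ∈ particleBall d m (r + 1) := particleBall_mono hr (by linarith) hq
  have hw := tripleWeight_nonneg i j k
  have hdiff : ∀ ε : ℝ, |ε| ≤ 1 →
      |fderiv ℝ (fderiv ℝ (particleValue P L F U₀ t)) (q + ε • basisVec i a) (basisVec j b)
          (basisVec k c)
        - fderiv ℝ (fderiv ℝ (particleValue P L F U₀ t)) q (basisVec j b) (basisVec k c)|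
      ≤ (M + (M + 4 * K * C ^ 3) * T) * tripleWeight i j k * |ε| := by
    intro ε hε
    set q' := q + ε • basisVec i a with hq'
    have hq'1 : q' ∈ particleBall d m (r + 1) :=
      add_smul_basisVec_mem_particleBall hm hr hε hq i a
    have hdx := fun (s : Icc 0 T) (hs : s ≤ τ) (l : Fin m) =>
      (htr m hm P hFE hUE X τ s hs q hq1 i a l).1 ε hε
    have hva := fun (s : Icc 0 T) (hs : s ≤ τ) (l : Fin m) =>
      (htr m hm P hFE hUE X τ s hs q' hq'1 j b l).2
    have hvb := fun (s : Icc 0 T) (hs : s ≤ τ) (l : Fin m) =>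
      (htr m hm P hFE hUE X τ s hs q hq1 k c l).2
    have hmean : ∀ G, (∀ r, 0 < r → ThirdDerivativeEstimate (discretize P G) r (A₃ r)) →
        ∀ s : Icc 0 T, s ≤ τ →
        |fderiv ℝ (fderiv ℝ (discretize P G)) (X.flow (X.start τ q') s).1
          (X.variation τ q' (basisVec j b) s).1 (X.variation τ q (basisVec k c) s).1
        - fderiv ℝ (fderiv ℝ (discretize P G)) (X.flow (X.start τ q) s).1
          (X.variation τ q' (basisVec j b) s).1 (X.variation τ q (basisVec k c) s).1|
        ≤ M * tripleWeight i j k * |ε| := fun G hG s hs =>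
      (hG R hR).abs_sub_le hm hR.le hA₃R (hball q' hq'1 s hs) (hball q hq1 s hs) hC.le
        (abs_nonneg ε) (fun l => (hdx s hs l).1) (fun l => (hva s hs l).1)
        (fun l => (hvb s hs l).1)
    have hham : ∀ s : Icc 0 T, s ≤ τ →
        (m : ℝ)⁻¹ * ∑ l, |fderiv ℝ (fderiv ℝ H) (particlePhase d l (X.flow (X.start τ q') s))
          (particlePhase d l (X.variation τ q' (basisVec j b) s))
          (particlePhase d l (X.variation τ q (basisVec k c) s))
        - fderiv ℝ (fderiv ℝ H) (particlePhase d l (X.flow (X.start τ q) s))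
          (particlePhase d l (X.variation τ q' (basisVec j b) s))
          (particlePhase d l (X.variation τ q (basisVec k c) s))|
        ≤ 4 * K * C ^ 3 * tripleWeight i j k * |ε| := by
      intro s hs
      have h1 : ∀ l ∈ Finset.univ,
          |fderiv ℝ (fderiv ℝ H) (particlePhase d l (X.flow (X.start τ q') s))
            (particlePhase d l (X.variation τ q' (basisVec j b) s))
            (particlePhase d l (X.variation τ q (basisVec k c) s))
          - fderiv ℝ (fderiv ℝ H) (particlePhase d l (X.flow (X.start τ q) s))
            (particlePhase d l (X.variation τ q' (basisVec j b) s))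
            (particlePhase d l (X.variation τ q (basisVec k c) s))|
          ≤ K * C ^ 3 * |ε| * (decay i l * decay j l * decay k l) := by
        intro l _
        have e1 : ‖particlePhase d l (X.flow (X.start τ q') s)
            - particlePhase d l (X.flow (X.start τ q) s)‖ ≤ C * decay i l * |ε| :=
          max_le (hdx s hs l).1 (hdx s hs l).2
        have e2 : ‖particlePhase d l (X.variation τ q' (basisVec j b) s)‖ ≤ C * decay j l :=
          max_le (hva s hs l).1 (hva s hs l).2
        have e3 : ‖particlePhase d l (X.variation τ q (basisVec k c) s)‖ ≤ C * decay k l :=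
          max_le (hvb s hs l).1 (hvb s hs l).2
        have e4 := norm_fderiv_fderiv_sub_le_of_third D.contDiff_hamiltonian hK
          (particlePhase d l (X.flow (X.start τ q') s)) (particlePhase d l (X.flow (X.start τ q) s))
        have e6 := ContinuousLinearMap.le_opNorm₂
          (fderiv ℝ (fderiv ℝ H) (particlePhase d l (X.flow (X.start τ q') s))
            - fderiv ℝ (fderiv ℝ H) (particlePhase d l (X.flow (X.start τ q) s)))
          (particlePhase d l (X.variation τ q' (basisVec j b) s))
          (particlePhase d l (X.variation τ q (basisVec k c) s))
        rw [sub_apply, sub_apply, Real.norm_eq_abs] at e6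
        refine e6.trans ?_
        have e5 := mul_le_mul (mul_le_mul (e4.trans (mul_le_mul_of_nonneg_left e1 hK0)) e2
          (norm_nonneg _) (mul_nonneg hK0 (mul_nonneg (mul_nonneg hC.le (decay_nonneg _ _))
            (abs_nonneg ε)))) e3 (norm_nonneg _)
          (mul_nonneg (mul_nonneg hK0 (mul_nonneg (mul_nonneg hC.le (decay_nonneg _ _))
            (abs_nonneg ε))) (mul_nonneg hC.le (decay_nonneg _ _)))
        refine e5.trans (le_of_eq ?_)
        ring
      have h2 := mul_le_mul_of_nonneg_left (Finset.sum_le_sum h1)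
        (show (0 : ℝ) ≤ (m : ℝ)⁻¹ by positivity)
      refine h2.trans ?_
      rw [← Finset.mul_sum, mul_left_comm]
      have h3 := mul_le_mul_of_nonneg_left (inv_mul_sum_decay_le i j k)
        (show 0 ≤ K * C ^ 3 * |ε| by positivity)
      refine h3.trans (le_of_eq ?_)
      ring
    have hkey := X.abs_fderiv_fderiv_particleValue_sub_le D hm (hF3 R hR).1 (hU3 R hR).1 τ ht q' q
      (basisVec j b) (basisVec k c) (B₀ := M * tripleWeight i j k * |ε|)
      (B := M * tripleWeight i j k * |ε| + 4 * K * C ^ 3 * tripleWeight i j k * |ε|)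
      (fun s hs => hmean U₀ hU3 s (Subtype.coe_le_coe.1 (by rw [hs]; exact τ.2.1)))
      (fun s hs => add_le_add (hmean F hF3 s hs) (hham s hs))
    refine hkey.trans ?_
    have h5 : (M * tripleWeight i j k * |ε| + 4 * K * C ^ 3 * tripleWeight i j k * |ε|) * t
        ≤ (M * tripleWeight i j k * |ε| + 4 * K * C ^ 3 * tripleWeight i j k * |ε|) * T :=
      mul_le_mul_of_nonneg_left ht.2.le (by positivity)
    calc M * tripleWeight i j k * |ε|
          + (M * tripleWeight i j k * |ε| + 4 * K * C ^ 3 * tripleWeight i j k * |ε|) * t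
        ≤ M * tripleWeight i j k * |ε|
          + (M * tripleWeight i j k * |ε| + 4 * K * C ^ 3 * tripleWeight i j k * |ε|) * T := by
          linarith
      _ = _ := by ring
  have hder := hasDerivAt_fderiv_fderiv_line hsm q (basisVec i a) (basisVec j b) (basisVec k c) 0
  rw [zero_smul, add_zero] at hder
  have hle := hder.le_of_lip' (C := (M + (M + 4 * K * C ^ 3) * T) * tripleWeight i j k)
    (by positivity) (by
      filter_upwards [Metric.closedBall_mem_nhds (0 : ℝ) one_pos] with ε hε
      have := hdiff ε (by simpa using hε)
      simpa using this)
  rw [Real.norm_eq_abs] at hle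
  have hle2 : |fderiv ℝ (fderiv ℝ (fderiv ℝ (particleValue P L F U₀ t))) q (basisVec i a)
      (basisVec j b) (basisVec k c)|
      ≤ (M + (M + 4 * K * C ^ 3) * T + 1) * tripleWeight i j k :=
    hle.trans (mul_le_mul_of_nonneg_right (by linarith) hw)
  refine hle2.trans (le_of_eq ?_)
  unfold tripleWeight
  split_ifs <;> rw [div_eq_mul_inv]

end ThirdDerivative

/-! ### The constants -/

section Constants

variable {d m : ℕ} {G : (Fin m → Pt d) → ℝ} {r C C' : ℝ}

theorem HessianEstimate.mono (h : HessianEstimate G r C) (hC : C ≤ C') :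
    HessianEstimate G r C' := by
  refine ⟨h.1, fun q hq i j a b => (h.2 q hq i j a b).trans ?_⟩
  split_ifs <;> gcongr

theorem ThirdDerivativeEstimate.mono (h : ThirdDerivativeEstimate G r C) (hC : C ≤ C') :
    ThirdDerivativeEstimate G r C' := by
  refine ⟨h.1, fun q hq i j k a b c => (h.2 q hq i j k a b c).trans ?_⟩
  split_ifs <;> gcongr

theorem GradientEstimate.mono (h : GradientEstimate G r C) (hC : C ≤ C') :
    GradientEstimate G r C' :=
  ⟨h.1, fun q hq => (h.2 q hq).trans hC⟩

end Constants

end ParticleHJ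

theorem mainTheorem4
    (d : ℕ) (hd : 1 ≤ d) (N : ℕ) (hN : 2 ≤ N) (T : ℝ) (hT : 0 < T)
    (mstar lam0 lam1 kap3 : ℝ) (kap0 : ℝ≥0)
    (hlam1 : 0 < lam1) (hkap3 : 0 < kap3) (hkap0 : 0 < kap0)
    (H L : Pt d × Pt d → ℝ) (F U₀ : Hilb d → ℝ)
    -- the partitions of the cube used for the discretization, one for each `m ≥ 1`
    (P : ∀ m : ℕ+, Equipartition d m)
    -- `F̃` and `Ũ₀` are `C^{1,1}` on `ℍ`, bounded from below and rearrangement invariant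
    (hFdiff : Differentiable ℝ F) (hFlip : LipschitzWith kap0 (fderiv ℝ F))
    (hUdiff : Differentiable ℝ U₀) (hUlip : LipschitzWith kap0 (fderiv ℝ U₀))
    (hFnonneg : ∀ x, 0 ≤ F x) (hUbelow : ∀ x, mstar ≤ U₀ x)
    (hFinv : RearrangementInvariant F) (hUinv : RearrangementInvariant U₀)
    (hUconv : ConvexOn ℝ univ U₀)
    -- regularity, duality, ellipticity and growth of `H` and `L`
    (hHsmooth : ContDiff ℝ ((N + 1 : ℕ) : WithTop ℕ∞) H)
    (hLsmooth : ContDiff ℝ ((N + 1 : ℕ) : WithTop ℕ∞) L)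
    (hLnonneg : ∀ z, 0 ≤ L z) (hdual : LegendreDual H L)
    (hLvv : ∀ q v w : Pt d,
      kap3 * ‖w‖ ^ 2 ≤ iteratedFDeriv ℝ 2 (fun y => L (q, y)) v ![w, w])
    (hHpp : ∀ q p w : Pt d, w ≠ 0 →
      0 < iteratedFDeriv ℝ 2 (fun y => H (q, y)) p ![w, w])
    (hHlip : LipschitzWith kap0 (fderiv ℝ H)) (hLlip : LipschitzWith kap0 (fderiv ℝ L))
    (hLcoer : ∀ q v : Pt d, lam1 * ‖v‖ ^ 2 + lam0 ≤ L (q, v))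
    (hLconv : StrictConvexOn ℝ univ
      (fun z : Hilb d × Hilb d => liftedLagrangian L F z.1 z.2))
    -- `F^{(m)}`, `U_0^{(m)}` are `C³` and satisfy the Hessian estimates uniformly in `m`
    (C₀ : ℝ → ℝ) (hC₀pos : ∀ r, 0 < r → 0 < C₀ r) (hC₀mono : MonotoneOn C₀ (Ioi 0))
    (hF3 : ∀ m : ℕ+, ContDiff ℝ 3 (discretize (P m) F))
    (hU3 : ∀ m : ℕ+, ContDiff ℝ 3 (discretize (P m) U₀))
    (hFest : ∀ m : ℕ+, ∀ r, 0 < r → HessianEstimate (discretize (P m) F) r (C₀ r))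
    (hUest : ∀ m : ℕ+, ∀ r, 0 < r → HessianEstimate (discretize (P m) U₀) r (C₀ r)) :
    (∀ m : ℕ+, IsViscositySolution T H (discretize (P m) F) (discretize (P m) U₀)
      (particleValue (P m) L F U₀)) ∧
    ∀ r : ℝ, 0 < r → ∀ t ∈ Ioo 0 T, ∃ C : ℝ, 0 < C ∧
      (∀ m : ℕ+, HessianEstimate (particleValue (P m) L F U₀ t) r C) ∧
      (UniformThirdDerivativeEstimate (fun m => discretize (P m) U₀) →
        UniformThirdDerivativeEstimate (fun m => discretize (P m) F) →
        BoundedThirdDerivatives H →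
        ∀ m : ℕ+, ThirdDerivativeEstimate (particleValue (P m) L F U₀ t) r C) ∧
      (LinearGrowthDq H → LinearGrowthDq L →
        ∀ m : ℕ+,
          (∀ q, DifferentiableAt ℝ (fun s => particleValue (P m) L F U₀ s q) t) ∧
          GradientEstimate (fun q => deriv (fun s => particleValue (P m) L F U₀ s q) t) r C) := by
  have D : IsRegular kap0 H L F U₀ := by
    have h3 : (3 : WithTop ℕ∞) ≤ ((N + 1 : ℕ) : WithTop ℕ∞) := by
      exact_mod_cast (by lia : 3 ≤ N + 1)
    exact ⟨hd, hkap0, hHsmooth.of_le h3, hLsmooth.of_le h3, hdual, hHlip, hLlip, hFdiff, hFlip,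
      hFinv, hUdiff, hUlip, hUinv, hLconv.convexOn, hUconv⟩
  have hm : ∀ m : ℕ+, (m : ℕ) ≠ 0 := fun m => m.ne_zero
  let X : ∀ m : ℕ+, ExtremalField (P m) H F U₀ T hT.le := fun m =>
    (D.nonempty_extremalField (hm m) (P m) (hF3 m) (hU3 m) hT.le).some
  refine ⟨fun m => (X m).isViscositySolution D (hm m), fun r hr t ht => ?_⟩
  obtain ⟨C₁, hC₁, h₁⟩ := D.exists_hessianEstimate hT.le hC₀pos hr.le
  obtain ⟨C₃, hC₃, h₃⟩ := D.exists_gradientEstimate hT.le hr.le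
  -- the constant has to be chosen before the additional hypotheses are available
  have h₂ : ∃ C₂ : ℝ, UniformThirdDerivativeEstimate (fun m => discretize (P m) U₀) →
      UniformThirdDerivativeEstimate (fun m => discretize (P m) F) → BoundedThirdDerivatives H →
      ∀ m : ℕ+, ThirdDerivativeEstimate (particleValue (P m) L F U₀ t) r C₂ := by
    by_cases h : UniformThirdDerivativeEstimate (fun m => discretize (P m) U₀) ∧
      UniformThirdDerivativeEstimate (fun m => discretize (P m) F) ∧ BoundedThirdDerivatives H
    · obtain ⟨⟨B, -, hB⟩, ⟨B', -, hB'⟩, K, hK⟩ := h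
      obtain ⟨C₂, -, h₂⟩ := D.exists_thirdDerivativeEstimate hT.le hC₀pos
        (A₃ := fun r => max 0 (max (B r) (B' r))) (fun _ _ => le_max_left _ _) hK hr.le
      exact ⟨C₂, fun _ _ _ m => h₂ m (hm m) (P m) (hFest m) (hUest m)
        (fun r hr => (hB' m r hr).mono ((le_max_right _ _).trans (le_max_right _ _)))
        (fun r hr => (hB m r hr).mono ((le_max_left _ _).trans (le_max_right _ _))) (X m) t ht⟩
    · exact ⟨0, fun hU hF hH => absurd ⟨hU, hF, hH⟩ h⟩
  obtain ⟨C₂, h₂⟩ := h₂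
  refine ⟨max C₁ (max C₂ C₃), lt_max_of_lt_left hC₁, fun m => ?_, fun hU hF hH m => ?_,
    fun _ _ m => ⟨?_, ?_⟩⟩
  · exact (h₁ m (hm m) (P m) (hFest m) (hUest m) (X m) t ht).mono (le_max_left _ _)
  · exact (h₂ hU hF hH m).mono ((le_max_left _ _).trans (le_max_right _ _))
  · exact (h₃ m (hm m) (P m) (hF3 m) (X m) t ht).1
  · exact (h₃ m (hm m) (P m) (hF3 m) (X m) t ht).2.mono
      ((le_max_right _ _).trans (le_max_right _ _))
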